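/- Let $m\ge 0$ and let $R_m$ be the ring of formal power series of bounded degree in $x_1,x_2,\dots$ over $\mathbb Q(q,t)$ that are symmetric in $x_{m+1},x_{m+2},\dots$. An $m$-partition is a pair $\Lambda=(\pmb a;\lambda)$ with $\pmb a\in\mathbb Z_{\ge 0}^m$ and $\lambda$ a partition; it is dominant if $a_1\ge\dots\ge a_m$. Throughout, $\Lambda=(\pmb a;\lambda)$ and $\Omega=(\pmb b;\mu)$. Let $$T_i=t+\frac{tx_i-x_{i+1}}{x_i-x_{i+1}}(K_{i,i+1}-1),$$ where $K_{i,i+1}$ exchanges $x_i$ and $x_{i+1}$. For $\eta\in\mathbb Z_{\ge0}^N$, the nonsymmetric Macdonald polynomial $E_\eta(x_1,\dots,x_N;q,t)$ is the polynomial over $\mathbb Q(q,t)$ with coefficient $1$ on $x^\eta$ such that $Y_iE_\eta=q^{\eta_i}t^{1-r_\eta(i)}E_\eta$ for $1\le i\le N$. Here $Y_i=t^{-N+i}T_i\cdots T_{N-1}\,\omega\, T_1^{-1}\cdots T_{i-1}^{-1}$, with $(\omega f)(x_1,\dots,x_N)=f(qx_N,x_1,\dots,x_{N-1})$, and $r_\eta(i)=1+\#\{j:\eta_j>\eta_i\}+\#\{j<i:\eta_j=\eta_i\}$.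 The nonsymmetric Hall–Littlewood polynomial is $H_{\pmb a}(x_1,\dots,x_m;t)=E_{\pmb a}(x_1,\dots,x_m;0,t)$. Put $k_\Lambda(x;t)=H_{\pmb a}(x_1,\dots,x_m;t)\,s_\lambda(x)$, where $s_\lambda(x)$ is the Schur function in all the variables $x_1,x_2,\dots$. The $k_\Lambda$ form a basis of $R_m$. Let $\langle\cdot,\cdot\rangle_m$ be the bilinear form on $R_m$ with $\langle k_\Lambda,k_\Omega\rangle_m=\delta_{\Lambda\Omega}$, and let $T_i^*$ be the adjoint of $T_i$ ($1\le i\le m-1$). For dominant $\Lambda$, let $\mathcal S_{\Lambda\Omega}$ be the set of skew tableaux $T$ of shape $(\pmb a\cup\lambda)/\mu$ in which each letter $i\in\{1,\dots,m\}$ appears $b_i$ times, always within the first $a_i$ columns; here $\pmb a\cup\lambda$ is the partition obtained by reordering the entries of $\pmb a$ and $\lambda$. For $T\in\mathcal S_{\Lambda\Omega}$, let $\bar T$ be the skew tableau of shape $\mu/\lambda$ in the letters $\bar m<\dots<\bar 1$ such that, for every $i$ and every $c\le a_i$, the letter $\bar i$ is in column $c$ of $\bar T$ iff $i$ is not in column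 $c$ of $T$, and such that $\bar i$ appears in no column $c>a_i$. Read its rows from bottom to top, each from left to right, and append the word $\bar 1^{a_1-a_1}\bar 2^{a_1-a_2}\cdots\bar m^{a_1-a_m}$. Replace each $\bar i$ by $m+1-i$, and let $c(T)$ be the (Lascoux–Schützenberger) charge of the resulting word, where a word of non-dominant evaluation is first brought to dominant evaluation by the action of the symmetric group on words. Define $$D_{\Lambda\Omega}(t)=\sum_{T\in\mathcal S_{\Lambda\Omega}}t^{\#\{i<j\,:\,b_i<b_j\}+c(T)}.$$ The dual $m$-symmetric Schur functions $s^*_\Lambda(x;t)$ are defined by $s_\Lambda^*=\sum_\Omega D_{\Lambda\Omega}(t)\,k_\Omega$ for dominant $\Lambda$, and by $s^*_{\Lambda}=t^{-1}T_i^*s^*_{(s_i\pmb a;\lambda)}$ if $a_i<a_{i+1}$, where $s_i\pmb a$ is $\pmb a$ with $a_i$ and $a_{i+1}$ exchanged. The $m$-symmetric Schur functions $s_\Lambda(x;t)\in R_m$ are determined by $\langle s_\Lambda,s^*_\Omega\rangle_m=\delta_{\Lambda\Omega}$ for all $\Lambda,\Omega$. **Proposition.** For every $\pmb b\in\mathbb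 Z_{\ge 0}^m$ and $\Omega=(\pmb b;\emptyset)$, $$s_\Omega(x;t)=k_\Omega(x;t)=H_{\pmb b}(x_1,\dots,x_m;t).$$ In particular, every nonsymmetric Hall–Littlewood polynomial $H_{\pmb b}(x_1,\dots,x_m;t)$ is one of the $m$-symmetric Schur functions. -/

import Mathlib

namespace MSym

/-! ## Scalars -/

/-- The field `ℚ(t)`. -/
abbrev Kt : Type := RatFunc ℚ

/-- The field `ℚ(q,t)`, presented as rational functions in `q` over `ℚ(t)`. -/
abbrev K : Type := RatFunc Kt

/-- The parameter `t`. -/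
noncomputable def t : K := RatFunc.C (RatFunc.X : Kt)

/-- The parameter `q`. -/
noncomputable def q : K := RatFunc.X

/-- Specialisation `q = 0` of a scalar that is regular at `q = 0`. -/
noncomputable def atZero (c : K) : Kt := RatFunc.eval (RingHom.id Kt) 0 c

/-! ## Hecke operators -/

open Classical in
/-- The exact quotient `f / g`, for `g ∣ f` in an integral domain (and `0` if `g ∤ f`). -/
noncomputable def exactQuot {A : Type*} [CommRing A] (f g : A) : A :=
  if h : g ∣ f then h.choose else 0

/-- `f ↦ t f + (t u - v) / (u - v) * (κ f - f)`, where `κ` exchanges the variables `u` and `v`. -/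
noncomputable def heckeOp {A : Type*} [CommRing A] [Algebra K A] (u v : A) (κ : A →ₐ[K] A)
    (f : A) : A :=
  t • f + (t • u - v) * exactQuot (κ f - f) (u - v)

/-! ## Nonsymmetric Macdonald polynomials in `N` variables `X 0, …, X (N-1)` -/

/-- The operator `T_{i+1}` on `ℚ(q,t)[x_1,…,x_N]`, meaningful for `i + 1 < N`; it involves the
variables `X i` and `X (i+1)`. -/
noncomputable def polyT {N : ℕ} (i : ℕ) (f : MvPolynomial (Fin N) K) : MvPolynomial (Fin N) K :=
  if h : i + 1 < N then
    heckeOp (MvPolynomial.X ⟨i, by omega⟩) (MvPolynomial.X ⟨i + 1, h⟩)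
      (MvPolynomial.rename (Equiv.swap (⟨i, by omega⟩ : Fin N) ⟨i + 1, h⟩)) f
  else f

/-- `T_{i+1}⁻¹ = t⁻¹ - 1 + t⁻¹ T_{i+1}`. -/
noncomputable def polyTinv {N : ℕ} (i : ℕ) (f : MvPolynomial (Fin N) K) :
    MvPolynomial (Fin N) K :=
  (t⁻¹ - 1) • f + t⁻¹ • polyT i f

/-- `ω = K_{N-1,N} ⋯ K_{1,2} τ_1`, that is, `(ω f)(x_1,…,x_N) = f (q x_N, x_1, …, x_{N-1})`. -/
noncomputable def polyOmega {N : ℕ} :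
    MvPolynomial (Fin N) K →ₐ[K] MvPolynomial (Fin N) K :=
  MvPolynomial.aeval fun j : Fin N =>
    if (j : ℕ) = 0 then q • MvPolynomial.X (⟨N - 1, by have := j.isLt; omega⟩ : Fin N)
    else MvPolynomial.X (⟨j - 1, by have := j.isLt; omega⟩ : Fin N)

/-- The Cherednik operator
`Y_{i+1} = t^{-N+i+1} T_{i+1} ⋯ T_{N-1} ω T_1⁻¹ ⋯ T_i⁻¹` (for `i : Fin N`). -/
noncomputable def cherednik {N : ℕ} (i : Fin N) (f : MvPolynomial (Fin N) K) :
    MvPolynomial (Fin N) K :=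
  t ^ ((i : ℤ) + 1 - N) •
    (List.range' i (N - 1 - i)).foldr polyT
      (polyOmega ((List.range i).foldr polyTinv f))

/-- `r_η(i) - 1`, where `r_η(i)` is the row containing the `i`-circle in the diagram of the
composition `η`: rows are ordered by decreasing length, circles in rows of equal length
increase from top to bottom. -/
def circleRow {N : ℕ} (η : Fin N → ℕ) (i : Fin N) : ℕ :=
  (Finset.univ.filter fun j => η i < η j ∨ (η j = η i ∧ j < i)).card

/-- `E` is the nonsymmetric Macdonald polynomial indexed by `η`: the common eigenfunction of the
Cherednik operators with eigenvalues `q ^ η_i * t ^ (1 - r_η(i))`, normalised to be monic, that is,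
with coefficient `1` on `x ^ η`. -/
def IsMacdonald {N : ℕ} (η : Fin N → ℕ) (E : MvPolynomial (Fin N) K) : Prop :=
  MvPolynomial.coeff (Finsupp.equivFunOnFinite.symm η) E = 1 ∧
    ∀ i : Fin N, cherednik i E = (q ^ η i * t ^ (-(circleRow η i : ℤ))) • E

/-- The nonsymmetric Macdonald polynomial `E_η(x_1,…,x_N;q,t)`. -/
noncomputable def macdonald {N : ℕ} (η : Fin N → ℕ) : MvPolynomial (Fin N) K :=
  Classical.epsilon (IsMacdonald η)

/-- The nonsymmetric Hall–Littlewood polynomial `H_a(x_1,…,x_m;t) = E_a(x_1,…,x_m;0,t)`. -/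
noncomputable def hallLittlewood {m : ℕ} (a : Fin m → ℕ) : MvPolynomial (Fin m) Kt :=
  ∑ n ∈ (macdonald a).support,
    MvPolynomial.monomial n (atZero (MvPolynomial.coeff n (macdonald a)))

/-! ## The ring of `m`-symmetric functions

The variables `x_1, x_2, …` are `X 0, X 1, …`. -/

/-- `R_m`: the formal power series of bounded degree over `ℚ(q,t)` that are symmetric in
`x_{m+1}, x_{m+2}, …`. -/
noncomputable def R (m : ℕ) : Subalgebra K (MvPowerSeries ℕ K) where
  carrier := {f | (∃ d : ℕ, ∀ n : ℕ →₀ ℕ, d < n.degree → MvPowerSeries.coeff n f = 0) ∧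
    ∀ σ : Equiv.Perm ℕ, (∀ i < m, σ i = i) → MvPowerSeries.rename σ f = f}
  mul_mem' := by
    rintro f g ⟨⟨d, hd⟩, hf⟩ ⟨⟨e, he⟩, hg⟩
    refine ⟨⟨d + e, fun n hn => ?_⟩, fun σ hσ => by rw [map_mul, hf σ hσ, hg σ hσ]⟩
    classical
    rw [MvPowerSeries.coeff_mul]
    refine Finset.sum_eq_zero fun p hp => ?_
    have h := Finset.HasAntidiagonal.mem_antidiagonal.1 hp
    have h2 : p.1.degree + p.2.degree = n.degree := by rw [← h, map_add]
    rcases lt_or_ge d p.1.degree with h3 | h3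
    · rw [hd _ h3, zero_mul]
    · rw [he _ (by omega), mul_zero]
  add_mem' := by
    rintro f g ⟨⟨d, hd⟩, hf⟩ ⟨⟨e, he⟩, hg⟩
    refine ⟨⟨d + e, fun n hn => ?_⟩, fun σ hσ => by rw [map_add, hf σ hσ, hg σ hσ]⟩
    rw [map_add, hd n (by omega), he n (by omega), add_zero]
  algebraMap_mem' c := by
    refine ⟨⟨0, fun n hn => ?_⟩, fun σ _ => AlgHom.commutes _ _⟩
    classical
    rw [MvPowerSeries.algebraMap_apply, MvPowerSeries.coeff_C, if_neg]
    rintro rfl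
    simp at hn

/-- The variable `x_{i+1}`, `i < m`, as an element of `R_m`. -/
noncomputable def xvar {m : ℕ} (i : Fin m) : R m :=
  ⟨MvPowerSeries.X (i : ℕ), by
    refine ⟨⟨1, fun n hn => ?_⟩, fun σ hσ => by rw [MvPowerSeries.rename_X, hσ i i.isLt]⟩
    classical
    rw [MvPowerSeries.coeff_X, if_neg]
    rintro rfl
    simp at hn⟩

/-- The inclusion of `ℚ(q,t)[x_1,…,x_m]` into `R_m`. -/
noncomputable def ofPoly (m : ℕ) : MvPolynomial (Fin m) K →ₐ[K] R m :=
  MvPolynomial.aeval xvar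

/-- The complete homogeneous symmetric function `h_r(x_1,x_2,…)`, the sum of all monomials of
degree `r`. -/
noncomputable def hsym (m r : ℕ) : R m :=
  ⟨fun n : ℕ →₀ ℕ => if n.degree = r then 1 else 0, by
    have hc : ∀ n : ℕ →₀ ℕ, MvPowerSeries.coeff n
        (fun n : ℕ →₀ ℕ => if n.degree = r then (1 : K) else 0 : MvPowerSeries ℕ K) =
          if n.degree = r then 1 else 0 := fun n => rfl
    refine ⟨⟨r, fun n hn => by rw [hc, if_neg (by omega)]⟩, fun σ _ => ?_⟩
    ext n
    have hn : n = Finsupp.embDomain σ.toEmbedding (Finsupp.embDomain σ.symm.toEmbedding n) := by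
      rw [Finsupp.embDomain_eq_mapDomain, Finsupp.embDomain_eq_mapDomain,
        ← Finsupp.mapDomain_comp]
      simp
    have key := MvPowerSeries.coeff_embDomain_rename σ.toEmbedding
      (fun n : ℕ →₀ ℕ => if n.degree = r then (1 : K) else 0 : MvPowerSeries ℕ K)
      (Finsupp.embDomain σ.symm.toEmbedding n)
    rw [← hn] at key
    refine key.trans ?_
    rw [hc, hc, Finsupp.embDomain_eq_mapDomain, Finsupp.degree_mapDomain]⟩

/-- The Schur function `s_λ(x) = det (h_{λ_i - i + j})`, where `h_r = 0` for `r < 0`. -/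
noncomputable def schur (m : ℕ) (lam : YoungDiagram) : R m :=
  Matrix.det (Matrix.of fun i j : Fin (lam.colLen 0) =>
    if (lam.rowLen i : ℤ) - i + j < 0 then 0
    else hsym m ((lam.rowLen i : ℤ) - i + j).toNat)

/-- `m`-partitions `(a; λ)`. -/
abbrev MPartition (m : ℕ) : Type := (Fin m → ℕ) × YoungDiagram

/-- `H_a(x_1,…,x_m;t)` as an element of `R_m`. -/
noncomputable def HL {m : ℕ} (a : Fin m → ℕ) : R m :=
  ofPoly m (MvPolynomial.map (RatFunc.C : Kt →+* K) (hallLittlewood a))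

/-- `k_Λ(x;t) = H_a(x_1,…,x_m;t) s_λ(x)`. -/
noncomputable def kfun {m : ℕ} (L : MPartition m) : R m := HL L.1 * schur m L.2

open Classical in
/-- The scalar product `⟨·,·⟩_m` on `R_m`: the bilinear form for which the basis `k_Λ(x;t)` is
self-dual. -/
noncomputable def form (m : ℕ) : LinearMap.BilinForm K (R m) :=
  if h : ∃ B : LinearMap.BilinForm K (R m), ∀ L O : MPartition m,
    B (kfun L) (kfun O) = if L = O then 1 else 0 then h.choose else 0

/-! ### The operators `T_i` on `R_m` and their adjoints -/

/-- `κ_{i,j}`, the exchange of the variables `X i` and `X j` in a power series. -/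
noncomputable def psSwap (i j : ℕ) : MvPowerSeries ℕ K →ₐ[K] MvPowerSeries ℕ K :=
  MvPowerSeries.rename (Equiv.swap i j)

theorem coeff_psSwap (i j : ℕ) (f : MvPowerSeries ℕ K) (n : ℕ →₀ ℕ) :
    MvPowerSeries.coeff n (psSwap i j f) =
      MvPowerSeries.coeff (n.mapDomain (Equiv.swap i j)) f := by
  have hn : n = Finsupp.embDomain (Equiv.swap i j).toEmbedding
      (n.mapDomain (Equiv.swap i j)) := by
    rw [Finsupp.embDomain_eq_mapDomain]
    have h : n = n.mapDomain ((Equiv.swap i j) ∘ (Equiv.swap i j)) := by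
      have : ((Equiv.swap i j) ∘ (Equiv.swap i j) : ℕ → ℕ) = id := by
        funext x; simp
      rw [this, Finsupp.mapDomain_id]
    rw [Finsupp.mapDomain_comp] at h
    exact h
  have key := MvPowerSeries.coeff_embDomain_rename (Equiv.swap i j).toEmbedding f
      (n.mapDomain (Equiv.swap i j))
  rw [← hn] at key
  exact key

/-- `X i - X j` divides `κ_{i,j} f - f`, with a quotient of bounded degree if `f` has bounded
degree. -/
theorem exists_psQuot {i j : ℕ} (hij : i ≠ j) (f : MvPowerSeries ℕ K) :
    ∃ g : MvPowerSeries ℕ K,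
      (MvPowerSeries.X i - MvPowerSeries.X j) * g = psSwap i j f - f ∧
      ∀ d : ℕ, (∀ n : ℕ →₀ ℕ, d < n.degree → MvPowerSeries.coeff n f = 0) →
        ∀ n : ℕ →₀ ℕ, d < n.degree → MvPowerSeries.coeff n g = 0 := by
  classical
  set F : MvPowerSeries ℕ K := psSwap i j f - f with hF
  let sh : (ℕ →₀ ℕ) → ℕ → (ℕ →₀ ℕ) := fun n k =>
    n - Finsupp.single i k + Finsupp.single j k
  have shv : ∀ n k x, sh n k x = n x - (if i = x then k else 0) + (if j = x then k else 0) := by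
    intro n k x
    simp [sh, Finsupp.single_apply]
  let g : MvPowerSeries ℕ K := fun n =>
    -∑ k ∈ Finset.range (n i + 1), MvPowerSeries.coeff (sh n k + Finsupp.single j 1) F
  have hg : ∀ n, MvPowerSeries.coeff n g =
      -∑ k ∈ Finset.range (n i + 1), MvPowerSeries.coeff (sh n k + Finsupp.single j 1) F :=
    fun n => rfl
  have hX : ∀ (a : ℕ) (n : ℕ →₀ ℕ) (h : MvPowerSeries ℕ K),
      MvPowerSeries.coeff n (MvPowerSeries.X a * h) =
        if n a = 0 then 0 else MvPowerSeries.coeff (n - Finsupp.single a 1) h := by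
    intro a n h
    rw [MvPowerSeries.X_def, MvPowerSeries.coeff_monomial_mul]
    by_cases h0 : n a = 0
    · rw [if_neg, if_pos h0]
      intro hle
      have := hle a
      simp [h0] at this
    · rw [if_pos, if_neg h0, one_mul]
      rw [Finsupp.single_le_iff]
      omega
  have hdeg : ∀ (n : ℕ →₀ ℕ) (k : ℕ), k ≤ n i → (sh n k).degree = n.degree := by
    intro n k hk
    have hle : Finsupp.single i k ≤ n := Finsupp.single_le_iff.2 hk
    have h1 : n - Finsupp.single i k + Finsupp.single i k = n := tsub_add_cancel_of_le hle
    have h2 := congrArg Finsupp.degree h1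
    rw [map_add, Finsupp.degree_single] at h2
    simp only [sh]
    rw [map_add, Finsupp.degree_single]
    exact h2
  have hanti : ∀ n : ℕ →₀ ℕ,
      MvPowerSeries.coeff (n.mapDomain (Equiv.swap i j)) F = -MvPowerSeries.coeff n F := by
    intro n
    rw [hF, map_sub, map_sub, coeff_psSwap, coeff_psSwap, ← Finsupp.mapDomain_comp]
    have : ((Equiv.swap i j) ∘ (Equiv.swap i j) : ℕ → ℕ) = id := by
      funext x; simp
    rw [this, Finsupp.mapDomain_id]
    ring
  refine ⟨g, ?_, ?_⟩
  · ext n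
    rw [sub_mul, map_sub, hX, hX]
    have e1 : (if n i = 0 then 0 else MvPowerSeries.coeff (n - Finsupp.single i 1) g) =
        -∑ k ∈ Finset.range (n i), MvPowerSeries.coeff (sh n (k + 1)) F := by
      split_ifs with h0
      · simp [h0]
      · rw [hg]
        have h1 : (n - Finsupp.single i 1 : ℕ →₀ ℕ) i + 1 = n i := by
          simp; omega
        rw [h1]
        congr 1
        refine Finset.sum_congr rfl fun k _ => ?_
        congr 1
        congr 1
        ext x
        simp only [Finsupp.add_apply, shv, Finsupp.tsub_apply, Finsupp.single_apply]
        split_ifs <;> omega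
    have e2 : ∑ k ∈ Finset.range (n i + 1), MvPowerSeries.coeff (sh n k) F =
        MvPowerSeries.coeff n F +
          ∑ k ∈ Finset.range (n i), MvPowerSeries.coeff (sh n (k + 1)) F := by
      rw [Finset.sum_range_succ', add_comm]
      congr 2
      congr 1
      ext x
      simp [shv]
    rw [e1]
    by_cases h0 : n j = 0
    · rw [if_pos h0, sub_zero]
      have e3 : ∑ k ∈ Finset.range (n i + 1), MvPowerSeries.coeff (sh n k) F = 0 := by
        have e4 : ∑ k ∈ Finset.range (n i + 1), MvPowerSeries.coeff (sh n k) F =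
            -∑ k ∈ Finset.range (n i + 1), MvPowerSeries.coeff (sh n k) F := by
          conv_lhs => rw [← Finset.sum_range_reflect]
          rw [← Finset.sum_neg_distrib]
          refine Finset.sum_congr rfl fun k hk => ?_
          have hk := Finset.mem_range.1 hk
          rw [← hanti]
          congr 2
          ext x
          have hm : (sh n k).mapDomain (Equiv.swap i j) x = sh n k (Equiv.swap i j x) := by
            conv_lhs => rw [show x = Equiv.swap i j (Equiv.swap i j x) by simp]
            rw [Finsupp.mapDomain_apply (Equiv.swap i j).injective]
          rw [hm, shv, shv]
          by_cases hxi : x = i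
          · subst hxi
            rw [Equiv.swap_apply_left]
            simp [hij, hij.symm, h0]
            omega
          · by_cases hxj : x = j
            · subst hxj
              rw [Equiv.swap_apply_right]
              simp [hij, hij.symm, h0]
            · rw [Equiv.swap_apply_of_ne_of_ne hxi hxj]
              simp [Ne.symm hxi, Ne.symm hxj]
        linear_combination (1 / 2 : K) * e4
      rw [e2] at e3
      linear_combination -e3
    · rw [if_neg h0, hg]
      have e5 : ∑ k ∈ Finset.range ((n - Finsupp.single j 1 : ℕ →₀ ℕ) i + 1),
          MvPowerSeries.coeff (sh (n - Finsupp.single j 1) k + Finsupp.single j 1) F =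
          ∑ k ∈ Finset.range (n i + 1), MvPowerSeries.coeff (sh n k) F := by
        have h1 : (n - Finsupp.single j 1 : ℕ →₀ ℕ) i = n i := by
          simp [hij]
        rw [h1]
        refine Finset.sum_congr rfl fun k _ => ?_
        congr 2
        ext x
        simp only [Finsupp.add_apply, shv, Finsupp.tsub_apply, Finsupp.single_apply]
        split_ifs <;> first | omega | (subst_vars; omega)
      rw [e5, e2]
      ring
  · intro d hd n hn
    rw [hg, neg_eq_zero]
    refine Finset.sum_eq_zero fun k hk => ?_
    have hk := Finset.mem_range.1 hk
    have hdg : (sh n k + Finsupp.single j 1).degree = n.degree + 1 := by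
      rw [map_add, hdeg n k (by omega), Finsupp.degree_single]
    rw [hF, map_sub, coeff_psSwap, hd _ (by rw [Finsupp.degree_mapDomain]; omega),
      hd _ (by omega), sub_zero]

theorem X_sub_X_ne_zero {i j : ℕ} (hij : i ≠ j) :
    (MvPowerSeries.X i - MvPowerSeries.X j : MvPowerSeries ℕ K) ≠ 0 := by
  classical
  intro h
  have := congrArg (MvPowerSeries.coeff (Finsupp.single i 1)) h
  rw [map_sub, MvPowerSeries.coeff_index_single_self_X, MvPowerSeries.coeff_index_single_X,
    if_neg hij, map_zero, sub_zero] at this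
  exact one_ne_zero this

/-- The operator `T` for the variables `X i` and `X j`, on power series. -/
noncomputable def psT (i j : ℕ) (f : MvPowerSeries ℕ K) : MvPowerSeries ℕ K :=
  heckeOp (MvPowerSeries.X i) (MvPowerSeries.X j) (psSwap i j) f

theorem psQuot_spec {i j : ℕ} (hij : i ≠ j) (f : MvPowerSeries ℕ K) :
    (MvPowerSeries.X i - MvPowerSeries.X j) *
      exactQuot (psSwap i j f - f) (MvPowerSeries.X i - MvPowerSeries.X j) =
        psSwap i j f - f := by
  obtain ⟨g, hg, -⟩ := exists_psQuot hij f
  have h : (MvPowerSeries.X i - MvPowerSeries.X j : MvPowerSeries ℕ K) ∣ psSwap i j f - f :=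
    ⟨g, hg.symm⟩
  rw [exactQuot, dif_pos h]
  exact h.choose_spec.symm

theorem psQuot_unique {i j : ℕ} (hij : i ≠ j) {f g : MvPowerSeries ℕ K}
    (h : (MvPowerSeries.X i - MvPowerSeries.X j) * g = psSwap i j f - f) :
    exactQuot (psSwap i j f - f) (MvPowerSeries.X i - MvPowerSeries.X j) = g :=
  mul_left_cancel₀ (X_sub_X_ne_zero hij) ((psQuot_spec hij f).trans h.symm)

theorem psT_add {i j : ℕ} (hij : i ≠ j) (f g : MvPowerSeries ℕ K) :
    psT i j (f + g) = psT i j f + psT i j g := by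
  have h : exactQuot (psSwap i j (f + g) - (f + g)) (MvPowerSeries.X i - MvPowerSeries.X j) =
      exactQuot (psSwap i j f - f) (MvPowerSeries.X i - MvPowerSeries.X j) +
        exactQuot (psSwap i j g - g) (MvPowerSeries.X i - MvPowerSeries.X j) := by
    refine psQuot_unique hij ?_
    rw [mul_add, psQuot_spec hij, psQuot_spec hij, map_add]
    ring
  rw [psT, psT, psT, heckeOp, heckeOp, heckeOp, h, smul_add]
  ring

theorem psT_smul {i j : ℕ} (hij : i ≠ j) (c : K) (f : MvPowerSeries ℕ K) :
    psT i j (c • f) = c • psT i j f := by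
  have h : exactQuot (psSwap i j (c • f) - c • f) (MvPowerSeries.X i - MvPowerSeries.X j) =
      c • exactQuot (psSwap i j f - f) (MvPowerSeries.X i - MvPowerSeries.X j) := by
    refine psQuot_unique hij ?_
    rw [mul_smul_comm, psQuot_spec hij, map_smul, smul_sub]
  rw [psT, psT, heckeOp, heckeOp, h, smul_add, mul_smul_comm, smul_comm]

theorem psT_mem {m i j : ℕ} (hij : i ≠ j) (hi : i < m) (hj : j < m) {f : MvPowerSeries ℕ K}
    (hf : f ∈ R m) : psT i j f ∈ R m := by
  have hXi : (MvPowerSeries.X i : MvPowerSeries ℕ K) ∈ R m := (xvar ⟨i, hi⟩ : R m).2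
  have hXj : (MvPowerSeries.X j : MvPowerSeries ℕ K) ∈ R m := (xvar ⟨j, hj⟩ : R m).2
  have hQ : exactQuot (psSwap i j f - f) (MvPowerSeries.X i - MvPowerSeries.X j) ∈ R m := by
    obtain ⟨g, hg, hdg⟩ := exists_psQuot hij f
    rw [psQuot_unique hij hg]
    obtain ⟨⟨d, hd⟩, hs⟩ := hf
    refine ⟨⟨d, hdg d hd⟩, fun σ hσ => ?_⟩
    refine mul_left_cancel₀ (X_sub_X_ne_zero hij) ?_
    have h1 := congrArg (MvPowerSeries.rename (R := K) σ) hg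
    rw [map_mul, map_sub, map_sub, MvPowerSeries.rename_X, MvPowerSeries.rename_X, hσ i hi,
      hσ j hj, hs σ hσ] at h1
    rw [h1, hg, psSwap, MvPowerSeries.rename_rename]
    have h2 : (σ ∘ Equiv.swap i j : ℕ → ℕ) = Equiv.swap i j ∘ σ := by
      funext x
      have := Equiv.swap_apply_apply σ i j
      rw [hσ i hi, hσ j hj] at this
      simp only [Function.comp]
      conv_rhs => rw [this]
      simp
    have h3 : MvPowerSeries.rename (σ ∘ Equiv.swap i j) f =
        MvPowerSeries.rename (Equiv.swap i j ∘ σ) f := by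
      simp only [h2]
    rw [h3, ← MvPowerSeries.rename_rename, hs σ hσ]
  have hT : psT i j f = t • f + (t • MvPowerSeries.X i - MvPowerSeries.X j) *
      exactQuot (psSwap i j f - f) (MvPowerSeries.X i - MvPowerSeries.X j) := rfl
  rw [hT]
  exact (R m).add_mem ((R m).smul_mem hf t)
    ((R m).mul_mem ((R m).sub_mem ((R m).smul_mem hXi t) hXj) hQ)

/-- The operator `T_{i+1} : R_m → R_m`, for `i + 1 < m`. -/
noncomputable def heckeT {m : ℕ} (i : ℕ) (hi : i + 1 < m) : R m →ₗ[K] R m where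
  toFun f := ⟨psT i (i + 1) f.1, psT_mem (by omega) (by omega) hi f.2⟩
  map_add' f g := Subtype.ext (psT_add (by omega) f.1 g.1)
  map_smul' c f := Subtype.ext (psT_smul (by omega) c f.1)

open Classical in
/-- `T_{i+1}^*`, the adjoint of `T_{i+1}` with respect to `⟨·,·⟩_m`. -/
noncomputable def heckeTstar {m : ℕ} (i : ℕ) (hi : i + 1 < m) : R m →ₗ[K] R m :=
  if h : ∃ S : R m →ₗ[K] R m, ∀ f g : R m, form m (heckeT i hi f) g = form m f (S g) then
    h.choose else 0

/-! ## Words and charge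

Words are lists of positive integers, read from left to right. -/

/-- The letters `a`, `a+1` of `w` (with their positions) that stay unpaired when the factors
`(a+1) a` are paired and removed repeatedly; listed from right to left. -/
def unpaired (a : ℕ) (w : List ℕ) : List (ℕ × ℕ) :=
  w.zipIdx.foldl (fun st p =>
    if p.1 = a + 1 then p :: st
    else if p.1 = a then
      match st with
      | [] => [p]
      | s :: st' => if s.1 = a + 1 then st' else p :: s :: st'
    else st) []

/-- The action of `σ_a` on words: the unpaired subword `a^r (a+1)^s` becomes `a^s (a+1)^r`. -/
def wordSigma (a : ℕ) (w : List ℕ) : List ℕ :=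
  let u := (unpaired a w).reverse
  let s := u.countP fun p => p.1 = a + 1
  let pos := u.map Prod.snd
  w.zipIdx.map fun p =>
    if p.2 ∈ pos then (if pos.idxOf p.2 < s then a else a + 1) else p.1

/-- While the evaluation `(v_1,…,v_m)` of the word is not dominant, apply `σ_a` for the smallest
`a` with `v_a < v_{a+1}`. Each step removes one inversion of the evaluation, so that `m ^ 2` steps
suffice to reach a word of dominant evaluation in the orbit of the symmetric group. -/
def makeDominant (m : ℕ) : ℕ → List ℕ → List ℕ
  | 0, w => w
  | fuel + 1, w =>
    match (List.range' 1 (m - 1)).find? fun a => w.count a < w.count (a + 1) with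
    | none => w
    | some a => makeDominant m fuel (wordSigma a w)

/-- One round of the labelling that computes the charge. The list `post` holds the unlabelled
letters still to be read before the end of the word is reached (in the order of reading, that is,
from right to left in the word), `pre` those that were already passed. One looks for the first
occurrence of the letter `r`, starting again at the beginning of the word with the label `l`
increased by one if necessary, then for the letter `r + 1`, and so on. The result is the sum of the
labels and the list of the letters left unlabelled. The first argument bounds the number of
letters. -/
def chargeRound : ℕ → ℕ → ℕ → List ℕ → List ℕ → ℕ × List ℕ
  | 0, _, _, pre, post => (0, pre ++ post)
  | n + 1, r, l, pre, post =>
    if r ∈ post then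
      let res := chargeRound n (r + 1) l (pre ++ post.takeWhile (· ≠ r))
        (post.dropWhile (· ≠ r)).tail
      (l + res.1, res.2)
    else if r ∈ pre then
      let res := chargeRound n (r + 1) (l + 1) (pre.takeWhile (· ≠ r))
        ((pre.dropWhile (· ≠ r)).tail ++ post)
      (l + 1 + res.1, res.2)
    else (0, pre ++ post)

/-- Repeat the rounds of labelling (at most `n` of them) and add up all labels; the argument is the
word read from right to left. -/
def chargeRounds : ℕ → List ℕ → ℕ
  | 0, _ => 0
  | n + 1, w =>
    let res := chargeRound w.length 1 0 [] w
    res.1 + chargeRounds n res.2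

/-- The charge of a word in the letters `1, …, m`. -/
def charge (m : ℕ) (w : List ℕ) : ℕ :=
  chargeRounds w.length (makeDominant m (m ^ 2) w).reverse

/-! ## Tableaux and the coefficients `D_{ΛΩ}(t)` for dominant `Λ` -/

/-- The partition `a ∪ λ`, the decreasing rearrangement of the entries of `a` and `λ`. -/
def cup {m : ℕ} (a : Fin m → ℕ) (lam : YoungDiagram) : YoungDiagram :=
  YoungDiagram.ofRowLens
    ((Finset.univ.val.map a + (lam.rowLens : Multiset ℕ)).sort (· ≥ ·))
    (Multiset.pairwise_sort _ _).sortedGE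

/-- Fillings of the skew diagram `α/β` with letters in `Fin m`; the element `i` of `Fin m` stands
for the letter `i + 1`. A cell `(r, c)` is in row `r` and column `c`, counted from `0`. -/
abbrev Filling (m : ℕ) (α β : YoungDiagram) : Type :=
  {c : ℕ × ℕ // c ∈ α.cells \ β.cells} → Fin m

/-- `T` belongs to `𝒮_{ΛΩ}`, for `Λ = (a; λ)` and `Ω = (b; μ)`: it is a skew tableau of shape
`(a ∪ λ)/μ` in which the letter `i` appears `b_i` times, always within the first `a_i` columns. -/
structure IsTableau {m : ℕ} (L O : MPartition m) (T : Filling m (cup L.1 L.2) O.2) : Prop where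
  shape : O.2 ≤ cup L.1 L.2
  row_weak : ∀ c d, c.1.1 = d.1.1 → c.1.2 < d.1.2 → T c ≤ T d
  col_strict : ∀ c d, c.1.2 = d.1.2 → c.1.1 < d.1.1 → T c < T d
  count : ∀ i, (Finset.univ.filter fun c => T c = i).card = O.1 i
  columns : ∀ c, c.1.2 < L.1 (T c)

/-- The word, read from top to bottom, of column `c` of the tableau `T̄` of shape `μ/λ` that
corresponds to `T`: the letter `ī` is in column `c`, where `c` is among the first `a_i` columns,
iff `i` is not in column `c` of `T`. The letter with index `i : Fin m` is written `m - i`, which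
turns the order of the barred letters into the usual order of `1, …, m`. -/
def barColumn {m : ℕ} (L O : MPartition m) (T : Filling m (cup L.1 L.2) O.2) (c : ℕ) : List ℕ :=
  ((Finset.univ.filter fun i : Fin m => c < L.1 i ∧ ∀ d, d.1.2 = c → T d ≠ i).image
    fun i : Fin m => m - (i : ℕ)).sort (· ≤ ·)

/-- The word of `T̄`: its rows are read from bottom to top, each from left to right. The entry of
`T̄` in row `r` and column `c` is the letter number `r - λ'_c` of column `c`. -/
def barWord {m : ℕ} (L O : MPartition m) (T : Filling m (cup L.1 L.2) O.2) : List ℕ :=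
  (List.range (O.2.colLen 0)).reverse.flatMap fun r =>
    (List.range' (L.2.rowLen r) (O.2.rowLen r - L.2.rowLen r)).map fun c =>
      (barColumn L O T c).getD (r - L.2.colLen c) 0

/-- The word `u_a`, the concatenation of the `ī ^ (a_1 - a_i)` for `i = 1, …, m` (with the letter
of index `i : Fin m` written `m - i`). -/
def uWord {m : ℕ} (a : Fin m → ℕ) : List ℕ :=
  (List.finRange m).flatMap fun i => List.replicate (a ⟨0, i.pos⟩ - a i) (m - (i : ℕ))

/-- `Inv(b) = #{i < j | b_i < b_j}`. -/
def inv {m : ℕ} (b : Fin m → ℕ) : ℕ :=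
  (Finset.univ.filter fun p : Fin m × Fin m => p.1 < p.2 ∧ b p.1 < b p.2).card

/-- `charge_{a,b}(T) = Inv(b) + charge(T̄ u_a)`, for dominant `a`. -/
def tableauCharge {m : ℕ} (L O : MPartition m) (T : Filling m (cup L.1 L.2) O.2) : ℕ :=
  inv O.1 + charge m (barWord L O T ++ uWord L.1)

open Classical in
/-- `D_{ΛΩ}(t)` for dominant `Λ`: the sum of `t ^ charge_{a,b}(T)` over `T ∈ 𝒮_{ΛΩ}`. -/
noncomputable def Ddom {m : ℕ} (L O : MPartition m) : K :=
  ∑ T ∈ Finset.univ.filter (IsTableau L O), t ^ tableauCharge L O T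

/-! ## The (dual) `m`-symmetric Schur functions -/

/-- `a_{i+1} < a_{i+2}` (in the usual numbering of the entries of `a` from `1` to `m`). -/
def IsAscent {m : ℕ} (a : Fin m → ℕ) (i : ℕ) : Prop :=
  ∃ hi : i + 1 < m, a ⟨i, by omega⟩ < a ⟨i + 1, hi⟩

/-- The composition obtained from `a` by exchanging the entries with indices `i` and `i + 1`. -/
def swapEntries {m : ℕ} (a : Fin m → ℕ) (i : ℕ) (hi : i + 1 < m) : Fin m → ℕ :=
  a ∘ Equiv.swap (⟨i, by omega⟩ : Fin m) ⟨i + 1, hi⟩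

theorem swapEntries_lt {m : ℕ} (a : Fin m → ℕ) (i : ℕ) (hi : i + 1 < m)
    (h : a ⟨i, by omega⟩ < a ⟨i + 1, hi⟩) :
    ∑ j : Fin m, (j : ℕ) * swapEntries a i hi j < ∑ j : Fin m, (j : ℕ) * a j := by
  set x : Fin m := ⟨i, by omega⟩ with hx
  set y : Fin m := ⟨i + 1, hi⟩ with hy
  have hxy : x ≠ y := by
    intro h
    have := congrArg Fin.val h
    simp [hx, hy] at this
  have key : ∀ f : Fin m → ℕ, ∑ j, f j =
      f x + f y + ∑ j ∈ (Finset.univ.erase x).erase y, f j := by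
    intro f
    rw [← Finset.add_sum_erase _ f (Finset.mem_univ x),
      ← Finset.add_sum_erase _ f (Finset.mem_erase.2 ⟨hxy.symm, Finset.mem_univ y⟩), add_assoc]
  rw [key, key]
  have h1 : ∑ j ∈ (Finset.univ.erase x).erase y, (j : ℕ) * swapEntries a i hi j =
      ∑ j ∈ (Finset.univ.erase x).erase y, (j : ℕ) * a j := by
    refine Finset.sum_congr rfl fun j hj => ?_
    rw [Finset.mem_erase, Finset.mem_erase] at hj
    rw [swapEntries, Function.comp, Equiv.swap_apply_of_ne_of_ne hj.2.1 hj.1]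
  have h2 : swapEntries a i hi x = a y := by
    rw [swapEntries, Function.comp, Equiv.swap_apply_left]
  have h3 : swapEntries a i hi y = a x := by
    rw [swapEntries, Function.comp, Equiv.swap_apply_right]
  rw [h1, h2, h3]
  have h4 : (x : ℕ) = i := rfl
  have h5 : (y : ℕ) = i + 1 := rfl
  rw [h4, h5]
  nlinarith [h]

open Classical in
/-- The dual `m`-symmetric Schur function `s_Λ^*(x;t)`. If `Λ` is dominant, it is
`∑ D_{ΛΩ}(t) k_Ω(x;t)`. Otherwise it is `t⁻¹ T_i^* s_{s_i Λ}^*` for an `i` with `a_i < a_{i+1}`;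
since the operators `T_i^*` satisfy the braid relations, all choices of `i` give the same result,
and the smallest one is taken. -/
noncomputable def sdual {m : ℕ} (L : MPartition m) : R m :=
  if h : ∃ i, IsAscent L.1 i then
    t⁻¹ • heckeTstar (Nat.find h) (Nat.find_spec h).fst
      (sdual (swapEntries L.1 (Nat.find h) (Nat.find_spec h).fst, L.2))
  else ∑ᶠ O : MPartition m, Ddom L O • kfun O
termination_by ∑ j : Fin m, (j : ℕ) * L.1 j
decreasing_by exact swapEntries_lt _ _ _ (Nat.find_spec h).snd

open Classical in
/-- The `m`-symmetric Schur functions `s_Λ(x;t)`: the family dual to the dual `m`-symmetric Schur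
functions with respect to the scalar product on `R_m`. -/
noncomputable def mschur {m : ℕ} : MPartition m → R m :=
  if h : ∃ s : MPartition m → R m, ∀ L O, form m (s L) (sdual O) = if L = O then 1 else 0 then
    h.choose else 0

end MSym

namespace MSym

open MvPolynomial Relation

/-! ## Demazure–Lusztig operators on polynomials -/

/-! The heart of the matter is a unitriangularity: `sdual L` equals `kfun L` plus a combination of
`kfun O` with the same total size `psize` and with strictly more cells in the partition part
(`sdual_sub_kfun_mem`). Since the `kfun` are orthonormal, pairing `kfun (b, ⊥)` with `sdual O` sees
only the leading term: a correction term would need an empty partition with more cells than some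
other partition. Hence `kfun (b, ⊥)` has the property that defines `mschur (b, ⊥)`. As the `sdual`
span, that property determines an element (`eq_of_form_sdual`), and `s_∅ = 1` turns `kfun (b, ⊥)`
into `H_b`.

For dominant `Λ` the triangularity is combinatorial. In a tableau of `𝒮_{ΛΩ}` a letter `i` occurs at
most once in a column and only in the first `a_i` columns, so `b_i ≤ a_i`. If the partition `μ` has
no more cells than `λ`, conservation of the number of cells forces `b = a`, every admissible column
then contains its letter, and comparing column lengths gives `μ = λ` (`IsTableau.eq_of_card_le`).
For `Ω = Λ` there is exactly one tableau, of charge `0` (`Ddom_self`). For general `Λ` one needs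
that `T_i^*` maps `k_{(b;μ)}` into the span of itself and `k_{(s_i b;μ)}`, and sends `k_{(s_i a;λ)}`
to `t k_Λ` at an ascent (`heckeTstar_kfun_swapEntries`); the partition part is never touched.

The bulk of the work shows that the objects, all obtained by choice, exist and behave as they
should. Nonsymmetric Macdonald polynomials are built from `1` by the intertwiners `T_i - c` and the
raising operator `Φ = x_N ω`. The construction also gives triangularity in the Bruhat order and
regularity at `q = 0` (`IsE`), and the separation of the joint spectra gives uniqueness
(`IsE.unique`). Specialising the Hecke action at `q = 0` yields the action on the `H_a`
(`opT_hlPoly`). That the `kfun` form a basis follows through a chain of triangular changes of basis,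
`x^a p_λ`, `x^a h_λ`, `x^a s_λ`, `H_a s_λ`; this provides the scalar product and the adjoints. -/

theorem poly_X_sub_X_ne_zero {σ R : Type*} [CommRing R] [Nontrivial R] {a b : σ} (hab : a ≠ b) :
    (X a - X b : MvPolynomial σ R) ≠ 0 :=
  sub_ne_zero.2 fun h => hab (X_injective h)

section DemazureLusztig

variable {σ : Type*} [DecidableEq σ]

/-- The exchange of the variables `X a` and `X b`. -/
noncomputable abbrev polySwap (a b : σ) : MvPolynomial σ K →ₐ[K] MvPolynomial σ K :=
  rename (Equiv.swap a b)

/-- Modulo `X a - X b` the exchange fixes every generator, hence is the identity. The argument works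
over any commutative ring, which is what later keeps the coefficients regular at `q = 0`. -/
theorem X_sub_X_dvd_rename_swap_sub {R : Type*} [CommRing R] (a b : σ) (f : MvPolynomial σ R) :
    (X a - X b : MvPolynomial σ R) ∣ rename (Equiv.swap a b) f - f := by
  rw [← Ideal.mem_span_singleton, ← Ideal.Quotient.eq]
  set I : Ideal (MvPolynomial σ R) := Ideal.span {X a - X b}
  have hab : (Ideal.Quotient.mk I (X a)) = Ideal.Quotient.mk I (X b) :=
    Ideal.Quotient.eq.2 (Ideal.mem_span_singleton_self _)
  have h : (Ideal.Quotient.mkₐ R I).comp (rename (Equiv.swap a b)) = Ideal.Quotient.mkₐ R I := by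
    refine MvPolynomial.algHom_ext fun i => ?_
    simp only [AlgHom.comp_apply, rename_X, Ideal.Quotient.mkₐ_eq_mk]
    rcases eq_or_ne i a with rfl | hia
    · rw [Equiv.swap_apply_left, hab]
    · rcases eq_or_ne i b with rfl | hib
      · rw [Equiv.swap_apply_right, hab]
      · rw [Equiv.swap_apply_of_ne_of_ne hia hib]
  exact DFunLike.congr_fun h f

theorem polySwap_swap (a b : σ) (f : MvPolynomial σ K) : polySwap a b (polySwap a b f) = f := by
  rw [polySwap, rename_rename]
  have : (Equiv.swap a b ∘ Equiv.swap a b : σ → σ) = id := by funext x; simp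
  rw [this, rename_id_apply]

theorem polySwap_X_left (a b : σ) : polySwap a b (X a) = X b := by simp [polySwap]

theorem polySwap_X_right (a b : σ) : polySwap a b (X b) = X a := by simp [polySwap]

theorem polySwap_X_of_ne {a b c : σ} (ha : c ≠ a) (hb : c ≠ b) : polySwap a b (X c) = X c := by
  simp [polySwap, Equiv.swap_apply_of_ne_of_ne ha hb]

theorem polySwap_C (a b : σ) (c : K) : polySwap a b (C c) = C c := rename_C _ _

/-- The Demazure–Lusztig operator for the variables `X a` and `X b`. -/
noncomputable def dlFun (a b : σ) (f : MvPolynomial σ K) : MvPolynomial σ K :=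
  heckeOp (X a) (X b) (polySwap a b) f

/-- The form of the definition with denominators cleared. Since `X a - X b` is cancellable, this
equation characterises the operator (`dlFun_unique`), and every identity below becomes a linear
combination of instances of it. -/
theorem dlFun_spec (a b : σ) (f : MvPolynomial σ K) :
    (X a - X b) * dlFun a b f =
      (C t * X a - X b) * polySwap a b f + (1 - C t) * (X b * f) := by
  have h := X_sub_X_dvd_rename_swap_sub a b f
  have h2 : (X a - X b) * exactQuot (polySwap a b f - f) (X a - X b) = polySwap a b f - f := by
    rw [exactQuot, dif_pos h]
    exact h.choose_spec.symm
  rw [dlFun, heckeOp, smul_eq_C_mul, smul_eq_C_mul]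
  linear_combination (C t * X a - X b) * h2

theorem dlFun_unique {a b : σ} (hab : a ≠ b) {f g : MvPolynomial σ K}
    (h : (X a - X b) * g = (C t * X a - X b) * polySwap a b f + (1 - C t) * (X b * f)) :
    g = dlFun a b f :=
  mul_left_cancel₀ (poly_X_sub_X_ne_zero hab) (h.trans (dlFun_spec a b f).symm)

/-- The Demazure–Lusztig operator as a linear map. -/
noncomputable def dl {a b : σ} (hab : a ≠ b) : Module.End K (MvPolynomial σ K) where
  toFun := dlFun a b
  map_add' f g := by
    refine (dlFun_unique hab ?_).symm
    rw [map_add]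
    linear_combination dlFun_spec a b f + dlFun_spec a b g
  map_smul' c f := by
    refine (dlFun_unique hab ?_).symm
    rw [map_smul, RingHom.id_apply]
    simp only [smul_eq_C_mul]
    linear_combination C c * dlFun_spec a b f

theorem dl_spec {a b : σ} (hab : a ≠ b) (f : MvPolynomial σ K) :
    (X a - X b) * dl hab f =
      (C t * X a - X b) * polySwap a b f + (1 - C t) * (X b * f) := dlFun_spec a b f

theorem dl_unique {a b : σ} (hab : a ≠ b) {f g : MvPolynomial σ K}
    (h : (X a - X b) * g = (C t * X a - X b) * polySwap a b f + (1 - C t) * (X b * f)) :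
    dl hab f = g := (dlFun_unique hab h).symm

theorem polySwap_dl_spec {a b : σ} (hab : a ≠ b) (f : MvPolynomial σ K) :
    (X b - X a) * polySwap a b (dl hab f) =
      (C t * X b - X a) * f + (1 - C t) * (X a * polySwap a b f) := by
  have h := congrArg (polySwap a b) (dl_spec hab f)
  simpa only [map_mul, map_add, map_sub, map_one, polySwap_X_left, polySwap_X_right, polySwap_C,
    polySwap_swap] using h

/-- Polynomials symmetric in the two variables act as scalars for the operator. -/
theorem dl_mul_of_polySwap_eq {a b : σ} (hab : a ≠ b) {g : MvPolynomial σ K}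
    (hg : polySwap a b g = g) (f : MvPolynomial σ K) : dl hab (g * f) = g * dl hab f := by
  refine dl_unique hab ?_
  rw [map_mul, hg]
  linear_combination g * dl_spec hab f

theorem dl_one {a b : σ} (hab : a ≠ b) : dl hab (1 : MvPolynomial σ K) = C t := by
  refine dl_unique hab ?_
  rw [map_one]
  ring

theorem dl_dl {a b : σ} (hab : a ≠ b) (f : MvPolynomial σ K) :
    dl hab (dl hab f) = (C t - 1) * dl hab f + C t * f := by
  refine dl_unique hab ?_
  -- A second factor `X a - X b` is needed: the exchanged value of the inner operator is only known
  -- after multiplication by it.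
  refine mul_left_cancel₀ (poly_X_sub_X_ne_zero hab) ?_
  linear_combination (C t * X a - X b) * polySwap_dl_spec hab f +
    (X a * (C t - 1)) * dl_spec hab f

theorem dl_X_mul_dl {a b : σ} (hab : a ≠ b) (f : MvPolynomial σ K) :
    dl hab (X a * dl hab f) = C t * (X b * f) := by
  refine dl_unique hab ?_
  rw [map_mul, polySwap_X_left]
  refine mul_left_cancel₀ (poly_X_sub_X_ne_zero hab) ?_
  linear_combination (C t * X a - X b) * X b * polySwap_dl_spec hab f -
    (X a * X b) * (1 - C t) * dl_spec hab f

/-- The operator is homogeneous of degree `0` in the two variables, so a common scalar `s` cancels.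
The scalar is needed for `ω ^ 2`, which multiplies both of the first two variables by `q`. -/
theorem algHom_dl {τ : Type*} [DecidableEq τ] {a b : σ} (hab : a ≠ b) {c d : τ} (hcd : c ≠ d)
    (φ : MvPolynomial σ K →ₐ[K] MvPolynomial τ K) {s : K} (hs : s ≠ 0)
    (ha : φ (X a) = C s * X c) (hb : φ (X b) = C s * X d)
    (hφ : ∀ f, φ (polySwap a b f) = polySwap c d (φ f)) (f : MvPolynomial σ K) :
    φ (dl hab f) = dl hcd (φ f) := by
  symm
  refine dl_unique hcd ?_
  have hs' : (C s : MvPolynomial τ K) ≠ 0 := fun h => hs (C_injective _ _ (h.trans C_0.symm))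
  refine mul_left_cancel₀ hs' ?_
  have h := congrArg φ (dl_spec hab f)
  have hC : φ (C t) = C t := φ.commutes t
  simp only [map_mul, map_add, map_sub, map_one, ha, hb, hφ, hC] at h
  linear_combination h

/-- The exchange of `c, d` commutes with the operator for `a, b`, and the coefficients of the
defining equation for `c, d` are symmetric in `a, b`, so they pass through it. -/
theorem dl_comm {a b c d : σ} (hab : a ≠ b) (hcd : c ≠ d) (hac : a ≠ c) (had : a ≠ d)
    (hbc : b ≠ c) (hbd : b ≠ d) (f : MvPolynomial σ K) :
    dl hab (dl hcd f) = dl hcd (dl hab f) := by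
  have hκ : ∀ g : MvPolynomial σ K,
      polySwap c d (polySwap a b g) = polySwap a b (polySwap c d g) := by
    intro g
    rw [polySwap, polySwap, rename_rename, rename_rename]
    congr 2
    funext x
    have : Equiv.swap c d * Equiv.swap a b = Equiv.swap a b * Equiv.swap c d :=
      (Equiv.Perm.disjoint_swap_swap (by simp [*, hac.symm, hbc.symm, had.symm, hbd.symm])).commute
    exact DFunLike.congr_fun this x
  have hc : ∀ g : MvPolynomial σ K,
      polySwap c d (dl hab g) = dl hab (polySwap c d g) := fun g =>
    algHom_dl hab hab (polySwap c d) (s := 1) one_ne_zero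
      (by rw [polySwap_X_of_ne hac had, C_1, one_mul])
      (by rw [polySwap_X_of_ne hbc hbd, C_1, one_mul]) hκ g
  have key : ∀ g : MvPolynomial σ K, polySwap a b g = g → ∀ f, dl hab (g * f) = g * dl hab f :=
    fun g hg f => dl_mul_of_polySwap_eq hab hg f
  symm
  refine dl_unique hcd ?_
  have hs1 : polySwap a b (X c - X d : MvPolynomial σ K) = X c - X d := by
    rw [map_sub, polySwap_X_of_ne hac.symm hbc.symm, polySwap_X_of_ne had.symm hbd.symm]
  have hs2 : polySwap a b (C t * X c - X d : MvPolynomial σ K) = C t * X c - X d := by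
    rw [map_sub, map_mul, polySwap_C, polySwap_X_of_ne hac.symm hbc.symm,
      polySwap_X_of_ne had.symm hbd.symm]
  have hs3 : polySwap a b ((1 - C t) * X d : MvPolynomial σ K) = (1 - C t) * X d := by
    rw [map_mul, map_sub, map_one, polySwap_C, polySwap_X_of_ne had.symm hbd.symm]
  rw [← key _ hs1, dl_spec, map_add, key _ hs2, ← mul_assoc, key _ hs3, hc]
  ring

/-- The values of a polynomial under the six permutations of `x, y, z` are treated as independent
unknowns: the indices `1` and `2` record applications of the two adjacent exchanges. Unprimed
letters follow the computation of `T₁T₂T₁ f`, primed ones that of `T₂T₁T₂ f`. Solving for all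
intermediate values leaves an identity of rational functions. -/
theorem braid_identity {L : Type*} [Field L] {x y z s f f1 f2 f12 f21 f121 a a1 a2 a12 b b1 c
    a' a1' a2' a21' b' b2' c' : L} (hxy : x - y ≠ 0) (hxz : x - z ≠ 0) (hyz : y - z ≠ 0)
    (ha : (x - y) * a = (s * x - y) * f1 + (1 - s) * (y * f))
    (ha1 : (y - x) * a1 = (s * y - x) * f + (1 - s) * (x * f1))
    (ha2 : (x - z) * a2 = (s * x - z) * f21 + (1 - s) * (z * f2))
    (ha12 : (y - z) * a12 = (s * y - z) * f121 + (1 - s) * (z * f12))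
    (hb : (y - z) * b = (s * y - z) * a2 + (1 - s) * (z * a))
    (hb1 : (x - z) * b1 = (s * x - z) * a12 + (1 - s) * (z * a1))
    (hc : (x - y) * c = (s * x - y) * b1 + (1 - s) * (y * b))
    (ha' : (y - z) * a' = (s * y - z) * f2 + (1 - s) * (z * f))
    (ha2' : (z - y) * a2' = (s * z - y) * f + (1 - s) * (y * f2))
    (ha1' : (x - z) * a1' = (s * x - z) * f12 + (1 - s) * (z * f1))
    (ha21' : (x - y) * a21' = (s * x - y) * f121 + (1 - s) * (y * f21))
    (hb' : (x - y) * b' = (s * x - y) * a1' + (1 - s) * (y * a'))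
    (hb2' : (x - z) * b2' = (s * x - z) * a21' + (1 - s) * (z * a2'))
    (hc' : (y - z) * c' = (s * y - z) * b2' + (1 - s) * (z * b')) : c = c' := by
  have hyx : y - x ≠ 0 := fun h => hxy (by linear_combination -h)
  have hzy : z - y ≠ 0 := fun h => hyz (by linear_combination -h)
  obtain rfl := eq_div_of_mul_eq hxy ((mul_comm _ _).trans ha)
  obtain rfl := eq_div_of_mul_eq hyx ((mul_comm _ _).trans ha1)
  obtain rfl := eq_div_of_mul_eq hxz ((mul_comm _ _).trans ha2)
  obtain rfl := eq_div_of_mul_eq hyz ((mul_comm _ _).trans ha12)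
  obtain rfl := eq_div_of_mul_eq hyz ((mul_comm _ _).trans hb)
  obtain rfl := eq_div_of_mul_eq hxz ((mul_comm _ _).trans hb1)
  obtain rfl := eq_div_of_mul_eq hxy ((mul_comm _ _).trans hc)
  obtain rfl := eq_div_of_mul_eq hyz ((mul_comm _ _).trans ha')
  obtain rfl := eq_div_of_mul_eq hzy ((mul_comm _ _).trans ha2')
  obtain rfl := eq_div_of_mul_eq hxz ((mul_comm _ _).trans ha1')
  obtain rfl := eq_div_of_mul_eq hxy ((mul_comm _ _).trans ha21')
  obtain rfl := eq_div_of_mul_eq hxy ((mul_comm _ _).trans hb')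
  obtain rfl := eq_div_of_mul_eq hxz ((mul_comm _ _).trans hb2')
  obtain rfl := eq_div_of_mul_eq hyz ((mul_comm _ _).trans hc')
  rw [← neg_sub x y, ← neg_sub y z]
  field_simp
  ring

theorem dl_braid {a b c : σ} (hab : a ≠ b) (hbc : b ≠ c) (hac : a ≠ c) (f : MvPolynomial σ K) :
    dl hab (dl hbc (dl hab f)) = dl hbc (dl hab (dl hbc f)) := by
  have x1 := polySwap_X_left a b
  have y1 := polySwap_X_right a b
  have z1 : polySwap a b (X c) = X c := polySwap_X_of_ne hac.symm hbc.symm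
  have x2 : polySwap b c (X a) = X a := polySwap_X_of_ne hab hac
  have y2 := polySwap_X_left b c
  have z2 := polySwap_X_right b c
  have hbr : polySwap b c (polySwap a b (polySwap b c f)) =
      polySwap a b (polySwap b c (polySwap a b f)) := by
    simp only [polySwap, rename_rename]
    congr 2
    funext x
    have h1 := Equiv.swap_mul_swap_mul_swap (x := a) (y := b) (z := c) hab hac
    have h2 := Equiv.swap_mul_swap_mul_swap (x := c) (y := b) (z := a) hbc.symm hac.symm
    rw [Equiv.swap_comm c b, Equiv.swap_comm b a, Equiv.swap_comm a c] at h2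
    have h3 := DFunLike.congr_fun (h1.trans h2.symm) x
    simp only [Equiv.Perm.mul_apply] at h3
    simp only [Function.comp_apply]
    exact h3
  have ap1 : ∀ {p r : MvPolynomial σ K}, p = r → polySwap a b p = polySwap a b r := fun h => by
    rw [h]
  have ap2 : ∀ {p r : MvPolynomial σ K}, p = r → polySwap b c p = polySwap b c r := fun h => by
    rw [h]
  let ι := algebraMap (MvPolynomial σ K) (FractionRing (MvPolynomial σ K))
  have hι : Function.Injective ι := IsFractionRing.injective _ _
  have ne : ∀ {u v : σ}, u ≠ v → ι (X u) - ι (X v) ≠ 0 := fun h => by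
    rw [← map_sub, Ne, ← map_zero ι, hι.eq_iff]
    exact poly_X_sub_X_ne_zero h
  have conv : ∀ {u v : σ} {w f1 f0 : MvPolynomial σ K},
      (X u - X v) * w = (C t * X u - X v) * f1 + (1 - C t) * (X v * f0) →
      (ι (X u) - ι (X v)) * ι w =
        (ι (C t) * ι (X u) - ι (X v)) * ι f1 + (1 - ι (C t)) * (ι (X v) * ι f0) := by
    intro u v w f1 f0 h
    simpa only [map_mul, map_add, map_sub, map_one] using congrArg ι h
  refine hι (braid_identity (ne hab) (ne hac) (ne hbc)
    (conv (dl_spec hab f)) (conv (polySwap_dl_spec hab f))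
    (conv (w := polySwap b c (dl hab f)) (f1 := polySwap b c (polySwap a b f))
      (f0 := polySwap b c f) ?_)
    (conv (w := polySwap a b (polySwap b c (dl hab f)))
      (f1 := polySwap a b (polySwap b c (polySwap a b f)))
      (f0 := polySwap a b (polySwap b c f)) ?_)
    (conv (dl_spec hbc (dl hab f)))
    (conv (w := polySwap a b (dl hbc (dl hab f)))
      (f1 := polySwap a b (polySwap b c (dl hab f))) (f0 := polySwap a b (dl hab f)) ?_)
    (conv (dl_spec hab _))
    (conv (dl_spec hbc f)) (conv (polySwap_dl_spec hbc f))
    (conv (w := polySwap a b (dl hbc f)) (f1 := polySwap a b (polySwap b c f))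
      (f0 := polySwap a b f) ?_)
    (conv (w := polySwap b c (polySwap a b (dl hbc f)))
      (f1 := polySwap a b (polySwap b c (polySwap a b f)))
      (f0 := polySwap b c (polySwap a b f)) ?_)
    (conv (dl_spec hab (dl hbc f)))
    (conv (w := polySwap b c (dl hab (dl hbc f)))
      (f1 := polySwap b c (polySwap a b (dl hbc f))) (f0 := polySwap b c (dl hbc f)) ?_)
    (conv (dl_spec hbc _)))
  · have h := ap2 (dl_spec hab f)
    simpa only [map_mul, map_add, map_sub, map_one, polySwap_C, x2, y2, z2] using h
  · have h := ap1 (ap2 (dl_spec hab f))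
    simpa only [map_mul, map_add, map_sub, map_one, polySwap_C, x1, y1, z1, x2, y2, z2] using h
  · have h := ap1 (dl_spec hbc (dl hab f))
    simpa only [map_mul, map_add, map_sub, map_one, polySwap_C, x1, y1, z1, x2, y2, z2] using h
  · have h := ap1 (dl_spec hbc f)
    simpa only [map_mul, map_add, map_sub, map_one, polySwap_C, x1, y1, z1, x2, y2, z2] using h
  -- Here the longest permutation appears as the other reduced word; `hbr` turns it into the unknown
  -- already used for the first side.
  · have h := ap2 (ap1 (dl_spec hbc f))
    rw [map_mul, map_mul, map_add, map_add, map_mul, map_mul, hbr] at h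
    simpa only [map_mul, map_add, map_sub, map_one, polySwap_C, x1, y1, z1, x2, y2, z2] using h
  · have h := ap2 (dl_spec hab (dl hbc f))
    simpa only [map_mul, map_add, map_sub, map_one, polySwap_C, x1, y1, z1, x2, y2, z2] using h

end DemazureLusztig

/-! ## Cherednik operators -/

theorem t_ne_zero : t ≠ 0 := by
  rw [t, Ne, map_eq_zero]
  exact RatFunc.X_ne_zero

theorem q_ne_zero : q ≠ 0 := RatFunc.X_ne_zero

section Cherednik

variable {N : ℕ}

/-- Polynomials in `N` variables. -/
abbrev Pol (N : ℕ) : Type := MvPolynomial (Fin N) K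

theorem fin_ne_succ {i : ℕ} (h : i + 1 < N) : (⟨i, by omega⟩ : Fin N) ≠ ⟨i + 1, h⟩ := by
  simp

/-- `polyT` as a linear map. -/
noncomputable def opT (N i : ℕ) : Module.End K (Pol N) :=
  if h : i + 1 < N then dl (fin_ne_succ h) else 1

theorem opT_of_lt {i : ℕ} (h : i + 1 < N) : opT N i = dl (fin_ne_succ h) := dif_pos h

theorem opT_apply (i : ℕ) (f : Pol N) : opT N i f = polyT i f := by
  rw [opT, polyT]
  split_ifs with h
  · rfl
  · rfl

/-- `polyTinv` as a linear map. -/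
noncomputable def opTinv (N i : ℕ) : Module.End K (Pol N) := (t⁻¹ - 1) • 1 + t⁻¹ • opT N i

theorem opTinv_apply (i : ℕ) (f : Pol N) : opTinv N i f = polyTinv i f := by
  rw [opTinv, polyTinv, ← opT_apply]
  rfl

theorem opT_mul_self {i : ℕ} (h : i + 1 < N) :
    opT N i * opT N i = (t - 1) • opT N i + t • 1 := by
  rw [opT_of_lt h]
  refine LinearMap.ext fun f => ?_
  have := dl_dl (fin_ne_succ h) f
  simp only [Module.End.mul_apply, LinearMap.add_apply, LinearMap.smul_apply, Module.End.one_apply,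
    this, smul_eq_C_mul, C_sub, C_1]

theorem opT_mul_opTinv {i : ℕ} (h : i + 1 < N) : opT N i * opTinv N i = 1 := by
  rw [opTinv, mul_add, mul_smul_comm, mul_smul_comm, opT_mul_self h, mul_one, smul_add, smul_smul,
    smul_smul, inv_mul_cancel₀ t_ne_zero, ← add_assoc, ← add_smul, mul_sub,
    inv_mul_cancel₀ t_ne_zero]
  simp

theorem opTinv_mul_opT {i : ℕ} (h : i + 1 < N) : opTinv N i * opT N i = 1 := by
  rw [← opT_mul_opTinv h, opTinv]
  simp only [add_mul, mul_add, smul_mul_assoc, mul_smul_comm, one_mul, mul_one]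

theorem t_smul_opTinv (i : ℕ) : t • opTinv N i = (1 - t) • 1 + opT N i := by
  rw [opTinv, smul_add, smul_smul, smul_smul, mul_sub, mul_inv_cancel₀ t_ne_zero]
  simp

theorem opT_comm {i j : ℕ} (h : i + 1 < j) : Commute (opT N i) (opT N j) := by
  by_cases hj : j + 1 < N
  · have hi : i + 1 < N := by omega
    rw [opT_of_lt hi, opT_of_lt hj]
    refine commute_iff_eq _ _ |>.2 (LinearMap.ext fun f => ?_)
    rw [Module.End.mul_apply, Module.End.mul_apply]
    refine dl_comm _ _ ?_ ?_ ?_ ?_ f <;> simp <;> omega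
  · rw [opT, opT, dif_neg hj]
    exact Commute.one_right _

theorem opT_braid {i : ℕ} (h : i + 2 < N) :
    opT N i * opT N (i + 1) * opT N i = opT N (i + 1) * opT N i * opT N (i + 1) := by
  have hi : i + 1 < N := by omega
  rw [opT_of_lt hi, opT_of_lt (show i + 1 + 1 < N from h)]
  refine LinearMap.ext fun f => ?_
  simp only [Module.End.mul_apply]
  exact dl_braid _ _ (by simp; omega) f

theorem commute_opTinv {A : Module.End K (Pol N)} {i : ℕ} (h : Commute A (opT N i)) :
    Commute A (opTinv N i) := by
  rw [opTinv]
  exact ((Commute.one_right A).smul_right _).add_right (h.smul_right _)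

theorem semiconj_opTinv {A : Module.End K (Pol N)} {i j : ℕ}
    (h : SemiconjBy A (opT N i) (opT N j)) : SemiconjBy A (opTinv N i) (opTinv N j) := by
  have h' : A * opT N i = opT N j * A := h
  rw [SemiconjBy, opTinv, opTinv, mul_add, add_mul, mul_smul_comm, mul_smul_comm, smul_mul_assoc,
    smul_mul_assoc, h', mul_one, one_mul]

/-- The braid relation multiplied on both sides by `T_i⁻¹ T_{i+1}⁻¹`; it is the basic move for
pulling a `T` through a product of inverses. -/
theorem opT_braid_inv {i : ℕ} (h : i + 2 < N) :
    opTinv N i * opTinv N (i + 1) * opT N i = opT N (i + 1) * (opTinv N i * opTinv N (i + 1)) := by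
  have hi : i + 1 < N := by omega
  have h1 := opTinv_mul_opT hi
  have h2 := opTinv_mul_opT (show i + 1 + 1 < N from h)
  have h3 := opT_mul_opTinv hi
  have h4 := opT_mul_opTinv (show i + 1 + 1 < N from h)
  have hb := opT_braid h
  calc opTinv N i * opTinv N (i + 1) * opT N i
      = opTinv N i * opTinv N (i + 1) * (opT N i * opT N (i + 1) * opT N i) *
          (opTinv N i * opTinv N (i + 1)) := by
        simp only [mul_assoc]
        rw [← mul_assoc (opT N i) (opTinv N i), h3, one_mul, h4, mul_one]
    _ = _ := by
        rw [hb]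
        simp only [mul_assoc]
        rw [← mul_assoc (opTinv N (i + 1)) (opT N (i + 1)), h2, one_mul,
          ← mul_assoc (opTinv N i) (opT N i), h1, one_mul]

/-- `polyOmega` as a linear map. -/
noncomputable def opOmega (N : ℕ) : Module.End K (Pol N) := polyOmega.toLinearMap

theorem opOmega_apply (f : Pol N) : opOmega N f = polyOmega f := rfl

/-- Multiplication by `X i`. -/
noncomputable def opX (i : Fin N) : Module.End K (Pol N) := LinearMap.mulLeft K (X i)

theorem opX_apply (i : Fin N) (f : Pol N) : opX i f = X i * f := rfl

theorem polyOmega_X_zero (h : 0 < N) :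
    polyOmega (X (⟨0, h⟩ : Fin N)) = C q * X (⟨N - 1, by omega⟩ : Fin N) := by
  rw [polyOmega, aeval_X, if_pos rfl, smul_eq_C_mul]

theorem polyOmega_X_succ {j : ℕ} (h : j + 1 < N) :
    polyOmega (X (⟨j + 1, h⟩ : Fin N)) = X (⟨j, by omega⟩ : Fin N) := by
  rw [polyOmega, aeval_X, if_neg (by simp)]
  rfl

/-- Apart from the first variable, `ω` lowers the indices of the variables by one, and hence those
of the operators as well. -/
theorem opOmega_mul_opT_succ {k : ℕ} (h : k + 2 < N) :
    opOmega N * opT N (k + 1) = opT N k * opOmega N := by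
  rw [opT_of_lt (show k + 1 + 1 < N from h), opT_of_lt (show k + 1 < N by omega)]
  refine LinearMap.ext fun f => ?_
  rw [Module.End.mul_apply, Module.End.mul_apply, opOmega_apply, opOmega_apply]
  refine algHom_dl _ _ polyOmega one_ne_zero ?_ ?_ ?_ f
  · rw [polyOmega_X_succ, C_1, one_mul]
  · rw [polyOmega_X_succ, C_1, one_mul]
  · intro f
    rw [← AlgHom.comp_apply, ← AlgHom.comp_apply]
    refine DFunLike.congr_fun (MvPolynomial.algHom_ext fun j => ?_) f
    obtain ⟨j, hj⟩ := j
    simp only [AlgHom.comp_apply, rename_X]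
    rcases Nat.eq_zero_or_pos j with rfl | hj0
    · rw [Equiv.swap_apply_of_ne_of_ne (by simp) (by simp), polyOmega_X_zero, map_mul, polySwap_C,
        polySwap_X_of_ne (by simp; omega) (by simp; omega)]
    · obtain ⟨j, rfl⟩ : ∃ j', j = j' + 1 := ⟨j - 1, by omega⟩
      rw [polyOmega_X_succ]
      by_cases h1 : j = k
      · subst h1
        rw [Equiv.swap_apply_left, polyOmega_X_succ, polySwap_X_left]
      · by_cases h2 : j = k + 1
        · subst h2
          rw [Equiv.swap_apply_right, polyOmega_X_succ, polySwap_X_right]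
        · rw [Equiv.swap_apply_of_ne_of_ne (by simpa using h1) (by simpa using h2),
            polyOmega_X_succ, polySwap_X_of_ne (by simpa using h1) (by simpa using h2)]

/-- A single `ω` separates the first two variables to opposite ends. After two applications they are
again adjacent, at the end, and both carry the factor `q`. -/
theorem opOmega_sq_mul_opT_zero (h : 1 < N) :
    opOmega N * opOmega N * opT N 0 = opT N (N - 2) * (opOmega N * opOmega N) := by
  rw [opT_of_lt (show 0 + 1 < N by omega), opT_of_lt (show N - 2 + 1 < N by omega)]
  refine LinearMap.ext fun f => ?_
  have e0 : (⟨N - 2 + 1, by omega⟩ : Fin N) = ⟨N - 1, by omega⟩ := Fin.ext (by simp; omega)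
  have x0 : polyOmega (polyOmega (X (⟨0, by omega⟩ : Fin N))) =
      C q * X (⟨N - 2, by omega⟩ : Fin N) := by
    rw [polyOmega_X_zero, map_mul, ← e0, polyOmega_X_succ]
    exact congrArg (· * _) (polyOmega.commutes q)
  have x1 : polyOmega (polyOmega (X (⟨0 + 1, by omega⟩ : Fin N))) =
      C q * X (⟨N - 2 + 1, by omega⟩ : Fin N) := by
    rw [polyOmega_X_succ, polyOmega_X_zero, e0]
  simp only [Module.End.mul_apply, opOmega_apply]
  refine algHom_dl (fin_ne_succ _) (fin_ne_succ (by omega)) (polyOmega.comp polyOmega) q_ne_zero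
    x0 x1 ?_ f
  intro f
  rw [← AlgHom.comp_apply, ← AlgHom.comp_apply]
  refine DFunLike.congr_fun (MvPolynomial.algHom_ext fun j => ?_) f
  obtain ⟨j, hj⟩ := j
  simp only [AlgHom.comp_apply, rename_X]
  rcases Nat.eq_zero_or_pos j with rfl | hj0
  · rw [Equiv.swap_apply_left, x1, x0, map_mul, polySwap_C, polySwap_X_left]
  · obtain ⟨j, rfl⟩ : ∃ j', j = j' + 1 := ⟨j - 1, by omega⟩
    rcases Nat.eq_zero_or_pos j with rfl | hj1
    · rw [Equiv.swap_apply_right, x1, x0, map_mul, polySwap_C, polySwap_X_right]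
    · obtain ⟨j, rfl⟩ : ∃ j', j = j' + 1 := ⟨j - 1, by omega⟩
      rw [Equiv.swap_apply_of_ne_of_ne (by simp) (by simp), polyOmega_X_succ, polyOmega_X_succ,
        polySwap_X_of_ne (by simp; omega) (by simp; omega)]

theorem opT_mul_opX_of_ne {i : ℕ} {c : Fin N} (h : (c : ℕ) ≠ i) (h' : (c : ℕ) ≠ i + 1) :
    Commute (opT N i) (opX c) := by
  by_cases hi : i + 1 < N
  · rw [opT_of_lt hi]
    refine commute_iff_eq _ _ |>.2 (LinearMap.ext fun f => ?_)
    rw [Module.End.mul_apply, Module.End.mul_apply, opX_apply, opX_apply]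
    refine dl_mul_of_polySwap_eq _ (polySwap_X_of_ne ?_ ?_) f
    · exact fun e => h (congrArg Fin.val e)
    · exact fun e => h' (congrArg Fin.val e)
  · rw [opT, dif_neg hi]
    exact Commute.one_left _

theorem opT_mul_opX_mul_opT {i : ℕ} (h : i + 1 < N) :
    opT N i * opX ⟨i, by omega⟩ * opT N i = t • opX ⟨i + 1, h⟩ := by
  rw [opT_of_lt h]
  refine LinearMap.ext fun f => ?_
  rw [Module.End.mul_apply, Module.End.mul_apply, opX_apply, dl_X_mul_dl, LinearMap.smul_apply,
    smul_eq_C_mul, opX_apply]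

theorem opT_mul_opX {i : ℕ} (h : i + 1 < N) :
    opT N i * opX ⟨i, by omega⟩ = t • (opX ⟨i + 1, h⟩ * opTinv N i) := by
  rw [← smul_mul_assoc, ← opT_mul_opX_mul_opT h, mul_assoc _ _ (opTinv N i), opT_mul_opTinv h,
    mul_one]

theorem opTinv_mul_opX {i : ℕ} (h : i + 1 < N) :
    opTinv N i * opX ⟨i + 1, h⟩ = t⁻¹ • (opX ⟨i, by omega⟩ * opT N i) := by
  have h1 : opX ⟨i + 1, h⟩ = t⁻¹ • (opT N i * opX ⟨i, by omega⟩ * opT N i) := by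
    rw [opT_mul_opX_mul_opT h, smul_smul, inv_mul_cancel₀ t_ne_zero, one_smul]
  rw [h1, mul_smul_comm, mul_assoc (opT N i), ← mul_assoc (opTinv N i), opTinv_mul_opT h, one_mul]

theorem opOmega_mul_opX_succ {j : ℕ} (h : j + 1 < N) :
    opOmega N * opX ⟨j + 1, h⟩ = opX ⟨j, by omega⟩ * opOmega N := by
  refine LinearMap.ext fun f => ?_
  simp only [Module.End.mul_apply, opX_apply, opOmega_apply]
  rw [map_mul, polyOmega_X_succ]

theorem opOmega_mul_opX_zero (h : 0 < N) :
    opOmega N * opX ⟨0, h⟩ = q • (opX ⟨N - 1, by omega⟩ * opOmega N) := by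
  refine LinearMap.ext fun f => ?_
  simp only [Module.End.mul_apply, opX_apply, opOmega_apply, LinearMap.smul_apply]
  rw [map_mul, polyOmega_X_zero, smul_eq_C_mul, mul_assoc]

/-- `T_i T_{i+1} ⋯ T_{i+n-1}`. -/
noncomputable def prodT (N i n : ℕ) : Module.End K (Pol N) :=
  ((List.range' i n).map (opT N)).prod

/-- `T_i⁻¹ T_{i+1}⁻¹ ⋯ T_{i+n-1}⁻¹`. -/
noncomputable def prodTinv (N i n : ℕ) : Module.End K (Pol N) :=
  ((List.range' i n).map (opTinv N)).prod

theorem prodT_succ (i n : ℕ) : prodT N i (n + 1) = opT N i * prodT N (i + 1) n := by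
  rw [prodT, List.range'_succ, List.map_cons, List.prod_cons]
  rfl

theorem prodT_succ' (i n : ℕ) : prodT N i (n + 1) = prodT N i n * opT N (i + n) := by
  rw [prodT, List.range'_1_concat, List.map_append, List.prod_append]
  simp [prodT]

theorem prodTinv_succ (i n : ℕ) : prodTinv N i (n + 1) = opTinv N i * prodTinv N (i + 1) n := by
  rw [prodTinv, List.range'_succ, List.map_cons, List.prod_cons]
  rfl

theorem prodTinv_succ' (i n : ℕ) :
    prodTinv N i (n + 1) = prodTinv N i n * opTinv N (i + n) := by
  rw [prodTinv, List.range'_1_concat, List.map_append, List.prod_append]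
  simp [prodTinv]

theorem prodT_zero (i : ℕ) : prodT N i 0 = 1 := by simp [prodT]

theorem prodTinv_zero (i : ℕ) : prodTinv N i 0 = 1 := by simp [prodTinv]

theorem commute_prodT {A : Module.End K (Pol N)} {i n : ℕ}
    (h : ∀ k, i ≤ k → k < i + n → Commute A (opT N k)) : Commute A (prodT N i n) := by
  induction n with
  | zero => rw [prodT_zero]; exact Commute.one_right _
  | succ n ih =>
    rw [prodT_succ']
    exact (ih fun k h1 h2 => h k h1 (by omega)).mul_right (h _ (by omega) (by omega))

theorem commute_prodTinv {A : Module.End K (Pol N)} {i n : ℕ}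
    (h : ∀ k, i ≤ k → k < i + n → Commute A (opT N k)) : Commute A (prodTinv N i n) := by
  induction n with
  | zero => rw [prodTinv_zero]; exact Commute.one_right _
  | succ n ih =>
    rw [prodTinv_succ']
    exact (ih fun k h1 h2 => h k h1 (by omega)).mul_right
      (commute_opTinv (h _ (by omega) (by omega)))

/-- The Cherednik operator as a linear map. -/
noncomputable def opY (i : Fin N) : Module.End K (Pol N) :=
  t ^ ((i : ℤ) + 1 - N) • (prodT N i (N - 1 - i) * opOmega N * prodTinv N 0 i)

theorem opY_apply (i : Fin N) (f : Pol N) : opY i f = cherednik i f := by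
  have h1 : ∀ (l : List ℕ) (g : Pol N), (l.map (opT N)).prod g = l.foldr polyT g := by
    intro l g
    induction l with
    | nil => rfl
    | cons a l ih => rw [List.map_cons, List.prod_cons, Module.End.mul_apply, ih, opT_apply]; rfl
  have h2 : ∀ (l : List ℕ) (g : Pol N), (l.map (opTinv N)).prod g = l.foldr polyTinv g := by
    intro l g
    induction l with
    | nil => rfl
    | cons a l ih => rw [List.map_cons, List.prod_cons, Module.End.mul_apply, ih, opTinv_apply]; rfl
  rw [opY, cherednik, LinearMap.smul_apply, Module.End.mul_apply, Module.End.mul_apply, prodT,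
    prodTinv, h1, h2, List.range_eq_range']
  rfl

/-- Compared with `Y_{i+1}`, the product defining `Y_i` has one more `T_i` on the left and one fewer
`T_i⁻¹` on the right; the powers of `t` differ by one. -/
theorem opT_mul_opY_mul_opT {i : ℕ} (h : i + 1 < N) :
    opT N i * opY ⟨i + 1, h⟩ * opT N i = t • opY ⟨i, by omega⟩ := by
  have e : N - 1 - i = N - 1 - (i + 1) + 1 := by omega
  have e2 : t ^ (((i + 1 : ℕ) : ℤ) + 1 - N) = t * t ^ ((i : ℤ) + 1 - N) := by
    rw [← zpow_one_add₀ t_ne_zero]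
    congr 1
    push_cast
    ring
  simp only [opY, mul_smul_comm, smul_mul_assoc]
  rw [e, prodT_succ, prodTinv_succ', zero_add, e2, mul_smul]
  congr 2
  simp only [mul_assoc]
  rw [opTinv_mul_opT h, mul_one]

/-- For `j = k + 2` this is the braid relation on the last two factors; any further factor commutes
with `T_k`. -/
theorem prodTinv_mul_opT {j k : ℕ} (hjk : k + 2 ≤ j) (hj : j < N) :
    prodTinv N 0 j * opT N k = opT N (k + 1) * prodTinv N 0 j := by
  induction j, hjk using Nat.le_induction with
  | base =>
    rw [prodTinv_succ', prodTinv_succ', zero_add, zero_add, mul_assoc (prodTinv N 0 k),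
      mul_assoc (prodTinv N 0 k), opT_braid_inv hj, ← mul_assoc,
      ← (commute_prodTinv (N := N) (A := opT N (k + 1)) (i := 0) (n := k)
        fun l _ hl => (opT_comm (by omega)).symm).eq, mul_assoc]
  | succ j hjk ih =>
    rw [prodTinv_succ', zero_add, mul_assoc,
      ← (commute_opTinv (opT_comm (show k + 1 < j by omega))).eq, ← mul_assoc, ih (by omega),
      mul_assoc]

theorem prodT_mul_opT {j k n : ℕ} (hjk : j ≤ k) (hn : k + 2 ≤ j + n) (hN : j + n < N) :
    prodT N j n * opT N k = opT N (k + 1) * prodT N j n := by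
  obtain ⟨d, rfl⟩ := Nat.exists_eq_add_of_le hjk
  clear hjk
  induction d generalizing j n with
  | zero =>
    obtain ⟨n, rfl⟩ : ∃ n', n = n' + 1 + 1 := ⟨n - 2, by omega⟩
    have hb := opT_braid (N := N) (i := j) (by omega)
    rw [add_zero, prodT_succ, prodT_succ, mul_assoc, mul_assoc,
      ← (commute_prodT (N := N) (A := opT N j) (i := j + 1 + 1) (n := n)
        fun l hl _ => opT_comm (by omega)).eq, ← mul_assoc, ← mul_assoc, ← mul_assoc, hb]
    simp only [mul_assoc]
  | succ d ih =>
    obtain ⟨n, rfl⟩ : ∃ n', n = n' + 1 := ⟨n - 1, by omega⟩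
    have := ih (j := j + 1) (n := n) (by omega) (by omega)
    rw [show j + (d + 1) = j + 1 + d by omega, prodT_succ, mul_assoc, this, ← mul_assoc,
      (opT_comm (N := N) (show j + 1 < j + 1 + d + 1 by omega)).eq, mul_assoc]

/-- On its way through `Y_j` the index of `T_k` changes twice, and the changes cancel. If `k + 1 <
j`, the inverses raise it and `ω` lowers it again. If `j < k`, `ω` lowers it and the product of the
`T` raises it again. The remaining product commutes with the operator. -/
theorem commute_opT_opY {k : ℕ} {j : Fin N} (hk : k + 1 < N) (h : k + 1 < j ∨ (j : ℕ) < k) :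
    Commute (opT N k) (opY j) := by
  obtain ⟨j, hj⟩ := j
  simp only at h
  rw [opY]
  refine Commute.smul_right ?_ _
  rw [commute_iff_eq]
  simp only
  symm
  rcases h with h | h
  · rw [mul_assoc, prodTinv_mul_opT h hj, ← mul_assoc, mul_assoc (prodT N _ _),
      opOmega_mul_opT_succ (by omega), ← mul_assoc,
      ← (commute_prodT (A := opT N k) fun l hl _ => opT_comm (by omega)).eq]
    simp only [mul_assoc]
  · obtain ⟨k, rfl⟩ : ∃ k', k = k' + 1 := ⟨k - 1, by omega⟩
    rw [mul_assoc, ← (commute_prodTinv (A := opT N (k + 1)) fun l _ hl =>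
      (opT_comm (by omega)).symm).eq, ← mul_assoc, mul_assoc (prodT N _ _),
      opOmega_mul_opT_succ (by omega), ← mul_assoc, prodT_mul_opT (by omega) (by omega) (by omega)]
    simp only [mul_assoc]

/-- The raising operator `f ↦ x_N · ω f`. -/
noncomputable def opPhi (h : 0 < N) : Module.End K (Pol N) := opX ⟨N - 1, by omega⟩ * opOmega N

theorem semiconj_prodTinv {A : Module.End K (Pol N)} {i n : ℕ}
    (h : ∀ k, i ≤ k → k < i + n → A * opT N (k + 1) = opT N k * A) :
    A * prodTinv N (i + 1) n = prodTinv N i n * A := by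
  induction n with
  | zero => rw [prodTinv_zero, prodTinv_zero, mul_one, one_mul]
  | succ n ih =>
    have h2 : SemiconjBy A (opTinv N (i + n + 1)) (opTinv N (i + n)) :=
      semiconj_opTinv (h _ (by omega) (by omega))
    have h2' : A * opTinv N (i + n + 1) = opTinv N (i + n) * A := h2
    rw [prodTinv_succ', prodTinv_succ', ← mul_assoc, ih fun k h1 h2 => h k h1 (by omega), mul_assoc,
      show i + 1 + n = i + n + 1 by omega, h2', mul_assoc]

theorem semiconj_prodT {A : Module.End K (Pol N)} {i n : ℕ}
    (h : ∀ k, i ≤ k → k < i + n → A * opT N (k + 1) = opT N k * A) :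
    A * prodT N (i + 1) n = prodT N i n * A := by
  induction n with
  | zero => rw [prodT_zero, prodT_zero, mul_one, one_mul]
  | succ n ih =>
    rw [prodT_succ', prodT_succ', ← mul_assoc, ih fun k h1 h2 => h k h1 (by omega), mul_assoc,
      show i + 1 + n = i + n + 1 by omega, h _ (by omega) (by omega), mul_assoc]

/-- Moving `x_N` to the left across `ω` and across the last factor `T` turns that factor into `t`
times its inverse. The inverse is carried through `ω ^ 2` and becomes the factor `T_0⁻¹` that
`Y_{i+1}` has in excess of the shifted product; the factor `t` is the difference of the
normalisations. -/
theorem opY_mul_opPhi {i : ℕ} (h : i + 1 < N) :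
    opY ⟨i, by omega⟩ * opPhi (by omega : 0 < N) =
      opPhi (by omega : 0 < N) * opY ⟨i + 1, h⟩ := by
  obtain ⟨N, rfl⟩ : ∃ N', N = N' + 2 := ⟨N - 2, by omega⟩
  have hω : ∀ k, k + 2 < N + 2 →
      opOmega (N + 2) * opT (N + 2) (k + 1) = opT (N + 2) k * opOmega (N + 2) :=
    fun k hk => opOmega_mul_opT_succ hk
  have e2 : t ^ (((i + 1 : ℕ) : ℤ) + 1 - ((N + 2 : ℕ) : ℤ)) =
      t ^ ((i : ℤ) + 1 - ((N + 2 : ℕ) : ℤ)) * t := by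
    rw [← zpow_add_one₀ t_ne_zero]
    congr 1
    push_cast
    ring
  have c1 : Commute (opX (⟨N + 1, by omega⟩ : Fin (N + 2))) (prodTinv (N + 2) 0 i) :=
    commute_prodTinv fun k _ hk => (opT_mul_opX_of_ne (by simp; omega) (by simp; omega)).symm
  have c2 : Commute (opX (⟨N + 1, by omega⟩ : Fin (N + 2))) (prodT (N + 2) i (N - i)) :=
    commute_prodT fun k _ hk => (opT_mul_opX_of_ne (by simp; omega) (by simp; omega)).symm
  have s1 : opOmega (N + 2) * prodTinv (N + 2) (0 + 1) i =
      prodTinv (N + 2) 0 i * opOmega (N + 2) :=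
    semiconj_prodTinv fun k _ hk => hω k (by omega)
  have s2 : opOmega (N + 2) * prodT (N + 2) (i + 1) (N - i) =
      prodT (N + 2) i (N - i) * opOmega (N + 2) :=
    semiconj_prodT fun k _ hk => hω k (by omega)
  have x1 := opOmega_mul_opX_succ (N := N + 2) (j := N) (by omega)
  have x2 := opT_mul_opX (N := N + 2) (i := N) (by omega)
  have x3 : opOmega (N + 2) * opOmega (N + 2) * opTinv (N + 2) 0 =
      opTinv (N + 2) N * (opOmega (N + 2) * opOmega (N + 2)) :=
    semiconj_opTinv (opOmega_sq_mul_opT_zero (by omega))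
  simp only [opY, opPhi, mul_smul_comm, smul_mul_assoc]
  rw [e2, mul_smul]
  congr 1
  rw [show N + 2 - 1 - i = N - i + 1 by omega, show N + 2 - 1 - (i + 1) = N - i by omega,
    prodT_succ', show i + (N - i) = N by omega, prodTinv_succ]
  simp only [show N + 2 - 1 = N + 1 by omega]
  set ω := opOmega (N + 2)
  set x := opX (⟨N + 1, by omega⟩ : Fin (N + 2))
  set A := prodT (N + 2) i (N - i)
  set B := prodTinv (N + 2) 0 i
  calc A * opT (N + 2) N * ω * B * (x * ω)
      = A * (opT (N + 2) N * (ω * (B * x * ω))) := by simp only [mul_assoc]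
    _ = A * (opT (N + 2) N * (ω * x * (B * ω))) := by rw [← c1.eq]; simp only [mul_assoc]
    _ = A * (opT (N + 2) N * opX ⟨N, by omega⟩ * (ω * (B * ω))) := by
        rw [x1]; simp only [mul_assoc]
    _ = t • (A * x * (opTinv (N + 2) N * (ω * (B * ω)))) := by
        rw [x2]; simp only [mul_assoc, smul_mul_assoc, mul_smul_comm]
    _ = t • (x * A * (opTinv (N + 2) N * (ω * ω) * prodTinv (N + 2) (0 + 1) i)) := by
        rw [c2.eq, ← s1]; simp only [mul_assoc]
    _ = t • (x * (A * ω) * (ω * (opTinv (N + 2) 0 * prodTinv (N + 2) (0 + 1) i))) := by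
        rw [← x3]; simp only [mul_assoc]
    _ = _ := by rw [← s2]; simp only [mul_assoc]

/-- Each inverse turns into a `T` at the cost of `t⁻¹` while the index of the variable drops by one.
-/
theorem prodTinv_mul_opX {j : ℕ} (h : j < N) :
    prodTinv N 0 j * opX ⟨j, h⟩ =
      t ^ (-(j : ℤ)) • (opX ⟨0, by omega⟩ * prodT N 0 j) := by
  induction j with
  | zero => simp [prodTinv_zero, prodT_zero]
  | succ j ih =>
    rw [prodTinv_succ', prodT_succ', zero_add, mul_assoc, opTinv_mul_opX h, mul_smul_comm,
      ← mul_assoc, ih (by omega), smul_mul_assoc, smul_smul, mul_assoc]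
    congr 1
    rw [← zpow_neg_one, ← zpow_add₀ t_ne_zero]
    congr 1
    push_cast
    ring

/-- The variable travels through all inverses to become the first one, and `ω` brings it back to the
end with the factor `q`. -/
theorem opY_last_mul_opPhi (h : 0 < N) :
    opY ⟨N - 1, by omega⟩ * opPhi h = q • (opPhi h * opY ⟨0, h⟩) := by
  have e1 : ((N - 1 : ℕ) : ℤ) + 1 - N = 0 := by omega
  simp only [opY, opPhi, e1, zpow_zero, one_smul, Nat.sub_self, prodT_zero, one_mul,
    prodTinv_zero, mul_one, mul_smul_comm, Nat.sub_zero]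
  rw [mul_assoc (opOmega N), ← mul_assoc (prodTinv N 0 (N - 1)), prodTinv_mul_opX, smul_mul_assoc,
    mul_smul_comm, ← mul_assoc, ← mul_assoc, opOmega_mul_opX_zero h, smul_mul_assoc,
    smul_mul_assoc, smul_comm]
  simp only [mul_assoc]
  congr 3
  push_cast [Nat.one_le_iff_ne_zero.2 h.ne']
  omega

end Cherednik

/-! ## Compositions -/

section Compositions

/-- The composition `(η_2, …, η_N, η_1 + 1)`. -/
def phi {n : ℕ} (η : Fin (n + 1) → ℕ) : Fin (n + 1) → ℕ :=
  Fin.snoc (α := fun _ => ℕ) (fun j => η j.succ) (η 0 + 1)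

@[simp] theorem phi_castSucc {n : ℕ} (η : Fin (n + 1) → ℕ) (j : Fin n) :
    phi η j.castSucc = η j.succ := by simp [phi]

@[simp] theorem phi_last {n : ℕ} (η : Fin (n + 1) → ℕ) : phi η (Fin.last n) = η 0 + 1 := by
  simp [phi]

theorem phi_injective {n : ℕ} : Function.Injective (phi (n := n)) := by
  intro η ν h
  funext j
  refine Fin.cases ?_ (fun j => ?_) j
  · simpa using congrFun h (Fin.last n)
  · simpa using congrFun h j.castSucc

theorem circleRow_eq_sum {N : ℕ} (η : Fin N → ℕ) (i : Fin N) :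
    circleRow η i = ∑ j, if η i < η j ∨ (η j = η i ∧ j < i) then 1 else 0 := by
  rw [circleRow, Finset.card_filter]

/-- At the front, the entry `η 0` wins ties and so precedes `η i` when `η i ≤ η 0`; at the end, `η 0
+ 1` loses ties and precedes it when `η i < η 0 + 1`. The two conditions agree. -/
theorem circleRow_phi_castSucc {n : ℕ} (η : Fin (n + 1) → ℕ) (i : Fin n) :
    circleRow (phi η) i.castSucc = circleRow η i.succ := by
  rw [circleRow_eq_sum, circleRow_eq_sum, Fin.sum_univ_castSucc, Fin.sum_univ_succ, add_comm]
  simp only [phi_castSucc, phi_last, Fin.castSucc_lt_castSucc_iff, Fin.succ_lt_succ_iff]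
  congr 1
  have h1 : ¬ Fin.last n < i.castSucc := not_lt.2 (Fin.le_last _)
  simp only [h1, Fin.succ_pos]
  congr 1
  simp only [and_false, or_false, and_true, eq_iff_iff]
  omega

theorem circleRow_phi_last {n : ℕ} (η : Fin (n + 1) → ℕ) :
    circleRow (phi η) (Fin.last n) = circleRow η 0 := by
  rw [circleRow_eq_sum, circleRow_eq_sum, Fin.sum_univ_castSucc, Fin.sum_univ_succ, add_comm]
  simp only [phi_castSucc, phi_last, lt_irrefl, and_false, or_false, if_false, Fin.not_lt_zero,
    zero_add, Fin.castSucc_lt_last, and_true]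
  refine Finset.sum_congr rfl fun j _ => ?_
  congr 1
  simp only [eq_iff_iff]
  omega

variable {N : ℕ}

theorem swapEntries_left (η : Fin N → ℕ) {i : ℕ} (hi : i + 1 < N) :
    swapEntries η i hi ⟨i, by omega⟩ = η ⟨i + 1, hi⟩ := by
  rw [swapEntries, Function.comp, Equiv.swap_apply_left]

theorem swapEntries_right (η : Fin N → ℕ) {i : ℕ} (hi : i + 1 < N) :
    swapEntries η i hi ⟨i + 1, hi⟩ = η ⟨i, by omega⟩ := by
  rw [swapEntries, Function.comp, Equiv.swap_apply_right]

theorem swapEntries_of_ne (η : Fin N → ℕ) {i : ℕ} (hi : i + 1 < N) {j : Fin N} (h : (j : ℕ) ≠ i)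
    (h' : (j : ℕ) ≠ i + 1) : swapEntries η i hi j = η j := by
  rw [swapEntries, Function.comp, Equiv.swap_apply_of_ne_of_ne (fun e => h (congrArg Fin.val e))
    (fun e => h' (congrArg Fin.val e))]

theorem swapEntries_swapEntries (η : Fin N → ℕ) {i : ℕ} (hi : i + 1 < N) :
    swapEntries (swapEntries η i hi) i hi = η := by
  funext j
  simp [swapEntries]

theorem swapEntries_of_eq (η : Fin N → ℕ) {i : ℕ} (hi : i + 1 < N)
    (h : η ⟨i, by omega⟩ = η ⟨i + 1, hi⟩) : swapEntries η i hi = η := by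
  funext j
  by_cases h1 : (j : ℕ) = i
  · obtain rfl : j = ⟨i, Nat.lt_of_succ_lt hi⟩ := Fin.ext h1
    rw [swapEntries_left, h]
  · by_cases h2 : (j : ℕ) = i + 1
    · obtain rfl : j = ⟨i + 1, hi⟩ := Fin.ext h2
      rw [swapEntries_right, h]
    · exact swapEntries_of_ne η hi h1 h2

theorem sum_swapEntries (η : Fin N → ℕ) {i : ℕ} (hi : i + 1 < N) :
    ∑ j, swapEntries η i hi j = ∑ j, η j :=
  Equiv.sum_comp (Equiv.swap (⟨i, by omega⟩ : Fin N) ⟨i + 1, hi⟩) η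

theorem swap_lt_swap_iff {i : ℕ} (hi : i + 1 < N) {j k : Fin N}
    (h : ¬ ((j : ℕ) = i ∧ (k : ℕ) = i + 1)) (h' : ¬ ((j : ℕ) = i + 1 ∧ (k : ℕ) = i)) :
    Equiv.swap (⟨i, by omega⟩ : Fin N) ⟨i + 1, hi⟩ j <
      Equiv.swap (⟨i, by omega⟩ : Fin N) ⟨i + 1, hi⟩ k ↔ j < k := by
  obtain ⟨j, hj⟩ := j
  obtain ⟨k, hk⟩ := k
  simp only at h h'
  rw [Equiv.swap_apply_def, Equiv.swap_apply_def]
  simp only [Fin.mk.injEq]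
  split_ifs <;> simp only [Fin.mk_lt_mk] <;> omega

/-- Rows depend on positions only through the order of equal entries, and the adjacent transposition
reverses the order of no pair of positions other than the one it exchanges. -/
theorem circleRow_swapEntries (η : Fin N → ℕ) {i : ℕ} (hi : i + 1 < N)
    (h : η ⟨i, by omega⟩ ≠ η ⟨i + 1, hi⟩) (k : Fin N) :
    circleRow (swapEntries η i hi) k =
      circleRow η (Equiv.swap (⟨i, by omega⟩ : Fin N) ⟨i + 1, hi⟩ k) := by
  rw [circleRow_eq_sum, circleRow_eq_sum]
  conv_rhs => rw [← Equiv.sum_comp (Equiv.swap (⟨i, by omega⟩ : Fin N) ⟨i + 1, hi⟩)]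
  refine Finset.sum_congr rfl fun j _ => ?_
  simp only [swapEntries, Function.comp]
  congr 1
  simp only [eq_iff_iff]
  refine or_congr Iff.rfl (and_congr_right fun e => (swap_lt_swap_iff hi ?_ ?_).symm)
  · rintro ⟨h1, h2⟩
    obtain rfl : j = ⟨i, Nat.lt_of_succ_lt hi⟩ := Fin.ext h1
    obtain rfl : k = ⟨i + 1, hi⟩ := Fin.ext h2
    rw [Equiv.swap_apply_left, Equiv.swap_apply_right] at e
    exact h e.symm
  · rintro ⟨h1, h2⟩
    obtain rfl : k = ⟨i, Nat.lt_of_succ_lt hi⟩ := Fin.ext h2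
    obtain rfl : j = ⟨i + 1, hi⟩ := Fin.ext h1
    rw [Equiv.swap_apply_left, Equiv.swap_apply_right] at e
    exact h e

theorem circleRow_succ_of_eq (η : Fin N → ℕ) {i : ℕ} (hi : i + 1 < N)
    (h : η ⟨i, by omega⟩ = η ⟨i + 1, hi⟩) :
    circleRow η ⟨i + 1, hi⟩ = circleRow η ⟨i, by omega⟩ + 1 := by
  rw [circleRow, circleRow, ← Finset.card_insert_of_notMem (a := (⟨i, by omega⟩ : Fin N))
    (by simp)]
  congr 1
  ext j
  simp only [Finset.mem_filter, Finset.mem_univ, true_and, Finset.mem_insert, ← h]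
  constructor
  · rintro (h1 | ⟨h1, h2⟩)
    · exact Or.inr (Or.inl h1)
    · rcases Nat.lt_succ_iff_lt_or_eq.1 (show (j : ℕ) < i + 1 from h2) with h3 | h3
      · exact Or.inr (Or.inr ⟨h1, h3⟩)
      · exact Or.inl (Fin.ext h3)
  · rintro (rfl | h1 | ⟨h1, h2⟩)
    · exact Or.inr ⟨rfl, by simp⟩
    · exact Or.inl h1
    · exact Or.inr ⟨h1, lt_trans h2 (by simp)⟩

/-- Every composition is reached from `0` by the moves `phi` and by exchanging an ascent. -/
theorem composition_induction {n : ℕ} {P : (Fin (n + 1) → ℕ) → Prop} (h0 : P 0)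
    (hphi : ∀ η, P η → P (phi η))
    (hswap : ∀ (η : Fin (n + 1) → ℕ) (i : ℕ) (hi : i + 1 < n + 1),
      η ⟨i, by omega⟩ < η ⟨i + 1, hi⟩ → P η → P (swapEntries η i hi)) (η : Fin (n + 1) → ℕ) :
    P η := by
  -- Induction on the size `d` and then on `e`, which weights entries more the further left they
  -- are. If the last entry is positive, the composition is `phi` of a smaller one. Otherwise some
  -- nonzero entry stands just before a zero; moving it to the right lowers `e`, and exchanging the
  -- resulting ascent restores the composition.
  have main : ∀ d e : ℕ, ∀ η : Fin (n + 1) → ℕ, ∑ j, η j = d →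
      ∑ j : Fin (n + 1), (n - (j : ℕ)) * η j = e → P η := by
    intro d
    induction d using Nat.strong_induction_on with
    | _ d ihd =>
      intro e
      induction e using Nat.strong_induction_on with
      | _ e ihe =>
        intro η hd he
        by_cases hz : η = 0
        · rw [hz]; exact h0
        by_cases hl : η (Fin.last n) = 0
        · obtain ⟨i, hi, h1, h2⟩ : ∃ (i : ℕ) (hi : i + 1 < n + 1),
              η ⟨i, by omega⟩ ≠ 0 ∧ η ⟨i + 1, hi⟩ = 0 := by
            by_contra hcon
            push Not at hcon
            apply hz
            have : ∀ k (hk : k ≤ n), η ⟨n - k, by omega⟩ = 0 := by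
              intro k
              induction k with
              | zero => intro _; exact hl
              | succ k ihk =>
                intro hk
                by_contra hne
                refine hcon (n - (k + 1)) (by omega) hne ?_
                rw [← ihk (by omega)]
                congr 2
                omega
            funext j
            have := this (n - j) (by omega)
            simp only [Pi.zero_apply]
            rw [← this]
            congr 1
            exact Fin.ext (by simp; omega)
          set η' := swapEntries η i hi with hη'
          have hx := swapEntries_left η hi
          have hy := swapEntries_right η hi
          rw [← hη'] at hx hy
          have key : P η' := by
            refine ihe _ ?_ η' ((sum_swapEntries η hi).trans hd) rfl
            rw [← he]
            have hasc : η' ⟨i, by omega⟩ < η' ⟨i + 1, hi⟩ := by rw [hx, hy]; omega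
            have hlt := swapEntries_lt η' i hi hasc
            have hinv : swapEntries η' i hi = η := swapEntries_swapEntries η hi
            rw [hinv] at hlt
            -- The weights `n - j` and `j` are complementary, so an increase of one weighted sum is
            -- a decrease of the other.
            have hs : ∀ ν : Fin (n + 1) → ℕ, ∑ j : Fin (n + 1), (n - (j : ℕ)) * ν j +
                ∑ j : Fin (n + 1), (j : ℕ) * ν j = n * ∑ j, ν j := by
              intro ν
              rw [← Finset.sum_add_distrib, Finset.mul_sum]
              refine Finset.sum_congr rfl fun j _ => ?_
              rw [← add_mul]
              congr 1
              omega
            have e1 := hs η'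
            have e2 := hs η
            have e3 : ∑ j, η' j = ∑ j, η j := sum_swapEntries η hi
            rw [e3] at e1
            omega
          have := hswap η' i hi (by rw [hx, hy]; omega) key
          rwa [hη', swapEntries_swapEntries] at this
        · set ν : Fin (n + 1) → ℕ := Fin.cons (η (Fin.last n) - 1) fun j => η j.castSucc with hν
          have hpν : phi ν = η := by
            funext j
            refine Fin.lastCases ?_ (fun j => ?_) j
            · rw [phi_last, hν, Fin.cons_zero]
              omega
            · rw [phi_castSucc, hν, Fin.cons_succ]
          rw [← hpν]
          refine hphi ν (ihd _ ?_ _ ν rfl rfl)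
          rw [← hd, Fin.sum_univ_succ, Fin.sum_univ_castSucc, hν]
          simp only [Fin.cons_zero, Fin.cons_succ]
          omega
  exact main _ _ η rfl rfl

/-! ### The Bruhat order on compositions -/

/-- `κ` is obtained from `ν` by an affine reflection that increases it in the Bruhat order. -/
def Step (ν κ : Fin N → ℕ) : Prop :=
  ∃ i j : Fin N, i < j ∧ (∀ c, c ≠ i → c ≠ j → ν c = κ c) ∧ ν i + ν j = κ i + κ j ∧
    (max (ν i) (ν j) < max (κ i) (κ j) ∨ (ν i = κ j ∧ ν j = κ i ∧ ν i < ν j))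

/-- A rank function for the Bruhat order. -/
def compRank (ν : Fin N → ℕ) : ℕ := ∑ j : Fin N, (N * ν j ^ 2 + (N - 1 - j) * ν j)

/-- Spreading two entries apart raises the sum of squares enough that the factor `N`, larger than
any difference of the weights, outweighs a loss in the linear part. Exchanging an ascent keeps the
squares and gains `(w - v)(b - a)`. -/
theorem rank_arith {N w v a b a' b' : ℤ} (hvw : v < w) (hwN : w < N) (hv : 0 ≤ v)
    (hs : a + b = a' + b')
    (h : (a < a' ∧ b < a') ∨ (a < b' ∧ b < b') ∨ (a = b' ∧ b = a' ∧ a < b)) :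
    N * a ^ 2 + w * a + (N * b ^ 2 + v * b) < N * a' ^ 2 + w * a' + (N * b' ^ 2 + v * b') := by
  rcases h with ⟨h1, h2⟩ | ⟨h1, h2⟩ | ⟨rfl, rfl, h⟩
  · obtain rfl : b' = a + b - a' := by linarith
    have h3 : 0 < (a' - a) * (a' - b) := mul_pos (by linarith) (by linarith)
    nlinarith [mul_pos (show 0 < N by linarith) h3, mul_pos (sub_pos.2 hvw) (sub_pos.2 h1)]
  · obtain rfl : a' = a + b - b' := by linarith
    have h4 : (b' - b) ≤ (b' - b) * (b' - a) := by nlinarith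
    have h5 : (w - v) * (b' - b) ≤ N * (b' - b) :=
      mul_le_mul_of_nonneg_right (by linarith) (by linarith)
    have h3 : 0 < (b' - b) * (b' - a) := mul_pos (by linarith) (by linarith)
    nlinarith [mul_le_mul_of_nonneg_left h4 (show 0 ≤ N by linarith),
      mul_pos (show 0 < N by linarith) h3]
  · nlinarith [mul_pos (sub_pos.2 hvw) (sub_pos.2 h)]

theorem Step.compRank_lt {ν κ : Fin N → ℕ} (h : Step ν κ) : compRank ν < compRank κ := by
  obtain ⟨i, j, hij, hc, hs, h⟩ := h
  have key : ∀ f : Fin N → ℕ, ∑ c, f c = f i + f j + ∑ c ∈ (Finset.univ.erase i).erase j, f c := by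
    intro f
    rw [← Finset.add_sum_erase _ f (Finset.mem_univ i),
      ← Finset.add_sum_erase _ f (Finset.mem_erase.2 ⟨hij.ne', Finset.mem_univ j⟩), add_assoc]
  rw [compRank, compRank, key, key]
  have e : ∑ c ∈ (Finset.univ.erase i).erase j, (N * ν c ^ 2 + (N - 1 - c) * ν c) =
      ∑ c ∈ (Finset.univ.erase i).erase j, (N * κ c ^ 2 + (N - 1 - c) * κ c) := by
    refine Finset.sum_congr rfl fun c hcm => ?_
    rw [Finset.mem_erase, Finset.mem_erase] at hcm
    rw [hc c hcm.2.1 hcm.1]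
  rw [e]
  refine Nat.add_lt_add_right ?_ _
  have hw : ∃ w v : ℕ, N - 1 - (i : ℕ) = w ∧ N - 1 - (j : ℕ) = v ∧ v < w ∧ w < N := by
    refine ⟨_, _, rfl, rfl, ?_, ?_⟩ <;> omega
  obtain ⟨w, v, hw, hv, hvw, hwN⟩ := hw
  rw [hw, hv]
  generalize ν i = a at *
  generalize ν j = b at *
  generalize κ i = a' at *
  generalize κ j = b' at *
  have h' : (a < a' ∧ b < a') ∨ (a < b' ∧ b < b') ∨ (a = b' ∧ b = a' ∧ a < b) := by omega
  zify at hvw hwN hs h' ⊢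
  exact rank_arith hvw hwN (by positivity) hs h'

theorem compRank_le {ν κ : Fin N → ℕ} (h : ReflTransGen Step ν κ) : compRank ν ≤ compRank κ := by
  induction h with
  | refl => exact le_rfl
  | tail _ h ih => exact ih.trans h.compRank_lt.le

theorem compRank_lt {ν κ : Fin N → ℕ} (h : ReflTransGen Step ν κ) (hne : ν ≠ κ) :
    compRank ν < compRank κ := by
  rcases h.cases_tail with h | ⟨ρ, h1, h2⟩
  · exact absurd h.symm hne
  · exact (compRank_le h1).trans_lt h2.compRank_lt

theorem step_swapEntries {η : Fin N → ℕ} {i : ℕ} (hi : i + 1 < N)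
    (h : η ⟨i, by omega⟩ < η ⟨i + 1, hi⟩) : Step η (swapEntries η i hi) := by
  refine ⟨⟨i, by omega⟩, ⟨i + 1, hi⟩, by simp, fun c h1 h2 => ?_, ?_, Or.inr ⟨?_, ?_, h⟩⟩
  · rw [swapEntries_of_ne η hi (fun e => h1 (Fin.ext e)) (fun e => h2 (Fin.ext e))]
  · rw [swapEntries_left, swapEntries_right, add_comm]
  · rw [swapEntries_right]
  · rw [swapEntries_left]

/-- Conjugating a reflection by an adjacent transposition keeps the direction of the step, unless
the step is that very transposition. -/
theorem Step.swapEntries {ν κ : Fin N → ℕ} (h : Step ν κ) {k : ℕ} (hk : k + 1 < N) :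
    Step (swapEntries ν k hk) (swapEntries κ k hk) ∨ MSym.swapEntries ν k hk = κ := by
  obtain ⟨i, j, hij, hc, hs, h⟩ := h
  by_cases hcase : (i : ℕ) = k ∧ (j : ℕ) = k + 1
  · obtain rfl : i = ⟨k, Nat.lt_of_succ_lt hk⟩ := Fin.ext hcase.1
    obtain rfl : j = ⟨k + 1, hk⟩ := Fin.ext hcase.2
    rcases h with h | ⟨h1, h2, -⟩
    · refine Or.inl ⟨_, _, hij, fun c h1 h2 => ?_, ?_, Or.inl ?_⟩
      · rw [swapEntries_of_ne ν hk (fun e => h1 (Fin.ext e)) (fun e => h2 (Fin.ext e)),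
          swapEntries_of_ne κ hk (fun e => h1 (Fin.ext e)) (fun e => h2 (Fin.ext e)), hc c h1 h2]
      · simp only [swapEntries_left, swapEntries_right]
        omega
      · simp only [swapEntries_left, swapEntries_right]
        omega
    · right
      funext c
      by_cases e1 : c = ⟨k, by omega⟩
      · rw [e1, swapEntries_left, h2]
      · by_cases e2 : c = ⟨k + 1, hk⟩
        · rw [e2, swapEntries_right, h1]
        · rw [swapEntries_of_ne ν hk (fun e => e1 (Fin.ext e)) (fun e => e2 (Fin.ext e)),
            hc c e1 e2]
  · left
    set s := Equiv.swap (⟨k, by omega⟩ : Fin N) ⟨k + 1, hk⟩ with hsdef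
    have hval : ∀ (μ : Fin N → ℕ) c, MSym.swapEntries μ k hk (s c) = μ c := by
      intro μ c
      simp [MSym.swapEntries, hsdef]
    have hlt : s i < s j := (swap_lt_swap_iff hk hcase fun e => by
      have : (i : ℕ) < j := hij
      omega).2 hij
    refine ⟨s i, s j, hlt, fun c h1 h2 => ?_, ?_, ?_⟩
    · obtain ⟨c, rfl⟩ := s.surjective c
      rw [hval, hval]
      exact hc c (fun e => h1 (by rw [e])) (fun e => h2 (by rw [e]))
    · simpa only [hval] using hs
    · simpa only [hval] using h

/-- The lifting property of the Bruhat order, obtained by transporting a chain of steps until the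
exceptional case of `Step.swapEntries` occurs, where the chain collapses onto the original one. -/
theorem reflTransGen_swapEntries {ν η : Fin N → ℕ} (h : ReflTransGen Step ν η) {k : ℕ}
    (hk : k + 1 < N) : ReflTransGen Step (swapEntries ν k hk) η ∨
      ReflTransGen Step (swapEntries ν k hk) (swapEntries η k hk) := by
  induction h with
  | refl => exact Or.inr .refl
  | tail _ h ih =>
    rcases ih with ih | ih
    · exact Or.inl (ih.tail h)
    · rcases h.swapEntries hk with h2 | h2
      · exact Or.inr (ih.tail h2)
      · left
        rwa [h2] at ih

theorem Step.phi {n : ℕ} {ν κ : Fin (n + 1) → ℕ} (h : Step ν κ) : Step (phi ν) (phi κ) := by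
  obtain ⟨i, j, hij, hc, hs, h⟩ := h
  obtain ⟨j, rfl⟩ := Fin.exists_succ_eq_of_ne_zero (Fin.ne_zero_of_lt hij)
  -- If the first place is involved, it becomes the last one and the pair changes order. The added
  -- `1` compensates: an exchange of an ascent becomes a growth of the maximum, and a growth of the
  -- maximum may become such an exchange.
  rcases Fin.eq_zero_or_eq_succ i with rfl | ⟨i, rfl⟩
  · refine ⟨j.castSucc, Fin.last n, Fin.castSucc_lt_last j, fun c h1 h2 => ?_, ?_, ?_⟩
    · obtain ⟨c, rfl⟩ := Fin.exists_castSucc_eq.2 h2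
      rw [phi_castSucc, phi_castSucc]
      exact hc _ (Fin.succ_ne_zero c) fun e => h1 (by rw [Fin.succ_injective _ e])
    · rw [phi_castSucc, phi_castSucc, phi_last, phi_last]
      omega
    · rw [phi_castSucc, phi_castSucc, phi_last, phi_last]
      omega
  · refine ⟨i.castSucc, j.castSucc, ?_, fun c h1 h2 => ?_, ?_, ?_⟩
    · simpa using hij
    · rcases Fin.eq_castSucc_or_eq_last c with ⟨c, rfl⟩ | rfl
      · rw [phi_castSucc, phi_castSucc]
        exact hc _ (fun e => h1 (by rw [Fin.succ_injective _ e]))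
          fun e => h2 (by rw [Fin.succ_injective _ e])
      · rw [phi_last, phi_last, hc 0 (Fin.succ_ne_zero i).symm (Fin.succ_ne_zero j).symm]
    · simpa only [phi_castSucc] using hs
    · simpa only [phi_castSucc] using h

theorem reflTransGen_phi {n : ℕ} {ν κ : Fin (n + 1) → ℕ} (h : ReflTransGen Step ν κ) :
    ReflTransGen Step (phi ν) (phi κ) := h.lift phi fun _ _ => Step.phi

end Compositions

/-- A family that is triangular with respect to a separating family of functionals is a basis. -/
theorem linearIndependent_and_span_of_triangular {k M ι : Type*} [Field k] [AddCommGroup M]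
    [Module k M] (φ : ι → M →ₗ[k] k) (v : ι → M) (ρ : ι → ℕ)
    (hfin : ∀ f, {i | φ i f ≠ 0}.Finite) (hinj : ∀ f, (∀ i, φ i f = 0) → f = 0)
    (hd : ∀ i, φ i (v i) ≠ 0) (ht : ∀ i j, φ j (v i) ≠ 0 → j = i ∨ ρ j < ρ i) :
    LinearIndependent k v ∧ ⊤ ≤ Submodule.span k (Set.range v) := by
  classical
  constructor
  · rw [linearIndependent_iff']
    intro s g hg
    by_contra hcon
    push Not at hcon
    -- At an index of maximal rank the functional annihilates all other terms of the relation.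
    obtain ⟨i, hi, hmax⟩ := (s.filter fun i => g i ≠ 0).exists_max_image ρ
      (hcon.imp fun i hi => Finset.mem_filter.2 hi)
    rw [Finset.mem_filter] at hi
    have h := congrArg (φ i) hg
    rw [map_sum, map_zero, Finset.sum_eq_single i] at h
    · rw [map_smul, smul_eq_mul] at h
      exact mul_ne_zero hi.2 (hd i) h
    · intro j hj hji
      rw [map_smul, smul_eq_mul]
      by_contra hne
      rcases mul_ne_zero_iff.1 hne with ⟨h1, h2⟩
      rcases ht j i h2 with h3 | h3
      · exact hji h3.symm
      · exact absurd (hmax j (Finset.mem_filter.2 ⟨hj, h1⟩)) (not_le.2 h3)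
    · exact fun h => absurd hi.1 h
  · have main : ∀ r : ℕ, ∀ f : M, (∀ i, φ i f ≠ 0 → ρ i < r) →
        f ∈ Submodule.span k (Set.range v) := by
      intro r
      induction r with
      | zero =>
        intro f hf
        rw [hinj f fun i => by_contra fun h => absurd (hf i h) (Nat.not_lt_zero _)]
        exact Submodule.zero_mem _
      | succ r ih =>
        intro f hf
        -- Vectors of equal rank do not disturb each other's coordinates, so the whole layer of rank
        -- `r` can be cleared at once.
        set s := (hfin f).toFinset.filter fun i => ρ i = r with hs
        set g := ∑ i ∈ s, (φ i f / φ i (v i)) • v i with hg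
        have hgm : g ∈ Submodule.span k (Set.range v) :=
          Submodule.sum_mem _ fun i _ => Submodule.smul_mem _ _ (Submodule.subset_span ⟨i, rfl⟩)
        rw [← sub_add_cancel f g]
        refine Submodule.add_mem _ (ih _ fun j hj => ?_) hgm
        have hgj : φ j g = ∑ i ∈ s, φ i f / φ i (v i) * φ j (v i) := by
          rw [hg, map_sum]
          simp only [map_smul, smul_eq_mul]
        rw [map_sub, hgj] at hj
        by_contra hr
        apply hj
        rw [sub_eq_zero]
        have hother : ∀ i ∈ s, i ≠ j → φ i f / φ i (v i) * φ j (v i) = 0 := by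
          intro i hi hij
          rw [hs, Finset.mem_filter] at hi
          by_contra hne
          rcases ht i j (right_ne_zero_of_mul hne) with h3 | h3
          · exact hij h3.symm
          · omega
        by_cases hjs : j ∈ s
        · rw [Finset.sum_eq_single_of_mem j hjs hother, div_mul_cancel₀ _ (hd j)]
        · rw [Finset.sum_eq_zero fun i hi => hother i hi fun e => hjs (e ▸ hi)]
          by_contra hne
          have h1 := hf j hne
          exact hjs (by rw [hs, Finset.mem_filter]; exact ⟨by simpa using hne, by omega⟩)
    intro f _
    refine main ((hfin f).toFinset.sup ρ + 1) f fun i hi => ?_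
    exact Nat.lt_succ_of_le (Finset.le_sup (f := ρ) (by simpa using hi))

/-! ## Demazure–Lusztig operators on monomials -/

section Monomials

theorem X_mul_geom_sum {σ : Type*} {a b : σ} (d : ℕ) :
    (X a - X b) * ∑ k ∈ Finset.range d, X a ^ k * X b ^ (d - k) =
      X b * (X a ^ d - X b ^ d : MvPolynomial σ K) := by
  have h := (Commute.all (X a : MvPolynomial σ K) (X b)).mul_geom_sum₂ d
  rw [← h, mul_left_comm]
  congr 1
  rw [Finset.mul_sum]
  refine Finset.sum_congr rfl fun k hk => ?_
  have := Finset.mem_range.1 hk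
  rw [show d - k = d - 1 - k + 1 by omega, pow_succ]
  ring

theorem monomial_mul_pow_mul_pow {σ : Type*} {a b : σ} (n : σ →₀ ℕ) (k l : ℕ) :
    (monomial n 1 : MvPolynomial σ K) * (X a ^ k * X b ^ l) =
      monomial (n + Finsupp.single a k + Finsupp.single b l) 1 := by
  rw [X_pow_eq_monomial, X_pow_eq_monomial, monomial_mul, monomial_mul, add_assoc]
  simp

variable {σ : Type*} [DecidableEq σ] {a b : σ}

theorem polySwap_monomial_of_eq {n : σ →₀ ℕ} (h : n a = n b) :
    polySwap a b (monomial n 1) = monomial n 1 := by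
  rw [polySwap, rename_monomial]
  refine congrArg (fun m => monomial m (1 : K)) (Finsupp.ext fun x => ?_)
  rw [Finsupp.mapDomain_equiv_apply, Equiv.symm_swap]
  rcases eq_or_ne x a with rfl | h1
  · rw [Equiv.swap_apply_left, h]
  · rcases eq_or_ne x b with rfl | h2
    · rw [Equiv.swap_apply_right, h]
    · rw [Equiv.swap_apply_of_ne_of_ne h1 h2]

theorem dl_X_left_pow (hab : a ≠ b) (d : ℕ) : dl hab (X a ^ d) =
    C t * X b ^ d + (1 - C t) * ∑ k ∈ Finset.range d, X a ^ k * X b ^ (d - k) := by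
  refine dl_unique hab ?_
  rw [map_pow, polySwap_X_left]
  linear_combination (1 - C t) * X_mul_geom_sum (a := a) (b := b) d

theorem dl_X_right_pow (hab : a ≠ b) (d : ℕ) : dl hab (X b ^ d) =
    C t * X a ^ d + (C t - 1) * ∑ k ∈ Finset.range d, X a ^ k * X b ^ (d - k) := by
  refine dl_unique hab ?_
  rw [map_pow, polySwap_X_right]
  linear_combination (C t - 1) * X_mul_geom_sum (a := a) (b := b) d

/-- The monomial is a part symmetric in the two variables times a power of `X a`; the symmetric part
passes through. The summand `Finsupp.single a 0` is kept so that all exponents have the same shape.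
-/
theorem dl_monomial_of_le (hab : a ≠ b) {n : σ →₀ ℕ} (h : n b ≤ n a) :
    dl hab (monomial n 1) =
      C t * monomial (n - Finsupp.single a (n a - n b) + Finsupp.single a 0 +
        Finsupp.single b (n a - n b)) 1 +
      (1 - C t) * ∑ k ∈ Finset.range (n a - n b), monomial (n - Finsupp.single a (n a - n b) +
        Finsupp.single a k + Finsupp.single b (n a - n b - k)) 1 := by
  set d := n a - n b
  set m := n - Finsupp.single a d with hm
  have hn : (monomial n 1 : MvPolynomial σ K) = monomial m 1 * X a ^ d := by
    rw [X_pow_eq_monomial, monomial_mul, mul_one, hm, tsub_add_cancel_of_le]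
    rw [Finsupp.single_le_iff]
    exact Nat.sub_le _ _
  have hsw : polySwap a b (monomial m 1) = monomial m 1 := by
    refine polySwap_monomial_of_eq ?_
    simp only [hm, Finsupp.tsub_apply, Finsupp.single_apply, if_true, if_neg hab]
    omega
  rw [hn, dl_mul_of_polySwap_eq hab hsw, dl_X_left_pow, mul_add, mul_left_comm,
    mul_left_comm (monomial m 1), Finset.mul_sum]
  simp only [← monomial_mul_pow_mul_pow, pow_zero, one_mul]

theorem dl_monomial_of_ge (hab : a ≠ b) {n : σ →₀ ℕ} (h : n a ≤ n b) :
    dl hab (monomial n 1) =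
      C t * monomial (n - Finsupp.single b (n b - n a) + Finsupp.single a (n b - n a) +
        Finsupp.single b 0) 1 +
      (C t - 1) * ∑ k ∈ Finset.range (n b - n a), monomial (n - Finsupp.single b (n b - n a) +
        Finsupp.single a k + Finsupp.single b (n b - n a - k)) 1 := by
  set d := n b - n a
  set m := n - Finsupp.single b d with hm
  have hn : (monomial n 1 : MvPolynomial σ K) = monomial m 1 * X b ^ d := by
    rw [X_pow_eq_monomial, monomial_mul, mul_one, hm, tsub_add_cancel_of_le]
    rw [Finsupp.single_le_iff]
    exact Nat.sub_le _ _
  have hsw : polySwap a b (monomial m 1) = monomial m 1 := by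
    refine polySwap_monomial_of_eq ?_
    simp only [hm, Finsupp.tsub_apply, Finsupp.single_apply, if_true, if_neg hab.symm]
    omega
  rw [hn, dl_mul_of_polySwap_eq hab hsw, dl_X_right_pow, mul_add, mul_left_comm,
    mul_left_comm (monomial m 1), Finset.mul_sum]
  simp only [← monomial_mul_pow_mul_pow, pow_zero, mul_one]

/-- The exponents on the segment spanned by `n` and its image under the exchange of `a` and `b`. -/
def segment (a b : σ) (n : σ →₀ ℕ) : Set (σ →₀ ℕ) :=
  {κ | (∀ c, c ≠ a → c ≠ b → κ c = n c) ∧ κ a + κ b = n a + n b ∧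
    κ a ≤ max (n a) (n b) ∧ κ b ≤ max (n a) (n b)}

theorem dl_monomial_mem (hab : a ≠ b) (n : σ →₀ ℕ) :
    dl hab (monomial n 1) ∈ restrictSupport K (segment a b n) := by
  have hC : ∀ (c : MvPolynomial σ K) (hc : ∃ e : K, c = C e) (p : MvPolynomial σ K),
      p ∈ restrictSupport K (segment a b n) → c * p ∈ restrictSupport K (segment a b n) := by
    rintro _ ⟨e, rfl⟩ p hp
    rw [← smul_eq_C_mul]
    exact Submodule.smul_mem _ _ hp
  have hmem : ∀ c l k r, c ∈ ({a, b} : Set σ) → r ≤ n c →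
      r = (if c = a then n a - n b else n b - n a) → (if c = a then n b ≤ n a else n a ≤ n b) →
      l + k = r →
      (monomial (n - Finsupp.single c r + Finsupp.single a l + Finsupp.single b k) 1 :
        MvPolynomial σ K) ∈ restrictSupport K (segment a b n) := by
    intro c l k r hc _ hr hle hlk
    refine (monomial_mem_restrictSupport K).2 (Or.inl ⟨fun e h1 h2 => ?_, ?_, ?_, ?_⟩)
    · rcases hc with rfl | rfl <;>
      simp [h1.symm, h2.symm]
    all_goals
      rcases hc with rfl | rfl
      · simp only [if_true] at hr hle
        simp [hab, hab.symm]
        omega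
      · simp only [if_neg hab.symm] at hr hle
        simp [hab, hab.symm]
        omega
  rcases le_total (n b) (n a) with h | h
  · rw [dl_monomial_of_le hab h]
    refine Submodule.add_mem _ (hC _ ⟨t, rfl⟩ _ ?_) (hC _ ⟨1 - t, by simp⟩ _
      (Submodule.sum_mem _ fun k hk => ?_))
    · exact hmem a _ _ _ (by simp) (by omega) (by simp) (by simpa using h) (by omega)
    · have := Finset.mem_range.1 hk
      exact hmem a _ _ _ (by simp) (by omega) (by simp) (by simpa using h) (by omega)
  · rw [dl_monomial_of_ge hab h]
    refine Submodule.add_mem _ (hC _ ⟨t, rfl⟩ _ ?_) (hC _ ⟨t - 1, by simp⟩ _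
      (Submodule.sum_mem _ fun k hk => ?_))
    · exact hmem b _ _ _ (by simp) (by omega) (by simp [hab.symm])
        (by simpa [hab.symm] using h) (by omega)
    · have := Finset.mem_range.1 hk
      exact hmem b _ _ _ (by simp) (by omega) (by simp [hab.symm])
        (by simpa [hab.symm] using h) (by omega)

/-- Only the first term of the formula reaches the exchanged exponent: all terms of the geometric
sum have a smaller power of `X a`. This produces the leading coefficient of the intertwiner. -/
theorem coeff_dl_monomial_of_lt (hab : a ≠ b) {n κ : σ →₀ ℕ} (h : n a < n b)
    (hc : ∀ c, c ≠ a → c ≠ b → κ c = n c) (ha : κ a = n b) (hb : κ b = n a) :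
    coeff κ (dl hab (monomial n 1)) = t := by
  rw [dl_monomial_of_ge hab h.le, coeff_add, coeff_C_mul, coeff_monomial, if_pos, mul_one,
    ← C_1, ← C_sub, coeff_C_mul, coeff_sum, Finset.sum_eq_zero, mul_zero, add_zero]
  · intro k hk
    have hk := Finset.mem_range.1 hk
    rw [coeff_monomial, if_neg]
    intro e
    have := DFunLike.congr_fun e a
    simp [hab.symm, ha] at this
    omega
  · ext c
    by_cases h1 : c = a
    · subst h1
      simp [hab.symm, ha]
      omega
    · by_cases h2 : c = b
      · subst h2
        simp [hab, hb]
        omega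
      · simp [Ne.symm h1, Ne.symm h2, hc c h1 h2]

theorem coeff_dl (hab : a ≠ b) (f : MvPolynomial σ K) (κ : σ →₀ ℕ) :
    coeff κ (dl hab f) = ∑ n ∈ f.support, coeff n f * coeff κ (dl hab (monomial n 1)) := by
  conv_lhs => rw [f.as_sum, map_sum, coeff_sum]
  refine Finset.sum_congr rfl fun n _ => ?_
  rw [show (monomial n (coeff n f) : MvPolynomial σ K) = coeff n f • monomial n 1 by
    rw [smul_monomial, smul_eq_mul, mul_one], map_smul, coeff_smul, smul_eq_mul]

theorem exists_mem_segment_of_coeff_dl_ne_zero (hab : a ≠ b) {f : MvPolynomial σ K} {κ : σ →₀ ℕ}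
    (h : coeff κ (dl hab f) ≠ 0) : ∃ n ∈ f.support, κ ∈ segment a b n := by
  rw [coeff_dl] at h
  obtain ⟨n, hn, h⟩ := Finset.exists_ne_zero_of_sum_ne_zero h
  refine ⟨n, hn, ?_⟩
  exact ((mem_restrictSupport_iff K).1 (dl_monomial_mem hab n))
    (mem_support_iff.2 (right_ne_zero_of_mul h))

end Monomials

/-! ## Regularity at `q = 0` -/

/-- The elements of `ℚ(q,t)` that are regular at `q = 0`. -/
noncomputable def regular : Subring K where
  carrier := {c | (RatFunc.denom c).eval₂ (RingHom.id Kt) 0 ≠ 0}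
  mul_mem' := by
    intro x y hx hy h
    have := Polynomial.eval₂_eq_zero_of_dvd_of_eval₂_eq_zero _ _ (RatFunc.denom_mul_dvd x y) h
    rw [Polynomial.eval₂_mul] at this
    exact mul_ne_zero hx hy this
  one_mem' := by simp
  add_mem' := by
    intro x y hx hy h
    have := Polynomial.eval₂_eq_zero_of_dvd_of_eval₂_eq_zero _ _ (RatFunc.denom_add_dvd x y) h
    rw [Polynomial.eval₂_mul] at this
    exact mul_ne_zero hx hy this
  zero_mem' := by simp
  neg_mem' := by
    intro x hx h
    have h1 : (-1 : K) * x = -x := by ring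
    have h2 : RatFunc.denom (-1 : K) = 1 := by
      rw [show (-1 : K) = RatFunc.C (-1) by rw [map_neg, map_one], RatFunc.denom_C]
    have h3 := RatFunc.denom_mul_dvd (-1 : K) x
    rw [h1, h2, one_mul] at h3
    exact hx (Polynomial.eval₂_eq_zero_of_dvd_of_eval₂_eq_zero _ _ h3 h)

/-- Specialisation at `q = 0` as a ring homomorphism. -/
noncomputable def atZeroHom : regular →+* Kt where
  toFun c := atZero c
  map_one' := RatFunc.eval_one _ _
  map_zero' := RatFunc.eval_zero _ _
  map_add' x y := RatFunc.eval_add _ _ x.2 y.2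
  map_mul' x y := RatFunc.eval_mul _ _ x.2 y.2

theorem atZeroHom_apply (c : regular) : atZeroHom c = atZero c := rfl

theorem C_mem_regular (c : Kt) : RatFunc.C c ∈ regular := by
  change (RatFunc.denom _).eval₂ (RingHom.id Kt) 0 ≠ 0
  simp

theorem atZero_C (c : Kt) : atZero (RatFunc.C c) = c := RatFunc.eval_C _ _

theorem q_mem_regular : q ∈ regular := by
  change (RatFunc.denom _).eval₂ (RingHom.id Kt) 0 ≠ 0
  rw [q]
  simp

theorem atZero_q : atZero q = 0 := RatFunc.eval_X _ _

theorem inv_mem_regular {c : K} (hc : c ∈ regular) (h : atZero c ≠ 0) : c⁻¹ ∈ regular := by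
  have hc0 : c ≠ 0 := by
    rintro rfl
    exact h (RatFunc.eval_zero _ _)
  intro h0
  have := Polynomial.eval₂_eq_zero_of_dvd_of_eval₂_eq_zero _ _ (RatFunc.denom_inv_dvd hc0) h0
  apply h
  rw [atZero, RatFunc.eval, this, zero_div]

theorem atZero_inv {c : K} (hc : c ∈ regular) (h : atZero c ≠ 0) : atZero c⁻¹ = (atZero c)⁻¹ := by
  have hc0 : c ≠ 0 := by
    rintro rfl
    exact h (RatFunc.eval_zero _ _)
  have h1 := map_mul atZeroHom ⟨c, hc⟩ ⟨c⁻¹, inv_mem_regular hc h⟩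
  have h2 : (⟨c, hc⟩ * ⟨c⁻¹, inv_mem_regular hc h⟩ : regular) = 1 :=
    Subtype.ext (mul_inv_cancel₀ hc0)
  rw [h2, map_one] at h1
  exact eq_inv_of_mul_eq_one_right h1.symm

theorem t_zpow_eq (z : ℤ) : t ^ z = RatFunc.C ((RatFunc.X : Kt) ^ z) := by
  rw [t, map_zpow₀]

theorem t_zpow_mem_regular (z : ℤ) : t ^ z ∈ regular := by
  rw [t_zpow_eq]
  exact C_mem_regular _

theorem t_mem_regular : t ∈ regular := C_mem_regular _

theorem t_inv_mem_regular : t⁻¹ ∈ regular := by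
  rw [← zpow_neg_one]
  exact t_zpow_mem_regular _

/-- The polynomials whose coefficients are regular at `q = 0`. -/
noncomputable def regularPoly (σ : Type*) : Subring (MvPolynomial σ K) :=
  (MvPolynomial.map regular.subtype).range

theorem smul_mem_regularPoly {σ : Type*} {c : K} (hc : c ∈ regular) {f : MvPolynomial σ K}
    (hf : f ∈ regularPoly σ) : c • f ∈ regularPoly σ := by
  rw [smul_eq_C_mul]
  exact Subring.mul_mem _ ⟨C ⟨c, hc⟩, by rw [map_C]; rfl⟩ hf

theorem X_mem_regularPoly {σ : Type*} (i : σ) : (X i : MvPolynomial σ K) ∈ regularPoly σ :=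
  ⟨X i, map_X _ _⟩

/-- The divided difference already exists over the ring of regular scalars, so the operator
introduces no denominators in `q`. -/
theorem dl_mem_regularPoly {σ : Type*} [DecidableEq σ] {a b : σ} (hab : a ≠ b)
    {f : MvPolynomial σ K} (hf : f ∈ regularPoly σ) : dl hab f ∈ regularPoly σ := by
  obtain ⟨g, rfl⟩ := hf
  obtain ⟨h, hh⟩ := X_sub_X_dvd_rename_swap_sub a b g
  have h2 := congrArg (MvPolynomial.map regular.subtype) hh
  rw [map_sub, map_mul, map_sub, map_X, map_X, map_rename] at h2
  refine ⟨C ⟨t, t_mem_regular⟩ * g + (C ⟨t, t_mem_regular⟩ * X a - X b) * h, ?_⟩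
  symm
  refine dl_unique hab ?_
  have hC : MvPolynomial.map (σ := σ) regular.subtype (C ⟨t, t_mem_regular⟩) = C t := by
    rw [map_C]; rfl
  simp only [map_add, map_mul, map_sub, map_X, hC]
  linear_combination -(C t * X a - X b) * h2

theorem opT_mem_regularPoly {N : ℕ} (i : ℕ) {f : Pol N} (hf : f ∈ regularPoly (Fin N)) :
    opT N i f ∈ regularPoly (Fin N) := by
  rw [opT]
  split_ifs
  · exact dl_mem_regularPoly _ hf
  · exact hf

theorem opTinv_mem_regularPoly {N : ℕ} (i : ℕ) {f : Pol N} (hf : f ∈ regularPoly (Fin N)) :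
    opTinv N i f ∈ regularPoly (Fin N) := by
  rw [opTinv, LinearMap.add_apply]
  refine Subring.add_mem _ ?_ ?_
  · exact smul_mem_regularPoly (Subring.sub_mem _ t_inv_mem_regular (Subring.one_mem _)) hf
  · exact smul_mem_regularPoly t_inv_mem_regular (opT_mem_regularPoly i hf)

/-! ## Nonsymmetric Macdonald polynomials -/

section Macdonald

variable {N : ℕ}

/-- The exponent of the monomial `x ^ η`. -/
noncomputable abbrev expo (η : Fin N → ℕ) : Fin N →₀ ℕ := Finsupp.equivFunOnFinite.symm η

theorem coe_expo (η : Fin N → ℕ) : ⇑(expo η) = η := rfl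

theorem expo_coe (n : Fin N →₀ ℕ) : expo ⇑n = n := Finsupp.equivFunOnFinite.symm_apply_apply n

theorem expo_injective : Function.Injective (expo (N := N)) :=
  Finsupp.equivFunOnFinite.symm.injective

/-- The eigenvalue of the Cherednik operator `Y_i` on `E_η`. -/
noncomputable def eigval (η : Fin N → ℕ) (i : Fin N) : K := q ^ η i * t ^ (-(circleRow η i : ℤ))

/-- Compare degrees in `q`, then in `t`, after clearing the negative powers of `t`. -/
theorem q_pow_mul_t_zpow_inj {a b r s : ℕ}
    (h : q ^ a * t ^ (-(r : ℤ)) = q ^ b * t ^ (-(s : ℤ))) : a = b ∧ r = s := by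
  have hX : ∀ (F : Type) [Field F] (k : ℕ), ((RatFunc.X : RatFunc F) ^ k).intDegree = k := by
    intro F _ k
    induction k with
    | zero => simp
    | succ k ih =>
      rw [pow_succ, RatFunc.intDegree_mul (pow_ne_zero _ RatFunc.X_ne_zero) RatFunc.X_ne_zero, ih,
        RatFunc.intDegree_X]
      push_cast
      rfl
  have ht : ∀ k : ℕ, t ^ k = RatFunc.C ((RatFunc.X : Kt) ^ k) := fun k => by rw [t, map_pow]
  have h1 : q ^ a * t ^ s = q ^ b * t ^ r := by
    rw [zpow_neg, zpow_neg, zpow_natCast, zpow_natCast] at h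
    have h2 := pow_ne_zero r t_ne_zero
    have h3 := pow_ne_zero s t_ne_zero
    field_simp at h
    linear_combination h
  have hab : a = b := by
    have h2 := congrArg RatFunc.intDegree h1
    rw [RatFunc.intDegree_mul (pow_ne_zero _ q_ne_zero) (pow_ne_zero _ t_ne_zero),
      RatFunc.intDegree_mul (pow_ne_zero _ q_ne_zero) (pow_ne_zero _ t_ne_zero), ht, ht,
      RatFunc.intDegree_C, RatFunc.intDegree_C, q, hX, hX] at h2
    omega
  subst hab
  refine ⟨rfl, ?_⟩
  have h2 := mul_left_cancel₀ (pow_ne_zero _ q_ne_zero) h1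
  rw [ht, ht] at h2
  have h3 := congrArg RatFunc.intDegree
      ((RatFunc.C : Kt →+* RatFunc Kt).injective h2)
  rw [hX, hX] at h3
  omega

/-- The powers of `q` in the joint spectrum already recover the composition. -/
theorem eigval_injective : Function.Injective (eigval (N := N)) := by
  intro η ν h
  funext i
  exact (q_pow_mul_t_zpow_inj (congrFun h i)).1

/-- The properties that single out `E_η`, together with triangularity and regularity at `q = 0`. -/
structure IsE (η : Fin N → ℕ) (f : Pol N) : Prop where
  eigen : ∀ i, opY i f = eigval η i • f
  lead : coeff (expo η) f = 1
  tri : ∀ n ∈ f.support, ReflTransGen Step ⇑n η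
  reg : f ∈ regularPoly (Fin N)

theorem opY_succ_mul_opT {i : ℕ} (h : i + 1 < N) :
    opY ⟨i + 1, h⟩ * opT N i = ((1 - t) • 1 + opT N i) * opY ⟨i, by omega⟩ := by
  rw [← t_smul_opTinv, smul_mul_assoc, ← mul_smul_comm, ← opT_mul_opY_mul_opT h, ← mul_assoc,
    ← mul_assoc, opTinv_mul_opT h, one_mul]

theorem opY_mul_opT {i : ℕ} (h : i + 1 < N) :
    opY ⟨i, by omega⟩ * opT N i =
      (t - 1) • opY ⟨i, by omega⟩ + opT N i * opY ⟨i + 1, h⟩ := by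
  have h1 : opY ⟨i, by omega⟩ = t⁻¹ • (opT N i * opY ⟨i + 1, h⟩ * opT N i) := by
    rw [opT_mul_opY_mul_opT h, smul_smul, inv_mul_cancel₀ t_ne_zero, one_smul]
  rw [h1, smul_mul_assoc, mul_assoc _ (opT N i) (opT N i), opT_mul_self h, mul_add,
    mul_smul_comm, mul_smul_comm, mul_one, smul_add, smul_smul t⁻¹ t, inv_mul_cancel₀ t_ne_zero,
    one_smul, smul_comm]

/-- The intertwiner property: `T_i - c` exchanges the eigenvalues of `Y_i` and `Y_{i+1}`. -/
theorem opY_intertwine {i : ℕ} (h : i + 1 < N) {μ : Fin N → K} {f : Pol N}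
    (hf : ∀ j, opY j f = μ j • f) {c : K}
    (hc : c * (μ ⟨i, by omega⟩ - μ ⟨i + 1, h⟩) = (t - 1) * μ ⟨i, by omega⟩) (j : Fin N) :
    opY j (opT N i f - c • f) =
      μ (Equiv.swap (⟨i, by omega⟩ : Fin N) ⟨i + 1, h⟩ j) • (opT N i f - c • f) := by
  rw [map_sub, map_smul, hf, ← Module.End.mul_apply]
  have hC : (C c : Pol N) * (C (μ ⟨i, by omega⟩) - C (μ ⟨i + 1, h⟩)) =
      (C t - 1) * C (μ ⟨i, by omega⟩) := by
    rw [← C_1, ← C_sub, ← C_sub, ← C_mul, ← C_mul, hc]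
  by_cases h1 : (j : ℕ) = i
  · obtain rfl : j = ⟨i, Nat.lt_of_succ_lt h⟩ := Fin.ext h1
    rw [Equiv.swap_apply_left, opY_mul_opT h, LinearMap.add_apply, LinearMap.smul_apply,
      Module.End.mul_apply, hf, hf, map_smul]
    simp only [smul_eq_C_mul, C_sub, C_1]
    linear_combination -hC * f
  · by_cases h2 : (j : ℕ) = i + 1
    · obtain rfl : j = ⟨i + 1, h⟩ := Fin.ext h2
      rw [Equiv.swap_apply_right, opY_succ_mul_opT h, Module.End.mul_apply, hf, map_smul,
        LinearMap.add_apply, LinearMap.smul_apply, Module.End.one_apply]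
      simp only [smul_eq_C_mul, C_sub, C_1]
      linear_combination hC * f
    · rw [Equiv.swap_apply_of_ne_of_ne (fun e => h1 (congrArg Fin.val e))
        (fun e => h2 (congrArg Fin.val e)), ← (commute_opT_opY h (by omega)).eq,
        Module.End.mul_apply, hf, map_smul, smul_sub, smul_smul, smul_smul, mul_comm]

/-- An interior point of the segment has a strictly smaller maximum than the endpoints, so it lies
below them in the Bruhat order. -/
theorem expo_mem_segment_cases {i : ℕ} (hi : i + 1 < N) {n κ : Fin N →₀ ℕ}
    (h : κ ∈ segment (⟨i, by omega⟩ : Fin N) ⟨i + 1, hi⟩ n) :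
    κ = n ∨ ⇑κ = swapEntries ⇑n i hi ∨ Step ⇑κ ⇑n := by
  obtain ⟨hc, hs, ha, hb⟩ := h
  by_cases h1 : κ ⟨i, by omega⟩ = n ⟨i, by omega⟩
  · left
    ext c
    by_cases e1 : c = ⟨i, by omega⟩
    · rw [e1, h1]
    · by_cases e2 : c = ⟨i + 1, hi⟩
      · rw [e2]; omega
      · exact hc c e1 e2
  · by_cases h2 : κ ⟨i, by omega⟩ = n ⟨i + 1, hi⟩
    · right; left
      funext c
      by_cases e1 : c = ⟨i, by omega⟩
      · rw [e1, h2, swapEntries_left]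
      · by_cases e2 : c = ⟨i + 1, hi⟩
        · rw [e2, swapEntries_right]; omega
        · rw [hc c e1 e2, swapEntries_of_ne _ hi (fun e => e1 (Fin.ext e))
            (fun e => e2 (Fin.ext e))]
    · right; right
      refine ⟨⟨i, by omega⟩, ⟨i + 1, hi⟩, by simp, hc, hs, Or.inl ?_⟩
      omega

theorem eigval_swapEntries (η : Fin N → ℕ) {i : ℕ} (hi : i + 1 < N)
    (h : η ⟨i, by omega⟩ ≠ η ⟨i + 1, hi⟩) (j : Fin N) :
    eigval (swapEntries η i hi) j =
      eigval η (Equiv.swap (⟨i, by omega⟩ : Fin N) ⟨i + 1, hi⟩ j) := by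
  rw [eigval, eigval, circleRow_swapEntries η hi h]
  rfl

/-- The scalar in the intertwiner for an ascent of `η`. -/
theorem exists_intertwiner_scalar (η : Fin N → ℕ) {i : ℕ} (hi : i + 1 < N)
    (h : η ⟨i, by omega⟩ < η ⟨i + 1, hi⟩) :
    ∃ c ∈ regular, atZero c = RatFunc.X - 1 ∧
      c * (eigval η ⟨i, by omega⟩ - eigval η ⟨i + 1, hi⟩) = (t - 1) * eigval η ⟨i, by omega⟩ := by
  set u := eigval η ⟨i, by omega⟩ with hu
  set v := eigval η ⟨i + 1, hi⟩ with hv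
  obtain ⟨d, hd⟩ := Nat.exists_eq_add_of_lt h
  set z : ℤ := -(circleRow η ⟨i + 1, hi⟩ : ℤ) + (circleRow η ⟨i, by omega⟩ : ℤ) with hz
  -- The ratio of the two eigenvalues. The ascent makes its power of `q` positive, so `1 - δ` takes
  -- the value `1` at `q = 0`, and the scalar `(t - 1) / (1 - δ)` is regular there with value `t -
  -- 1`.
  set δ : K := q * (q ^ d * t ^ z) with hδ
  have hδm : q ^ d * t ^ z ∈ regular :=
    Subring.mul_mem _ (Subring.pow_mem _ q_mem_regular _) (t_zpow_mem_regular _)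
  have hδr : δ ∈ regular := Subring.mul_mem _ q_mem_regular hδm
  have hδ0 : atZero δ = 0 := by
    have := map_mul atZeroHom ⟨q, q_mem_regular⟩ ⟨_, hδm⟩
    rw [atZeroHom_apply, atZeroHom_apply, atZeroHom_apply, atZero_q, zero_mul] at this
    exact this
  have h1r : 1 - δ ∈ regular := Subring.sub_mem _ (Subring.one_mem _) hδr
  have h10 : atZero (1 - δ) = 1 := by
    have := map_sub atZeroHom 1 ⟨δ, hδr⟩
    rw [map_one, atZeroHom_apply, atZeroHom_apply, hδ0, sub_zero] at this
    exact this
  have h1ne : 1 - δ ≠ 0 := by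
    intro e
    rw [e] at h10
    exact zero_ne_one ((RatFunc.eval_zero _ _).symm.trans h10)
  have hi1 : (1 - δ)⁻¹ ∈ regular := inv_mem_regular h1r (by rw [h10]; exact one_ne_zero)
  have ht1 : t - 1 ∈ regular := Subring.sub_mem _ t_mem_regular (Subring.one_mem _)
  have hvu : v = δ * u := by
    rw [hv, hu, hδ, eigval, eigval, hd, hz, zpow_add₀ t_ne_zero, zpow_neg, zpow_neg, zpow_natCast,
      zpow_natCast]
    have := pow_ne_zero (circleRow η ⟨i, by omega⟩) t_ne_zero
    field_simp
    ring
  refine ⟨(t - 1) * (1 - δ)⁻¹, Subring.mul_mem _ ht1 hi1, ?_, ?_⟩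
  · have e1 := map_mul atZeroHom ⟨_, ht1⟩ ⟨_, hi1⟩
    have e2 := map_sub atZeroHom ⟨t, t_mem_regular⟩ 1
    rw [map_one, atZeroHom_apply, atZeroHom_apply] at e2
    rw [atZeroHom_apply, atZeroHom_apply, atZeroHom_apply] at e1
    refine e1.trans ?_
    rw [atZero_inv h1r (by rw [h10]; exact one_ne_zero), h10, inv_one, mul_one]
    refine e2.trans ?_
    rw [show ((⟨t, t_mem_regular⟩ : regular) : K) = RatFunc.C (RatFunc.X : Kt) from rfl, atZero_C]
  · rw [hvu]
    field_simp

/-- The intertwiner exchanges two eigenvalues, which gives the spectrum of the exchanged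
composition. Its exponent is absent from `f` by rank and is reached by `T_i` only from `x ^ η`, with
coefficient `t`; this explains the factor `t⁻¹`. -/
theorem IsE.swap {η : Fin N → ℕ} {f : Pol N} (hf : IsE η f) {i : ℕ} (hi : i + 1 < N)
    (h : η ⟨i, by omega⟩ < η ⟨i + 1, hi⟩) {c : K} (hcr : c ∈ regular)
    (hc : c * (eigval η ⟨i, by omega⟩ - eigval η ⟨i + 1, hi⟩) =
      (t - 1) * eigval η ⟨i, by omega⟩) :
    IsE (swapEntries η i hi) (t⁻¹ • (opT N i f - c • f)) := by
  have hst := step_swapEntries hi h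
  have hle : ∀ n ∈ f.support, ReflTransGen Step ⇑n (swapEntries η i hi) := fun n hn =>
    (hf.tri n hn).tail hst
  have hnot : coeff (expo (swapEntries η i hi)) f = 0 := by
    by_contra hne
    have := compRank_le (hf.tri _ (mem_support_iff.2 hne))
    rw [coe_expo] at this
    exact absurd hst.compRank_lt (not_lt.2 this)
  refine ⟨fun j => ?_, ?_, fun n hn => ?_, ?_⟩
  · rw [map_smul, opY_intertwine hi hf.eigen hc, eigval_swapEntries η hi h.ne, smul_comm]
  · rw [coeff_smul, coeff_sub, coeff_smul, hnot, smul_zero, sub_zero, opT_of_lt hi, coeff_dl,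
      Finset.sum_eq_single (expo η), hf.lead, one_mul, coeff_dl_monomial_of_lt _ h, smul_eq_mul,
      inv_mul_cancel₀ t_ne_zero]
    · intro c h1 h2
      exact swapEntries_of_ne η hi (fun e => h1 (Fin.ext e)) (fun e => h2 (Fin.ext e))
    · exact swapEntries_left η hi
    · exact swapEntries_right η hi
    · intro n hn hne
      -- If `n` contributes, the target exponent is `n` itself, the exchange of `n`, or a point
      -- below `n`. The first and last contradict the ranks, and the second gives `n = η`.
      by_contra hcon
      have hseg := (mem_restrictSupport_iff K).1 (dl_monomial_mem (fin_ne_succ hi) n)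
        (mem_support_iff.2 (right_ne_zero_of_mul hcon))
      have hr := compRank_le (hf.tri n hn)
      have hr2 := hst.compRank_lt
      rcases expo_mem_segment_cases hi hseg with e | e | e
      · rw [← e] at hr
        exact absurd hr (not_le.2 hr2)
      · rw [coe_expo] at e
        have := congrArg (fun ν => MSym.swapEntries ν i hi) e
        simp only [swapEntries_swapEntries] at this
        exact hne (by rw [this, expo_coe])
      · have := e.compRank_lt
        rw [coe_expo] at this
        omega
    · intro hn
      rw [notMem_support_iff.1 hn, zero_mul]
  · have hn' : coeff n (opT N i f - c • f) ≠ 0 := by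
      rw [mem_support_iff, coeff_smul] at hn
      exact right_ne_zero_of_mul hn
    by_cases hnf : n ∈ f.support
    · exact hle n hnf
    · rw [coeff_sub, coeff_smul, notMem_support_iff.1 hnf, smul_zero, sub_zero, opT_of_lt hi] at hn'
      obtain ⟨m, hm, hseg⟩ := exists_mem_segment_of_coeff_dl_ne_zero _ hn'
      rcases expo_mem_segment_cases hi hseg with e | e | e
      · rw [e]; exact hle m hm
      · rw [e]
        -- The lifting property keeps the exchanged exponent below the exchanged composition.
        rcases reflTransGen_swapEntries (hf.tri m hm) hi with h1 | h1
        · exact h1.tail hst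
        · exact h1
      · exact (hle m hm).head e
  · refine smul_mem_regularPoly t_inv_mem_regular (Subring.sub_mem _ ?_ ?_)
    · exact opT_mem_regularPoly _ hf.reg
    · exact smul_mem_regularPoly hcr hf.reg

theorem opPhi_monomial {n : ℕ} (ν : Fin (n + 1) → ℕ) :
    opPhi (Nat.succ_pos n) (monomial (expo ν) 1) =
      q ^ ν 0 • (monomial (expo (phi ν)) 1 : Pol (n + 1)) := by
  rw [opPhi, Module.End.mul_apply, opX_apply, opOmega_apply, polyOmega, aeval_monomial, map_one,
    one_mul, Finsupp.prod_fintype _ _ (fun i => pow_zero _), monomial_eq,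
    Finsupp.prod_fintype _ _ (fun i => pow_zero _), Fin.prod_univ_succ, Fin.prod_univ_castSucc]
  simp only [coe_expo, phi_castSucc, phi_last, C_1, one_mul]
  have h0 : (⟨n + 1 - 1, by omega⟩ : Fin (n + 1)) = Fin.last n := rfl
  have h1 : ∀ j : Fin n, (⟨(j.succ : ℕ) - 1, by simp⟩ : Fin (n + 1)) = j.castSucc := by
    intro j
    ext
    simp
  simp only [h0, Fin.val_zero, if_true, Fin.val_succ, Nat.add_eq_zero_iff, one_ne_zero, and_false,
    if_false, smul_pow, smul_mul_assoc, mul_smul_comm]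
  congr 1
  have h2 : ∀ j : Fin n, (⟨(j : ℕ) + 1 - 1, by omega⟩ : Fin (n + 1)) = j.castSucc := by
    intro j
    ext
    simp
  simp only [h2]
  ring

theorem coeff_opPhi {n : ℕ} (f : Pol (n + 1)) (m : Fin (n + 1) →₀ ℕ) :
    coeff m (opPhi (Nat.succ_pos n) f) =
      ∑ ν ∈ f.support, coeff ν f * (q ^ ν 0 * if expo (phi ⇑ν) = m then 1 else 0) := by
  conv_lhs => rw [f.as_sum, map_sum, coeff_sum]
  refine Finset.sum_congr rfl fun ν _ => ?_
  rw [show (monomial ν (coeff ν f) : Pol (n + 1)) = coeff ν f • monomial (expo ⇑ν) 1 by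
    rw [smul_monomial, smul_eq_mul, mul_one, expo_coe], map_smul, coeff_smul, smul_eq_mul,
    opPhi_monomial, coeff_smul, coeff_monomial, smul_eq_mul]

theorem eigval_phi_castSucc {n : ℕ} (η : Fin (n + 1) → ℕ) (i : Fin n) :
    eigval (phi η) i.castSucc = eigval η i.succ := by
  rw [eigval, eigval, circleRow_phi_castSucc, phi_castSucc]

theorem eigval_phi_last {n : ℕ} (η : Fin (n + 1) → ℕ) :
    eigval (phi η) (Fin.last n) = q * eigval η 0 := by
  rw [eigval, eigval, circleRow_phi_last, phi_last, pow_succ]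
  ring

/-- `T_{n-1}⁻¹ ⋯ T_0⁻¹`. -/
noncomputable def prodTinvRev (N : ℕ) : ℕ → Module.End K (Pol N)
  | 0 => 1
  | n + 1 => opTinv N n * prodTinvRev N n

theorem prodTinvRev_mul_prodT {n : ℕ} (h : n < N) : prodTinvRev N n * prodT N 0 n = 1 := by
  induction n with
  | zero => rw [prodTinvRev, prodT_zero, one_mul]
  | succ n ih =>
    rw [prodTinvRev, prodT_succ', zero_add, mul_assoc, ← mul_assoc (prodTinvRev N n),
      ih (by omega), one_mul, opTinv_mul_opT h]

/-- The commutation of `Φ` with the Cherednik operators shifts the spectrum as `phi` does. The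
delicate point is regularity, since one divides by `q ^ η 0`. -/
theorem IsE.phi {n : ℕ} {η : Fin (n + 1) → ℕ} {f : Pol (n + 1)} (hf : IsE η f) :
    IsE (phi η) ((q ^ η 0)⁻¹ • opPhi (Nat.succ_pos n) f) := by
  have hq := pow_ne_zero (η 0) q_ne_zero
  refine ⟨fun i => ?_, ?_, fun m hm => ?_, ?_⟩
  · rw [map_smul, smul_comm (eigval _ _)]
    congr 1
    rw [← Module.End.mul_apply]
    refine Fin.lastCases ?_ (fun i => ?_) i
    · rw [eigval_phi_last, show Fin.last n = ⟨n + 1 - 1, by omega⟩ from rfl, opY_last_mul_opPhi,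
        LinearMap.smul_apply, Module.End.mul_apply, mul_smul]
      congr 1
      rw [show (⟨0, Nat.succ_pos n⟩ : Fin (n + 1)) = 0 from rfl, hf.eigen, map_smul]
    · have h := opY_mul_opPhi (N := n + 1) (i := i) (Nat.succ_lt_succ i.isLt)
      have e1 : (⟨(i : ℕ), by omega⟩ : Fin (n + 1)) = i.castSucc := rfl
      have e2 : (⟨(i : ℕ) + 1, Nat.succ_lt_succ i.isLt⟩ : Fin (n + 1)) = i.succ := rfl
      rw [e1, e2] at h
      rw [eigval_phi_castSucc, h, Module.End.mul_apply, hf.eigen, map_smul]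
  · rw [coeff_smul, coeff_opPhi, Finset.sum_eq_single (expo η), hf.lead, coe_expo, if_pos rfl,
      one_mul, mul_one, smul_eq_mul, inv_mul_cancel₀ hq]
    · intro ν _ hν
      rw [if_neg, mul_zero, mul_zero]
      intro e
      exact hν (by rw [← phi_injective (expo_injective e), expo_coe])
    · intro hn
      rw [notMem_support_iff.1 hn, zero_mul]
  · rw [mem_support_iff, coeff_smul, coeff_opPhi] at hm
    obtain ⟨ν, hν, h⟩ := Finset.exists_ne_zero_of_sum_ne_zero (right_ne_zero_of_mul hm)
    have e : expo (MSym.phi ⇑ν) = m := by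
      by_contra hne
      rw [if_neg hne, mul_zero, mul_zero] at h
      exact h rfl
    rw [← e, coe_expo]
    exact reflTransGen_phi (hf.tri ν hν)
  -- The operator `Y_1` contains no inverses, so its eigenvalue equation expresses `ω f` as its
  -- eigenvalue times inverse Hecke operators applied to `f`. The power of `q` in the eigenvalue is
  -- exactly the one divided out.
  · have hY : opY (⟨0, Nat.succ_pos n⟩ : Fin (n + 1)) =
        t ^ (-(n : ℤ)) • (prodT (n + 1) 0 n * opOmega (n + 1)) := by
      rw [opY]
      simp only [Nat.add_sub_cancel, Nat.sub_zero, prodTinv_zero, mul_one]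
      congr 2
      push_cast
      ring
    have hω : opOmega (n + 1) f =
        (t ^ (n : ℤ) * eigval η 0) • prodTinvRev (n + 1) n f := by
      have h1 := hf.eigen ⟨0, Nat.succ_pos n⟩
      rw [hY, LinearMap.smul_apply, Module.End.mul_apply] at h1
      have h2 := congrArg (fun g => t ^ (n : ℤ) • prodTinvRev (n + 1) n g) h1
      simp only [map_smul, smul_smul] at h2
      rw [← Module.End.mul_apply, prodTinvRev_mul_prodT (by omega), Module.End.one_apply,
        ← zpow_add₀ t_ne_zero, add_neg_cancel, zpow_zero, one_smul] at h2
      exact h2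
    have hr : ∀ k, prodTinvRev (n + 1) k f ∈ regularPoly (Fin (n + 1)) := by
      intro k
      induction k with
      | zero =>
        rw [prodTinvRev, Module.End.one_apply]
        exact hf.reg
      | succ k ih =>
        rw [prodTinvRev, Module.End.mul_apply]
        exact opTinv_mem_regularPoly _ ih
    rw [opPhi, Module.End.mul_apply, opX_apply, hω, mul_smul_comm, smul_smul]
    have hs : (q ^ η 0)⁻¹ * (t ^ (n : ℤ) * eigval η 0) =
        t ^ ((n : ℤ) + -(circleRow η 0 : ℤ)) := by
      rw [eigval, zpow_add₀ t_ne_zero]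
      field_simp
    rw [hs]
    exact smul_mem_regularPoly (t_zpow_mem_regular _)
      (Subring.mul_mem _ (X_mem_regularPoly _) (hr n))

theorem circleRow_zero (i : Fin N) : circleRow (0 : Fin N → ℕ) i = i := by
  rw [circleRow]
  simp only [Pi.zero_apply, lt_irrefl, false_or, true_and]
  exact (congrArg Finset.card (by ext; simp)).trans (Fin.card_Iio i)

theorem isE_zero : IsE (0 : Fin N → ℕ) 1 := by
  have hsm : ∀ c : K, (C c : Pol N) = c • 1 := fun c => by rw [smul_eq_C_mul, mul_one]
  have h1 : ∀ k, k + 1 < N → opT N k (1 : Pol N) = t • 1 := fun k hk => by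
    rw [opT_of_lt hk, dl_one, hsm]
  have h2 : ∀ k, k + 1 < N → opTinv N k (1 : Pol N) = t⁻¹ • 1 := fun k hk => by
    rw [opTinv, LinearMap.add_apply, LinearMap.smul_apply, LinearMap.smul_apply, h1 k hk,
      Module.End.one_apply, smul_smul, inv_mul_cancel₀ t_ne_zero, ← add_smul]
    congr 1
    ring
  have h3 : ∀ n i, i + n < N → prodT N i n (1 : Pol N) = t ^ n • 1 := by
    intro n
    induction n with
    | zero => intro i _; rw [prodT_zero, pow_zero, one_smul]; rfl
    | succ n ih =>
      intro i hi
      rw [prodT_succ', Module.End.mul_apply, h1 _ (by omega), map_smul, ih i (by omega), smul_smul,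
        pow_succ']
  have h4 : ∀ n i, i + n < N → prodTinv N i n (1 : Pol N) = t⁻¹ ^ n • 1 := by
    intro n
    induction n with
    | zero => intro i _; rw [prodTinv_zero, pow_zero, one_smul]; rfl
    | succ n ih =>
      intro i hi
      rw [prodTinv_succ', Module.End.mul_apply, h2 _ (by omega), map_smul, ih i (by omega),
        smul_smul, pow_succ']
  refine ⟨fun i => ?_, ?_, fun n hn => ?_, Subring.one_mem _⟩
  · have hi := i.isLt
    rw [opY, LinearMap.smul_apply, Module.End.mul_apply, Module.End.mul_apply, h4 _ _ (by omega),
      map_smul, opOmega_apply, map_one, map_smul, h3 _ _ (by omega), smul_smul, smul_smul, eigval,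
      circleRow_zero, Pi.zero_apply, pow_zero, one_mul]
    -- The powers of `t` combine to `t^{(i+1-N) - i + (N-1-i)} = t^{-i}`, and the row of place `i`
    -- in the zero composition is `i`.
    congr 1
    rw [inv_pow, ← zpow_natCast, ← zpow_natCast, ← zpow_neg, ← zpow_add₀ t_ne_zero,
      ← zpow_add₀ t_ne_zero]
    congr 1
    omega
  · rw [coeff_one, if_pos]
    ext
    rfl
  · rw [mem_support_iff, coeff_one] at hn
    have : n = 0 := by
      by_contra hne
      exact hn (if_neg (Ne.symm hne))
    rw [this]
    exact .refl

theorem exists_isE (η : Fin N → ℕ) : ∃ f, IsE η f := by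
  cases N with
  | zero => exact ⟨1, by rw [Subsingleton.elim η 0]; exact isE_zero⟩
  | succ n =>
    refine composition_induction (P := fun η => ∃ f, IsE η f) ⟨1, isE_zero⟩ ?_ ?_ η
    · rintro η ⟨f, hf⟩
      exact ⟨_, hf.phi⟩
    · rintro η i hi h ⟨f, hf⟩
      obtain ⟨c, hcr, -, hc⟩ := exists_intertwiner_scalar η hi h
      exact ⟨_, hf.swap hi h hcr hc⟩

theorem coeff_expo_of_isE {η ν : Fin N → ℕ} {f : Pol N} (hf : IsE η f)
    (h : coeff (expo ν) f ≠ 0) : ν = η ∨ compRank ν < compRank η := by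
  have := hf.tri _ (mem_support_iff.2 h)
  rw [coe_expo] at this
  by_cases e : ν = η
  · exact Or.inl e
  · exact Or.inr (compRank_lt this e)

theorem linearIndependent_and_span_of_monic_triangular {F : Type*} [Field F]
    {E : (Fin N → ℕ) → MvPolynomial (Fin N) F} (h1 : ∀ η, coeff (expo η) (E η) = 1)
    (h2 : ∀ η ν, coeff (expo ν) (E η) ≠ 0 → ν = η ∨ compRank ν < compRank η) :
    LinearIndependent F E ∧ ⊤ ≤ Submodule.span F (Set.range E) := by
  refine linearIndependent_and_span_of_triangular (fun ν => lcoeff F (expo ν)) E compRank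
    ?_ ?_ (fun η => ?_) h2
  · intro f
    refine (f.support.finite_toSet.preimage (f := expo) expo_injective.injOn).subset ?_
    intro ν hν
    exact Finset.mem_coe.2 (mem_support_iff.2 hν)
  · intro f hf
    ext n
    have := hf ⇑n
    rw [lcoeff_apply, expo_coe] at this
    rw [this, coeff_zero]
  · rw [lcoeff_apply, h1]
    exact one_ne_zero

/-- A simultaneous eigenvector of the Cherednik operators is a combination of the `E_ν` with the
same spectrum. -/
theorem exists_eigen_expansion {E : (Fin N → ℕ) → Pol N} (hE : ∀ ν, IsE ν (E ν)) {μ : Fin N → K}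
    {f : Pol N} (hf : ∀ i, opY i f = μ i • f) :
    ∃ c : (Fin N → ℕ) →₀ K, (c.sum fun ν a => a • E ν) = f ∧ ∀ ν, eigval ν ≠ μ → c ν = 0 := by
  obtain ⟨hli, hsp⟩ := linearIndependent_and_span_of_monic_triangular
    (fun ν => (hE ν).lead) (fun ν κ => coeff_expo_of_isE (hE ν))
  obtain ⟨c, hc⟩ := (Finsupp.mem_span_range_iff_exists_finsupp (R := K)).1
    (hsp (Submodule.mem_top (x := f)))
  refine ⟨c, hc, fun ν hν => ?_⟩
  obtain ⟨i, hi⟩ : ∃ i, eigval ν i ≠ μ i := by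
    by_contra hcon
    push Not at hcon
    exact hν (funext hcon)
  have h1 : ∑ κ ∈ c.support, (c κ * (eigval κ i - μ i)) • E κ = 0 := by
    have h2 := hf i
    rw [← hc, Finsupp.sum, map_sum, Finset.smul_sum, ← sub_eq_zero,
      ← Finset.sum_sub_distrib] at h2
    rw [← h2]
    refine Finset.sum_congr rfl fun κ _ => ?_
    rw [map_smul, (hE κ).eigen, smul_smul, smul_smul, ← sub_smul]
    congr 1
    ring
  by_contra hcν
  exact mul_ne_zero hcν (sub_ne_zero.2 hi)
    (linearIndependent_iff'.1 hli _ _ h1 ν (Finsupp.mem_support_iff.2 hcν))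

/-- By separation of spectra a joint eigenvector is a multiple of a single member of the eigenbasis,
and the leading coefficient fixes the multiple. Triangularity of `f` is not assumed, so the lemma
applies to a polynomial obtained by choice. -/
theorem IsE.unique {η : Fin N → ℕ} {e f : Pol N} (he : IsE η e)
    (hf : ∀ i, opY i f = eigval η i • f) (h1 : coeff (expo η) f = 1) : f = e := by
  choose E hE using exists_isE (N := N)
  -- The eigenbasis is modified so that its member at `η` is the given `e`.
  have hG : ∀ ν, IsE ν (Function.update E η e ν) := by
    intro ν
    by_cases h : ν = η
    · rw [h, Function.update_self]; exact he
    · rw [Function.update_of_ne h]; exact hE ν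
  obtain ⟨c, hc, hzero⟩ := exists_eigen_expansion hG hf
  have hfe : f = c η • e := by
    rw [← hc, Finsupp.sum, Finset.sum_eq_single η, Function.update_self]
    · intro ν _ hν
      rw [hzero ν fun h => hν (eigval_injective h), zero_smul]
    · intro hn
      rw [Finsupp.notMem_support_iff.1 hn, zero_smul]
  rw [hfe, coeff_smul, he.lead, smul_eq_mul, mul_one] at h1
  rw [hfe, h1, one_smul]

/-- The chosen polynomial satisfies only the defining conditions; uniqueness identifies it with the
constructed one and so transfers triangularity and regularity to it. -/
theorem isE_macdonald (η : Fin N → ℕ) : IsE η (macdonald η) := by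
  obtain ⟨e, he⟩ := exists_isE η
  have hM : IsMacdonald η e := ⟨he.lead, fun i => by rw [← opY_apply]; exact he.eigen i⟩
  have hM' : IsMacdonald η (macdonald η) := Classical.epsilon_spec ⟨e, hM⟩
  have : macdonald η = e :=
    he.unique (fun i => by rw [opY_apply]; exact hM'.2 i) hM'.1
  rwa [this]

theorem opT_macdonald_of_lt (η : Fin N → ℕ) {i : ℕ} (hi : i + 1 < N)
    (h : η ⟨i, by omega⟩ < η ⟨i + 1, hi⟩) :
    ∃ c ∈ regular, atZero c = RatFunc.X - 1 ∧
      opT N i (macdonald η) = c • macdonald η + t • macdonald (swapEntries η i hi) := by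
  obtain ⟨c, hcr, hc0, hc⟩ := exists_intertwiner_scalar η hi h
  refine ⟨c, hcr, hc0, ?_⟩
  have h1 := (isE_macdonald η).swap hi h hcr hc
  have h2 := (isE_macdonald (swapEntries η i hi)).unique h1.eigen h1.lead
  rw [← h2, smul_smul, mul_inv_cancel₀ t_ne_zero, one_smul]
  abel

/-- For equal adjacent entries the intertwiner has `c = t`, and its image would carry the spectrum
with two eigenvalues exchanged. The powers of `q` would force the composition to be `η`, whose rows
are in the other order. No such spectrum exists, so the image vanishes. -/
theorem opT_macdonald_of_eq (η : Fin N → ℕ) {i : ℕ} (hi : i + 1 < N)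
    (h : η ⟨i, by omega⟩ = η ⟨i + 1, hi⟩) :
    opT N i (macdonald η) = t • macdonald η := by
  have hE := isE_macdonald η
  have hrow := circleRow_succ_of_eq η hi h
  have hv : eigval η ⟨i, by omega⟩ = t * eigval η ⟨i + 1, hi⟩ := by
    rw [eigval, eigval, hrow, h, mul_left_comm, ← zpow_one_add₀ t_ne_zero]
    congr 2
    push_cast
    ring
  have h1 := opY_intertwine hi hE.eigen (c := t) (by rw [hv]; ring)
  rw [← sub_eq_zero]
  have hno : ∀ ν : Fin N → ℕ,
      eigval ν ≠ fun j => eigval η (Equiv.swap (⟨i, by omega⟩ : Fin N) ⟨i + 1, hi⟩ j) := by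
    intro ν hν
    have hνη : ν = η := by
      funext j
      have := (q_pow_mul_t_zpow_inj (congrFun hν j)).1
      rw [this]
      exact congrFun (swapEntries_of_eq η hi h) j
    have := (q_pow_mul_t_zpow_inj (congrFun hν ⟨i, by omega⟩)).2
    rw [Equiv.swap_apply_left, hνη, hrow] at this
    omega
  obtain ⟨d, hd, hzero⟩ := exists_eigen_expansion isE_macdonald h1
  have hd0 : d = 0 := Finsupp.ext fun ν => hzero ν (hno ν)
  rw [← hd, hd0, Finsupp.sum_zero_index]

end Macdonald

/-! ## Nonsymmetric Hall–Littlewood polynomials -/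

section HallLittlewood

variable {m : ℕ}

theorem coeff_hallLittlewood (a : Fin m → ℕ) (n : Fin m →₀ ℕ) :
    coeff n (hallLittlewood a) = atZero (coeff n (macdonald a)) := by
  rw [hallLittlewood, coeff_sum]
  simp only [coeff_monomial]
  rw [Finset.sum_ite_eq' (macdonald a).support n]
  split_ifs with h
  · rfl
  · rw [notMem_support_iff.1 h]
    exact (RatFunc.eval_zero _ _).symm

/-- Setting `q = 0` is a ring homomorphism only on regular scalars; a lift to that ring allows
polynomial identities to be specialised. -/
theorem exists_lift_hallLittlewood (a : Fin m → ℕ) : ∃ g : MvPolynomial (Fin m) regular,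
    MvPolynomial.map regular.subtype g = macdonald a ∧
      MvPolynomial.map atZeroHom g = hallLittlewood a := by
  obtain ⟨g, hg⟩ := (isE_macdonald a).reg
  refine ⟨g, hg, ?_⟩
  ext n
  rw [coeff_hallLittlewood, ← hg, coeff_map, coeff_map]
  rfl

/-- The nonsymmetric Hall–Littlewood polynomial with coefficients in `ℚ(q,t)`. -/
noncomputable def hlPoly (a : Fin m → ℕ) : Pol m :=
  MvPolynomial.map (RatFunc.C : Kt →+* K) (hallLittlewood a)

theorem coeff_hlPoly_self (a : Fin m → ℕ) : coeff (expo a) (hlPoly a) = 1 := by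
  rw [hlPoly, coeff_map, coeff_hallLittlewood, (isE_macdonald a).lead]
  exact (congrArg _ (RatFunc.eval_one _ _)).trans (map_one _)

theorem reflTransGen_of_coeff_hlPoly {a : Fin m → ℕ} {n : Fin m →₀ ℕ}
    (h : coeff n (hlPoly a) ≠ 0) : ReflTransGen Step ⇑n a := by
  refine (isE_macdonald a).tri n (mem_support_iff.2 fun h0 => h ?_)
  rw [hlPoly, coeff_map, coeff_hallLittlewood, h0]
  exact (congrArg _ (RatFunc.eval_zero _ _)).trans (map_zero _)

/-- The relation with denominators cleared descends to regular coefficients by injectivity of the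
inclusion, is specialised there, and then characterises the operator again. -/
theorem dl_hlPoly_of_lift {i j : Fin m} (hij : i ≠ j) {a b : Fin m → ℕ} {c d : K}
    (hc : c ∈ regular) (hd : d ∈ regular)
    (h : dl hij (macdonald a) = c • macdonald a + d • macdonald b) :
    dl hij (hlPoly a) = RatFunc.C (atZero c) • hlPoly a + RatFunc.C (atZero d) • hlPoly b := by
  obtain ⟨g, hg, hg'⟩ := exists_lift_hallLittlewood a
  obtain ⟨g2, hg2, hg2'⟩ := exists_lift_hallLittlewood b
  refine dl_unique hij ?_
  have h1 := dl_spec hij (macdonald a)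
  rw [h, ← hg, ← hg2, polySwap] at h1
  let T : regular := ⟨t, t_mem_regular⟩
  have h2 : (X i - X j) * (C ⟨c, hc⟩ * g + C ⟨d, hd⟩ * g2) =
      (C T * X i - X j) * rename (Equiv.swap i j) g + (1 - C T) * (X j * g) := by
    refine MvPolynomial.map_injective regular.subtype Subtype.val_injective ?_
    simp only [map_mul, map_sub, map_add, map_one, map_X, map_C, MvPolynomial.map_rename]
    simp only [smul_eq_C_mul] at h1
    exact h1
  have h3 := congrArg (MvPolynomial.map ((RatFunc.C : Kt →+* K).comp atZeroHom)) h2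
  simp only [map_mul, map_sub, map_add, map_one, map_X, map_C, MvPolynomial.map_rename] at h3
  rw [← MvPolynomial.map_map, ← MvPolynomial.map_map, hg', hg2'] at h3
  have hT : ((RatFunc.C : Kt →+* K).comp atZeroHom) T = t :=
    congrArg RatFunc.C (atZero_C (RatFunc.X : Kt))
  rw [hT] at h3
  rw [smul_eq_C_mul, smul_eq_C_mul]
  exact h3

theorem opT_hlPoly_of_lt (a : Fin m → ℕ) {i : ℕ} (hi : i + 1 < m)
    (h : a ⟨i, by omega⟩ < a ⟨i + 1, hi⟩) :
    opT m i (hlPoly a) = (t - 1) • hlPoly a + t • hlPoly (swapEntries a i hi) := by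
  obtain ⟨c, hcr, hc0, hc⟩ := opT_macdonald_of_lt a hi h
  rw [opT_of_lt hi] at hc ⊢
  rw [dl_hlPoly_of_lift _ hcr t_mem_regular hc, hc0, map_sub, map_one]
  congr 2
  exact congrArg RatFunc.C (atZero_C (RatFunc.X : Kt))

theorem opT_hlPoly_of_eq (a : Fin m → ℕ) {i : ℕ} (hi : i + 1 < m)
    (h : a ⟨i, by omega⟩ = a ⟨i + 1, hi⟩) : opT m i (hlPoly a) = t • hlPoly a := by
  have hc := opT_macdonald_of_eq a hi h
  rw [opT_of_lt hi] at hc ⊢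
  have hc' : dl (fin_ne_succ hi) (macdonald a) = t • macdonald a + (0 : K) • macdonald a := by
    rw [hc, zero_smul, add_zero]
  rw [dl_hlPoly_of_lift _ t_mem_regular (Subring.zero_mem _) hc']
  have h0 : atZero 0 = 0 := RatFunc.eval_zero _ _
  rw [h0, map_zero, zero_smul, add_zero]
  congr 1
  exact congrArg RatFunc.C (atZero_C (RatFunc.X : Kt))

/-- Apply the operator once more to the formula at an ascent and use the quadratic relation. -/
theorem opT_hlPoly_of_gt (a : Fin m → ℕ) {i : ℕ} (hi : i + 1 < m)
    (h : a ⟨i + 1, hi⟩ < a ⟨i, by omega⟩) :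
    opT m i (hlPoly a) = hlPoly (swapEntries a i hi) := by
  have h1 := opT_hlPoly_of_lt (swapEntries a i hi) hi
    (by rw [swapEntries_left, swapEntries_right]; exact h)
  rw [swapEntries_swapEntries] at h1
  have h2 : hlPoly a = t⁻¹ • (opT m i (hlPoly (swapEntries a i hi)) -
      (t - 1) • hlPoly (swapEntries a i hi)) := by
    rw [h1, add_sub_cancel_left, smul_smul, inv_mul_cancel₀ t_ne_zero, one_smul]
  rw [h2, map_smul, map_sub, map_smul, ← Module.End.mul_apply, opT_mul_self hi,
    LinearMap.add_apply, LinearMap.smul_apply, LinearMap.smul_apply, Module.End.one_apply,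
    add_sub_cancel_left, smul_smul, inv_mul_cancel₀ t_ne_zero, one_smul]

end HallLittlewood

/-! ## Power sums -/

section PowerSum

variable {S : Type*} [CommSemiring S]

open Classical in
/-- The power sum `∑ x_j ^ r` as a power series. -/
noncomputable def psumSeries (S : Type*) [CommSemiring S] (r : ℕ) : MvPowerSeries ℕ S :=
  fun n : ℕ →₀ ℕ => if ∃ j, n = Finsupp.single j r then 1 else 0

open Classical in
theorem coeff_psumSeries (r : ℕ) (n : ℕ →₀ ℕ) : MvPowerSeries.coeff n (psumSeries S r) =
    if ∃ j, n = Finsupp.single j r then 1 else 0 := rfl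

theorem coeff_psumSeries_mul {r : ℕ} (hr : 0 < r) (g : MvPowerSeries ℕ S) (n : ℕ →₀ ℕ) :
    MvPowerSeries.coeff n (psumSeries S r * g) =
      ∑ j ∈ n.support, if r ≤ n j then MvPowerSeries.coeff (n - Finsupp.single j r) g else 0 := by
  classical
  rw [MvPowerSeries.coeff_mul, ← Finset.sum_filter]
  simp only [coeff_psumSeries, ite_mul, one_mul, zero_mul]
  rw [← Finset.sum_filter]
  symm
  refine Finset.sum_bij (fun j _ => (Finsupp.single j r, n - Finsupp.single j r)) ?_ ?_ ?_ ?_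
  · intro j hj
    rw [Finset.mem_filter] at hj
    rw [Finset.mem_filter, Finset.HasAntidiagonal.mem_antidiagonal]
    exact ⟨add_tsub_cancel_of_le (Finsupp.single_le_iff.2 hj.2), j, rfl⟩
  · intro i _ j _ h
    exact Finsupp.single_left_injective hr.ne' (congrArg Prod.fst h)
  · rintro ⟨u, v⟩ h
    rw [Finset.mem_filter, Finset.HasAntidiagonal.mem_antidiagonal] at h
    obtain ⟨h1, j, h2⟩ := h
    simp only at h1 h2
    subst h2
    have h3 : r ≤ n j := by
      rw [← h1]
      simp
    refine ⟨j, ?_, ?_⟩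
    · rw [Finset.mem_filter, Finsupp.mem_support_iff]
      exact ⟨by omega, h3⟩
    · rw [← h1, add_tsub_cancel_left]
  · intro j _
    rfl

theorem map_psumSeries {S' : Type*} [CommSemiring S'] (φ : S →+* S') (r : ℕ) :
    MvPowerSeries.map φ (psumSeries S r) = psumSeries S' r := by
  ext n
  rw [MvPowerSeries.coeff_map, coeff_psumSeries, coeff_psumSeries]
  split_ifs
  · exact map_one φ
  · exact map_zero φ

/-- The power sum `∑ x_j ^ r` as an element of `R_m`. -/
noncomputable def psym (m r : ℕ) : R m :=
  ⟨psumSeries K r, by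
    classical
    refine ⟨⟨r, fun n hn => ?_⟩, fun σ _ => ?_⟩
    · rw [coeff_psumSeries, if_neg]
      rintro ⟨j, rfl⟩
      rw [Finsupp.degree_single] at hn
      exact lt_irrefl _ hn
    · ext n
      obtain ⟨n, rfl⟩ : ∃ n', n = Finsupp.embDomain σ.toEmbedding n' := by
        refine ⟨Finsupp.embDomain σ.symm.toEmbedding n, ?_⟩
        rw [Finsupp.embDomain_eq_mapDomain, Finsupp.embDomain_eq_mapDomain,
          ← Finsupp.mapDomain_comp]
        simp
      refine (MvPowerSeries.coeff_embDomain_rename σ.toEmbedding _ n).trans ?_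
      rw [coeff_psumSeries, coeff_psumSeries]
      congr 1
      rw [eq_iff_iff]
      constructor
      · rintro ⟨j, rfl⟩
        exact ⟨σ j, by rw [Finsupp.embDomain_single]; rfl⟩
      · rintro ⟨j, h⟩
        refine ⟨σ.symm j, Finsupp.embDomain_injective σ.toEmbedding ?_⟩
        rw [h, Finsupp.embDomain_single]
        simp⟩

end PowerSum

/-! ### Coordinates on `R m`: coefficients at representatives of orbits of exponents -/

section Coordinates

variable {m : ℕ}

theorem coeff_embDomain_of_mem {f : MvPowerSeries ℕ K} (hf : f ∈ R m) {σ : Equiv.Perm ℕ}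
    (hσ : ∀ i < m, σ i = i) (n : ℕ →₀ ℕ) :
    MvPowerSeries.coeff (Finsupp.embDomain σ.toEmbedding n) f = MvPowerSeries.coeff n f := by
  have := MvPowerSeries.coeff_embDomain_rename σ.toEmbedding f n
  rw [← this]
  congr 1
  exact (hf.2 σ hσ).symm

/-- The exponent with entries `l` at the places `s, s + 1, …`. -/
noncomputable def place (s : ℕ) : List ℕ → (ℕ →₀ ℕ)
  | [] => 0
  | r :: l => Finsupp.single s r + place (s + 1) l

theorem place_apply (s : ℕ) (l : List ℕ) (i : ℕ) :
    place s l i = if s ≤ i then l.getD (i - s) 0 else 0 := by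
  induction l generalizing s with
  | nil => simp [place]
  | cons r l ih =>
    rw [place, Finsupp.add_apply, ih, Finsupp.single_apply]
    rcases lt_trichotomy s i with h | rfl | h
    · rw [if_neg h.ne, if_pos (by omega), if_pos h.le, zero_add,
        show i - s = i - (s + 1) + 1 by omega, List.getD_cons_succ]
    · simp
    · rw [if_neg (by omega), if_neg (by omega), if_neg (by omega)]

theorem degree_place (s : ℕ) (l : List ℕ) : (place s l).degree = l.sum := by
  induction l generalizing s with
  | nil => simp [place]
  | cons r l ih => rw [place, map_add, ih, Finsupp.degree_single, List.sum_cons]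

/-- The composition `a` as an exponent in the variables `X 0, …, X (m-1)`. -/
noncomputable def headExpo (a : Fin m → ℕ) : ℕ →₀ ℕ := Finsupp.embDomain Fin.valEmbedding (expo a)

theorem headExpo_apply (a : Fin m → ℕ) (i : Fin m) : headExpo a i = a i :=
  Finsupp.embDomain_apply_self Fin.valEmbedding (expo a) i

theorem headExpo_of_le (a : Fin m → ℕ) {i : ℕ} (h : m ≤ i) : headExpo a i = 0 := by
  refine Finsupp.embDomain_of_notMem_range _ _ _ ?_
  rintro ⟨j, rfl⟩
  exact absurd j.isLt (not_lt.2 h)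

theorem degree_headExpo (a : Fin m → ℕ) : (headExpo a).degree = ∑ i, a i := by
  rw [headExpo, Finsupp.embDomain_eq_mapDomain, Finsupp.degree_mapDomain,
    Finsupp.degree_eq_sum]
  rfl

/-- The size of an `m`-partition. -/
def psize (L : MPartition m) : ℕ := ∑ i, L.1 i + L.2.card

theorem sum_rowLens (lam : YoungDiagram) : lam.rowLens.sum = lam.card := by
  have h1 : lam.rowLens.sum = ∑ i ∈ Finset.range (lam.colLen 0), lam.rowLen i := rfl
  rw [h1, YoungDiagram.card,
    Finset.card_eq_sum_card_fiberwise (f := Prod.fst) (t := Finset.range (lam.colLen 0))]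
  · exact Finset.sum_congr rfl fun i _ => lam.rowLen_eq_card
  · intro c hc
    have h2 : (c.1, 0) ∈ lam := lam.up_left_mem le_rfl (Nat.zero_le c.2) hc
    exact Finset.mem_coe.2 (Finset.mem_range.2 (YoungDiagram.mem_iff_lt_colLen.1 h2))

theorem rowLen_ofRowLens_eq_getD (w : List ℕ) (hw : w.SortedGE) (i : ℕ) :
    (YoungDiagram.ofRowLens w hw).rowLen i = w.getD i 0 := by
  by_cases h : i < w.length
  · rw [List.getD_eq_getElem _ _ h]
    exact YoungDiagram.rowLen_ofRowLens ⟨i, h⟩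
  · rw [List.getD_eq_default _ _ (not_lt.1 h)]
    by_contra hne
    have : (i, 0) ∈ YoungDiagram.ofRowLens w hw :=
      YoungDiagram.mem_iff_lt_rowLen.2 (Nat.pos_of_ne_zero hne)
    exact h (YoungDiagram.mem_ofRowLens.1 this).1

theorem getD_rowLens (lam : YoungDiagram) (i : ℕ) : lam.rowLens.getD i 0 = lam.rowLen i := by
  rw [← rowLen_ofRowLens_eq_getD _ lam.rowLens_sorted, YoungDiagram.ofRowLens_to_rowLens_eq_self]

/-- The representative of the orbit of exponents that corresponds to an `m`-partition. -/
noncomputable def repExpo (L : MPartition m) : ℕ →₀ ℕ := headExpo L.1 + place m L.2.rowLens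

theorem degree_repExpo (L : MPartition m) : (repExpo L).degree = psize L := by
  rw [repExpo, map_add, degree_headExpo, degree_place, sum_rowLens, psize]

theorem youngDiagram_cells_subset (lam : YoungDiagram) :
    lam.cells ⊆ Finset.range lam.card ×ˢ Finset.range lam.card := by
  intro c hc
  have h1 : lam.rowLen c.1 ≤ lam.card := by
    rw [YoungDiagram.rowLen_eq_card]
    exact Finset.card_le_card (Finset.filter_subset _ _)
  have h2 : lam.colLen c.2 ≤ lam.card := by
    rw [YoungDiagram.colLen_eq_card]
    exact Finset.card_le_card (Finset.filter_subset _ _)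
  have h3 := YoungDiagram.mem_iff_lt_rowLen.1 ((YoungDiagram.mem_cells c).1 hc)
  have h4 := YoungDiagram.mem_iff_lt_colLen.1 ((YoungDiagram.mem_cells c).1 hc)
  rw [Finset.mem_product, Finset.mem_range, Finset.mem_range]
  omega

theorem finite_setOf_card_le (d : ℕ) : {lam : YoungDiagram | lam.card ≤ d}.Finite := by
  refine Set.Finite.of_finite_image (f := YoungDiagram.cells) ?_ ?_
  · refine ((Finset.range d ×ˢ Finset.range d).powerset.finite_toSet).subset ?_
    rintro _ ⟨lam, h, rfl⟩
    rw [Finset.mem_coe, Finset.mem_powerset]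
    refine (youngDiagram_cells_subset lam).trans ?_
    exact Finset.product_subset_product (Finset.range_mono h) (Finset.range_mono h)
  · intro a _ b _ h
    exact YoungDiagram.ext h

theorem finite_setOf_psize_le (d : ℕ) : {L : MPartition m | psize L ≤ d}.Finite := by
  refine ((Set.Finite.pi' fun _ : Fin m => Set.finite_le_nat d).prod
    (finite_setOf_card_le d)).subset ?_
  rintro ⟨a, lam⟩ h
  have h' : ∑ i, a i + lam.card ≤ d := h
  refine ⟨fun i => ?_, ?_⟩
  · have := Finset.single_le_sum (f := a) (fun _ _ => Nat.zero_le _) (Finset.mem_univ i)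
    exact this.trans ((Nat.le_add_right _ _).trans h')
  · exact (Nat.le_add_left _ _).trans h'

/-- The coefficient of an element of `R_m` at the representative of an orbit of exponents. -/
noncomputable def repCoeff (L : MPartition m) : R m →ₗ[K] K :=
  (MvPowerSeries.coeff (repExpo L)).comp (R m).val.toLinearMap

theorem repCoeff_apply (L : MPartition m) (f : R m) :
    repCoeff L f = MvPowerSeries.coeff (repExpo L) f.1 := rfl

theorem finite_repCoeff_ne_zero (f : R m) : {L | repCoeff L f ≠ 0}.Finite := by
  obtain ⟨d, hd⟩ := f.2.1
  refine (finite_setOf_psize_le d).subset fun L hL => ?_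
  by_contra h
  refine hL (hd _ ?_)
  rw [degree_repExpo]
  exact not_le.1 h

/-- Every exponent is conjugate to the representative of an `m`-partition. -/
theorem exists_perm_repExpo (n : ℕ →₀ ℕ) : ∃ (L : MPartition m) (σ : Equiv.Perm ℕ),
    (∀ i < m, σ i = i) ∧ Finsupp.embDomain σ.toEmbedding (repExpo L) = n := by
  obtain ⟨N, hN⟩ := n.support.exists_nat_subset_range
  let g : Fin N → ℕ := fun k => n (m + k)
  -- Sorting in the dual order arranges the exponents at the places `m, …, m + N - 1` decreasingly.
  -- All exponents at later places vanish, so `τ` extended by the identity suffices.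
  let τ : Equiv.Perm (Fin N) := Tuple.sort (OrderDual.toDual ∘ g)
  have hτ : Antitone (g ∘ τ) := fun i j h => Tuple.monotone_sort (OrderDual.toDual ∘ g) h
  let e : Fin N ≃ {i : ℕ // m ≤ i ∧ i < m + N} :=
    { toFun := fun k => ⟨m + k, by omega⟩
      invFun := fun i => ⟨i.1 - m, by have := i.2; omega⟩
      left_inv := fun k => Fin.ext (by simp)
      right_inv := fun i => Subtype.ext (by have := i.2; simp; omega) }
  let σ : Equiv.Perm ℕ := τ.extendDomain e
  have hsorted : (List.ofFn (g ∘ τ)).SortedGE := by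
    rw [List.sortedGE_ofFn_iff]
    exact hτ
  let lam := YoungDiagram.ofRowLens (List.ofFn (g ∘ τ)) hsorted
  refine ⟨(fun i => n i, lam), σ, fun i hi => ?_, ?_⟩
  · exact Equiv.Perm.extendDomain_apply_not_subtype _ _ (by simp; omega)
  · have hrow : ∀ k, lam.rowLens.getD k 0 = if h : k < N then g (τ ⟨k, h⟩) else 0 := by
      intro k
      rw [getD_rowLens, rowLen_ofRowLens_eq_getD]
      split_ifs with h
      · rw [List.getD_eq_getElem _ _ (by simpa using h), List.getElem_ofFn]
        rfl
      · rw [List.getD_eq_default _ _ (by simpa using h)]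
    ext x
    obtain ⟨x, rfl⟩ := σ.surjective x
    rw [show σ x = σ.toEmbedding x from rfl, Finsupp.embDomain_apply_self, repExpo,
      Finsupp.add_apply, place_apply]
    simp only [hrow]
    by_cases h1 : m ≤ x
    · rw [headExpo_of_le _ h1, if_pos h1, zero_add]
      by_cases h2 : x < m + N
      · have h3 := Equiv.Perm.extendDomain_apply_subtype τ e (b := x) ⟨h1, h2⟩
        rw [dif_pos (by omega)]
        change _ = n (σ x)
        rw [show σ x = _ from h3]
        rfl
      · have h3 : σ x = x := Equiv.Perm.extendDomain_apply_not_subtype τ e (b := x) (by omega)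
        rw [dif_neg (by omega)]
        change _ = n (σ x)
        rw [h3]
        by_contra hne
        have := Finset.mem_range.1 (hN (Finsupp.mem_support_iff.2 (Ne.symm hne)))
        omega
    · have h3 : σ x = x := Equiv.Perm.extendDomain_apply_not_subtype τ e (b := x) (by omega)
      rw [if_neg h1, add_zero]
      change _ = n (σ x)
      rw [h3]
      exact headExpo_apply _ ⟨x, by omega⟩

theorem eq_zero_of_repCoeff (f : R m) (h : ∀ L, repCoeff L f = 0) : f = 0 := by
  refine Subtype.ext (MvPowerSeries.ext fun n => ?_)
  obtain ⟨L, σ, hσ, rfl⟩ := exists_perm_repExpo (m := m) n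
  rw [coeff_embDomain_of_mem f.2 hσ]
  exact h L

end Coordinates

/-! ## The basis `x ^ a p_λ` of `R_m` -/

section PowerSumBasis

variable {m : ℕ}

/-- `x ^ A p_l` as a power series over `ℕ`. -/
noncomputable def headPsum (A : ℕ →₀ ℕ) (l : List ℕ) : MvPowerSeries ℕ ℕ :=
  (l.map (psumSeries ℕ)).prod * MvPowerSeries.monomial A 1

theorem headPsum_cons (A : ℕ →₀ ℕ) (r : ℕ) (l : List ℕ) :
    headPsum A (r :: l) = psumSeries ℕ r * headPsum A l := by
  rw [headPsum, headPsum, List.map_cons, List.prod_cons, mul_assoc]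

/-- Over `ℕ` nothing cancels, so a coefficient is nonzero as soon as one way of choosing the
variable for `p_r` contributes. This is why the product is taken over `ℕ`. -/
theorem coeff_headPsum_cons_ne_zero {A n : ℕ →₀ ℕ} {r : ℕ} (hr : 0 < r) {l : List ℕ} :
    MvPowerSeries.coeff n (headPsum A (r :: l)) ≠ 0 ↔
      ∃ j n', MvPowerSeries.coeff n' (headPsum A l) ≠ 0 ∧ n = n' + Finsupp.single j r := by
  rw [headPsum_cons, coeff_psumSeries_mul hr, Ne, Finset.sum_eq_zero_iff]
  push Not
  constructor
  · rintro ⟨j, -, h⟩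
    split_ifs at h with h1
    · exact ⟨j, _, h, (tsub_add_cancel_of_le (Finsupp.single_le_iff.2 h1)).symm⟩
    · exact absurd rfl h
  · rintro ⟨j, n', h, rfl⟩
    have h1 : r ≤ (n' + Finsupp.single j r) j := by simp
    refine ⟨j, ?_, ?_⟩
    · rw [Finsupp.mem_support_iff]
      omega
    · rw [if_pos h1, add_tsub_cancel_right]
      exact h

/-- The multiset of the positive exponents of the variables `X m, X (m+1), …`. -/
noncomputable def tailParts (m : ℕ) (n : ℕ →₀ ℕ) : Multiset ℕ :=
  (n.support.filter (m ≤ ·)).val.map n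

theorem tailParts_add_single_of_lt {n : ℕ →₀ ℕ} {j r : ℕ} (hj : j < m) :
    tailParts m (n + Finsupp.single j r) = tailParts m n := by
  have hv : ∀ i, m ≤ i → (n + Finsupp.single j r) i = n i := fun i hi => by
    rw [Finsupp.add_apply, Finsupp.single_eq_of_ne (by omega), add_zero]
  have hs : (n + Finsupp.single j r).support.filter (m ≤ ·) = n.support.filter (m ≤ ·) := by
    ext i
    simp only [Finset.mem_filter, Finsupp.mem_support_iff]
    exact and_congr_left fun h => by rw [hv i h]
  rw [tailParts, tailParts, hs]
  exact Multiset.map_congr rfl fun i hi => hv i (Finset.mem_filter.1 hi).2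

theorem card_tailParts_add_single_of_ne {n : ℕ →₀ ℕ} {j r : ℕ} (hj : n j ≠ 0) :
    (tailParts m (n + Finsupp.single j r)).card = (tailParts m n).card := by
  rw [tailParts, tailParts, Multiset.card_map, Multiset.card_map]
  congr 2
  ext i
  simp only [Finset.mem_filter, Finsupp.mem_support_iff, Finsupp.add_apply, Finsupp.single_apply]
  refine and_congr_left fun _ => ?_
  split_ifs with h
  · subst h; omega
  · rw [add_zero]

theorem tailParts_add_single_of_eq_zero {n : ℕ →₀ ℕ} {j r : ℕ} (hr : 0 < r) (hj : m ≤ j)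
    (hn : n j = 0) : tailParts m (n + Finsupp.single j r) = r ::ₘ tailParts m n := by
  have hs : (n + Finsupp.single j r).support.filter (m ≤ ·) =
      insert j (n.support.filter (m ≤ ·)) := by
    ext i
    simp only [Finset.mem_filter, Finsupp.mem_support_iff, Finsupp.add_apply,
      Finsupp.single_apply, Finset.mem_insert]
    by_cases h : j = i
    · subst h
      simp [hn, hr.ne', hj]
    · simp [h, Ne.symm h]
  have hnot : j ∉ n.support.filter (m ≤ ·) := by simp [hn]
  rw [tailParts, tailParts, hs, Finset.insert_val_of_notMem hnot, Multiset.map_cons]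
  congr 1
  · simp [hn]
  · refine Multiset.map_congr rfl fun i hi => ?_
    have : j ≠ i := fun e => hnot (e ▸ hi)
    simp [Ne.symm this]

/-- Each factor `p_r` puts its exponent on a head variable, on an occupied tail variable or on a
fresh one. Only the last adds a part, so the full number of parts forces all choices to be fresh and
leaves the head unchanged. -/
theorem tailParts_of_coeff_headPsum {A : ℕ →₀ ℕ} (hA : ∀ i, m ≤ i → A i = 0) {l : List ℕ}
    (hl : ∀ r ∈ l, 0 < r) {n : ℕ →₀ ℕ} (h : MvPowerSeries.coeff n (headPsum A l) ≠ 0) :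
    (tailParts m n).card < l.length ∨
      (tailParts m n = l ∧ ∀ i < m, n i = A i) := by
  classical
  induction l generalizing n with
  | nil =>
    rw [headPsum, List.map_nil, List.prod_nil, one_mul, MvPowerSeries.coeff_monomial] at h
    obtain rfl : n = A := by
      by_contra hne
      exact h (if_neg hne)
    refine Or.inr ⟨?_, fun _ _ => rfl⟩
    rw [tailParts, Finset.filter_eq_empty_iff.2]
    · rfl
    · intro i hi hm
      exact Finsupp.mem_support_iff.1 hi (hA i hm)
  | cons r l ih =>
    have hr := hl r (by simp)
    obtain ⟨j, n', h', rfl⟩ := (coeff_headPsum_cons_ne_zero hr).1 h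
    have ih' := ih (fun s hs => hl s (by simp [hs])) h'
    rw [List.length_cons]
    by_cases hj : j < m
    · rw [tailParts_add_single_of_lt hj]
      rcases ih' with h1 | ⟨h1, -⟩
      · left; omega
      · left; rw [h1, Multiset.coe_card]; omega
    · by_cases hn : n' j = 0
      · rw [tailParts_add_single_of_eq_zero hr (not_lt.1 hj) hn]
        rcases ih' with h1 | ⟨h1, h2⟩
        · left; rw [Multiset.card_cons]; omega
        · right
          refine ⟨by rw [h1]; rfl, fun i hi => ?_⟩
          rw [Finsupp.add_apply, Finsupp.single_eq_of_ne (by omega), add_zero, h2 i hi]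
      · rw [card_tailParts_add_single_of_ne hn]
        rcases ih' with h1 | ⟨h1, -⟩
        · left; omega
        · left; rw [h1, Multiset.coe_card]; omega

theorem coeff_headPsum_place_ne_zero (A : ℕ →₀ ℕ) {l : List ℕ} (hl : ∀ r ∈ l, 0 < r) (s : ℕ) :
    MvPowerSeries.coeff (A + place s l) (headPsum A l) ≠ 0 := by
  classical
  induction l generalizing s with
  | nil => simp [headPsum, place]
  | cons r l ih =>
    refine (coeff_headPsum_cons_ne_zero (hl r (by simp))).2
      ⟨s, A + place (s + 1) l, ih (fun x hx => hl x (by simp [hx])) _, ?_⟩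
    rw [place]
    abel

theorem tailParts_add_place {A : ℕ →₀ ℕ} (hA : ∀ i, m ≤ i → A i = 0) {l : List ℕ}
    (hl : ∀ r ∈ l, 0 < r) {s : ℕ} (hs : m ≤ s) : tailParts m (A + place s l) = l := by
  induction l generalizing s with
  | nil =>
    rw [place, add_zero, tailParts, Finset.filter_eq_empty_iff.2]
    · rfl
    · intro i hi hm
      exact Finsupp.mem_support_iff.1 hi (hA i hm)
  | cons r l ih =>
    rw [place, add_comm (Finsupp.single s r), ← add_assoc,
      tailParts_add_single_of_eq_zero (hl r (by simp)) hs,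
      ih (fun x hx => hl x (by simp [hx])) (by omega)]
    · rfl
    · rw [Finsupp.add_apply, hA s hs, place_apply, if_neg (by omega)]

theorem rowLens_injective : Function.Injective YoungDiagram.rowLens := by
  intro a b h
  rw [← YoungDiagram.ofRowLens_to_rowLens_eq_self (μ := a),
    ← YoungDiagram.ofRowLens_to_rowLens_eq_self (μ := b)]
  simp only [h]

theorem eq_of_rowLens_perm {a b : YoungDiagram} (h : a.rowLens.Perm b.rowLens) : a = b :=
  rowLens_injective (h.eq_of_pairwise' a.rowLens_sorted.pairwise b.rowLens_sorted.pairwise)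

/-- `x ^ a` as an element of `R_m`. -/
noncomputable def xpow (a : Fin m → ℕ) : R m := ofPoly m (monomial (expo a) 1)

/-- The product of the power sums indexed by the entries of a list. -/
noncomputable def psymList (m : ℕ) (l : List ℕ) : R m := (l.map (psym m)).prod

theorem coe_ofPoly (f : Pol m) :
    (ofPoly m f : MvPowerSeries ℕ K) = (rename Fin.val f : MvPolynomial ℕ K) := by
  induction f using MvPolynomial.induction_on with
  | C c =>
    rw [rename_C, MvPolynomial.coe_C]
    exact congrArg Subtype.val ((ofPoly m).commutes c)
  | add f g hf hg =>
    rw [map_add, map_add, MvPolynomial.coe_add, ← hf, ← hg]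
    rfl
  | mul_X f i hf =>
    rw [map_mul, map_mul, MvPolynomial.coe_mul, ← hf, rename_X, MvPolynomial.coe_X, ofPoly,
      aeval_X]
    rfl

theorem coe_xpow (a : Fin m → ℕ) :
    (xpow a : MvPowerSeries ℕ K) = MvPowerSeries.monomial (headExpo a) 1 := by
  rw [xpow, coe_ofPoly, rename_monomial, MvPolynomial.coe_monomial, headExpo,
    Finsupp.embDomain_eq_mapDomain]
  rfl

theorem coe_xpow_mul_psymList (a : Fin m → ℕ) (l : List ℕ) :
    (xpow a * psymList m l : R m).1 =
      MvPowerSeries.map (Nat.castRingHom K) (headPsum (headExpo a) l) := by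
  rw [headPsum, map_mul, MvPowerSeries.map_monomial, map_one, mul_comm (MvPowerSeries.map _ _)]
  refine congrArg₂ (· * ·) (coe_xpow a) ?_
  rw [psymList, map_list_prod, List.map_map]
  refine (map_list_prod (R m).val _).trans ?_
  rw [List.map_map]
  congr 1
  refine List.map_congr_left fun r _ => ?_
  exact (map_psumSeries _ r).symm

/-- Triangular in the number of parts, with respect to the coefficients at orbit representatives;
equality of the number of parts forces equality of the `m`-partitions. -/
theorem psymList_basis :
    LinearIndependent K (fun L : MPartition m => xpow L.1 * psymList m L.2.rowLens) ∧
      ⊤ ≤ Submodule.span K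
        (Set.range fun L : MPartition m => xpow L.1 * psymList m L.2.rowLens) := by
  have hc : ∀ L O : MPartition m, repCoeff O (xpow L.1 * psymList m L.2.rowLens) ≠ 0 ↔
      MvPowerSeries.coeff (repExpo O) (headPsum (headExpo L.1) L.2.rowLens) ≠ 0 := by
    intro L O
    rw [repCoeff_apply, coe_xpow_mul_psymList, MvPowerSeries.coeff_map]
    exact Nat.cast_ne_zero
  refine linearIndependent_and_span_of_triangular repCoeff _
    (fun L => L.2.rowLens.length) finite_repCoeff_ne_zero eq_zero_of_repCoeff (fun L => ?_)
    fun L O h => ?_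
  · rw [hc]
    exact coeff_headPsum_place_ne_zero _ L.2.pos_of_mem_rowLens m
  · have hA : ∀ (a : Fin m → ℕ) i, m ≤ i → headExpo a i = 0 := fun a i hi => headExpo_of_le a hi
    rw [hc] at h
    have h1 := tailParts_of_coeff_headPsum (hA L.1) L.2.pos_of_mem_rowLens h
    rw [repExpo, tailParts_add_place (hA O.1) O.2.pos_of_mem_rowLens le_rfl] at h1
    rcases h1 with h1 | ⟨h1, h2⟩
    · exact Or.inr h1
    · left
      refine Prod.ext (funext fun i => ?_) (eq_of_rowLens_perm (Multiset.coe_eq_coe.1 h1))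
      have h3 := h2 i i.isLt
      rw [Finsupp.add_apply, headExpo_apply, headExpo_apply, place_apply,
        if_neg (not_le.2 i.isLt), add_zero] at h3
      exact h3

end PowerSumBasis

/-- A family that is triangular with respect to a basis is a basis. -/
theorem linearIndependent_and_span_of_basis_triangular {k M ι : Type*} [Field k] [AddCommGroup M]
    [Module k M] (b : Module.Basis ι k M) (v : ι → M) (ρ : ι → ℕ) (c : ι → k) (hc : ∀ i, c i ≠ 0)
    (h : ∀ i, v i - c i • b i ∈ Submodule.span k (b '' {j | ρ j < ρ i})) :
    LinearIndependent k v ∧ ⊤ ≤ Submodule.span k (Set.range v) := by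
  classical
  have key : ∀ i j, b.coord j (v i) ≠ c i * b.coord j (b i) → ρ j < ρ i := by
    intro i j hne
    refine (b.mem_span_image.1 (h i)) (Finsupp.mem_support_iff.2 ?_)
    rw [map_sub, map_smul]
    exact sub_ne_zero.2 hne
  refine linearIndependent_and_span_of_triangular b.coord v ρ (fun f => ?_) (fun f hf => ?_)
    (fun i => ?_) fun i j hij => ?_
  · exact (b.repr f).support.finite_toSet.subset fun i hi =>
      Finset.mem_coe.2 (Finsupp.mem_support_iff.2 hi)
  · exact b.ext_elem fun i => by rw [map_zero]; exact hf i
  · have := key i i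
    rw [Module.Basis.coord_apply b i (b i), b.repr_self, Finsupp.single_eq_same, mul_one] at this
    intro h0
    rw [h0] at this
    exact lt_irrefl _ (this (hc i).symm)
  · by_cases hji : j = i
    · exact Or.inl hji
    · refine Or.inr (key i j ?_)
      rw [Module.Basis.coord_apply b j (b i), b.repr_self, Finsupp.single_eq_of_ne hji, mul_zero]
      exact hij

/-! ## The basis `k_Λ` of `R_m` -/

section KBasis

variable {m : ℕ}

theorem exists_rowLens_perm {l : List ℕ} (hl : ∀ r ∈ l, 0 < r) :
    ∃ lam : YoungDiagram, lam.rowLens.Perm l := by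
  have hp : (l.mergeSort (· ≥ ·)).Perm l := List.mergeSort_perm _ _
  have hs : (l.mergeSort (· ≥ ·)).SortedGE := by
    have := List.pairwise_mergeSort (le := fun a b : ℕ => decide (a ≥ b))
      (fun a b c h1 h2 => by simp at *; omega) (fun a b => by simp; omega) l
    exact (this.imp fun h => by simpa using h).sortedGE
  refine ⟨YoungDiagram.ofRowLens _ hs, ?_⟩
  rw [YoungDiagram.rowLens_ofRowLens_eq_self fun x hx => hl x (hp.subset hx)]
  exact hp

theorem card_eq_of_rowLens_perm {lam : YoungDiagram} {l : List ℕ} (h : lam.rowLens.Perm l) :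
    lam.card = l.sum := by
  rw [← sum_rowLens, h.sum_eq]

/-- The span of the products of at least `k` power sums, of total degree `n`. -/
noncomputable def psymSpan (m n k : ℕ) : Submodule K (R m) :=
  Submodule.span K {f | ∃ l : List ℕ, (∀ r ∈ l, 0 < r) ∧ l.sum = n ∧ k ≤ l.length ∧
    f = psymList m l}

theorem psymList_mem {l : List ℕ} (hl : ∀ r ∈ l, 0 < r) {n k : ℕ} (hn : l.sum = n)
    (hk : k ≤ l.length) : psymList m l ∈ psymSpan m n k :=
  Submodule.subset_span ⟨l, hl, hn, hk, rfl⟩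

theorem psymSpan_mono {n k k' : ℕ} (h : k ≤ k') : psymSpan m n k' ≤ psymSpan m n k := by
  refine Submodule.span_mono ?_
  rintro _ ⟨l, h1, h2, h3, rfl⟩
  exact ⟨l, h1, h2, h.trans h3, rfl⟩

theorem psymSpan_mul {n k n' k' : ℕ} {f g : R m} (hf : f ∈ psymSpan m n k)
    (hg : g ∈ psymSpan m n' k') : f * g ∈ psymSpan m (n + n') (k + k') := by
  have h := Submodule.mul_mem_mul hf hg
  rw [psymSpan, psymSpan, Submodule.span_mul_span] at h
  refine Submodule.span_mono ?_ h
  rintro _ ⟨_, ⟨l, h1, h2, h3, rfl⟩, _, ⟨l', h1', h2', h3', rfl⟩, rfl⟩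
  refine ⟨l ++ l', fun r hr => ?_, ?_, ?_, ?_⟩
  · rcases List.mem_append.1 hr with h | h
    · exact h1 r h
    · exact h1' r h
  · rw [List.sum_append, h2, h2']
  · rw [List.length_append]; omega
  · simp only [psymList, List.map_append, List.prod_append]

theorem coeff_hsym (r : ℕ) (n : ℕ →₀ ℕ) :
    MvPowerSeries.coeff n (hsym m r : MvPowerSeries ℕ K) = if n.degree = r then 1 else 0 := rfl

/-- Newton's identity `n h_n = ∑ p_i h_{n-i}`. -/
theorem newton_hsym (n : ℕ) :
    (n : K) • hsym m n = ∑ i ∈ Finset.range n, psym m (i + 1) * hsym m (n - 1 - i) := by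
  refine Subtype.ext (MvPowerSeries.ext fun ν => ?_)
  have h1 : ((∑ i ∈ Finset.range n, psym m (i + 1) * hsym m (n - 1 - i) : R m) :
      MvPowerSeries ℕ K) =
      ∑ i ∈ Finset.range n, psumSeries K (i + 1) * (hsym m (n - 1 - i) : MvPowerSeries ℕ K) :=
    map_sum (R m).val _ _
  have h2 : ∀ i ∈ Finset.range n, ∀ j ∈ ν.support,
      (if i + 1 ≤ ν j then MvPowerSeries.coeff (ν - Finsupp.single j (i + 1))
        (hsym m (n - 1 - i) : MvPowerSeries ℕ K) else 0) =
      if ν.degree = n then (if i < ν j then 1 else 0) else 0 := by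
    intro i hi j _
    have hi := Finset.mem_range.1 hi
    by_cases h3 : i + 1 ≤ ν j
    · have h4 : (ν - Finsupp.single j (i + 1)).degree + (i + 1) = ν.degree := by
        conv_rhs => rw [← tsub_add_cancel_of_le (Finsupp.single_le_iff.2 h3), map_add,
          Finsupp.degree_single]
      rw [if_pos h3, coeff_hsym, if_pos (show i < ν j from h3)]
      congr 1
      rw [eq_iff_iff]
      omega
    · rw [if_neg h3, if_neg (show ¬ i < ν j from h3), ite_self]
  rw [h1, map_sum]
  simp only [coeff_psumSeries_mul (Nat.succ_pos _)]
  rw [Finset.sum_congr rfl fun i hi => Finset.sum_congr rfl (h2 i hi), Finset.sum_comm]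
  change (n : K) * (if ν.degree = n then 1 else 0) = _
  by_cases hd : ν.degree = n
  · simp only [if_pos hd, mul_one]
    -- The variable `x_j` contributes once for each `i < ν j`, hence `ν j` times; summing over `j`
    -- gives the degree.
    have h3 : ∀ j ∈ ν.support,
        ∑ i ∈ Finset.range n, (if i < ν j then (1 : K) else 0) = (ν j : K) := by
      intro j _
      have hle : ν j ≤ n := by
        rw [← hd]
        exact Finsupp.le_degree j ν
      rw [Finset.sum_boole]
      congr 1
      rw [show (Finset.range n).filter (· < ν j) = Finset.range (ν j) by
        ext i; simp only [Finset.mem_filter, Finset.mem_range]; omega, Finset.card_range]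
    rw [Finset.sum_congr rfl h3, ← Nat.cast_sum, ← hd]
    rfl
  · simp only [if_neg hd, mul_zero, Finset.sum_const_zero]

theorem hsym_zero : hsym m 0 = 1 := by
  classical
  refine Subtype.ext (MvPowerSeries.ext fun ν => ?_)
  rw [coeff_hsym]
  change _ = MvPowerSeries.coeff ν (1 : MvPowerSeries ℕ K)
  rw [MvPowerSeries.coeff_one]
  congr 1
  rw [eq_iff_iff, Finsupp.degree_eq_zero_iff]

/-- In Newton's identity the last summand is `p_n`, while all others are products of `p_i` with a
complete function of positive degree and so, by induction, involve at least two power sums. -/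
theorem hsym_mem_psymSpan {n : ℕ} (hn : 0 < n) :
    hsym m n ∈ psymSpan m n 1 ∧ hsym m n - (n : K)⁻¹ • psymList m [n] ∈ psymSpan m n 2 := by
  induction n using Nat.strong_induction_on with
  | _ n ih =>
    have hn0 : (n : K) ≠ 0 := Nat.cast_ne_zero.2 hn.ne'
    have hp : psymList m [n] ∈ psymSpan m n 1 :=
      psymList_mem (by simpa using hn) (by simp) (by simp)
    have h2 : hsym m n - (n : K)⁻¹ • psymList m [n] ∈ psymSpan m n 2 := by
      obtain ⟨k, rfl⟩ : ∃ k, n = k + 1 := ⟨n - 1, by omega⟩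
      have h3 := newton_hsym (m := m) (k + 1)
      rw [Finset.sum_range_succ, Nat.add_sub_cancel, Nat.sub_self, hsym_zero, mul_one] at h3
      have h4 : hsym m (k + 1) - ((k + 1 : ℕ) : K)⁻¹ • psymList m [k + 1] =
          ((k + 1 : ℕ) : K)⁻¹ • ∑ i ∈ Finset.range k, psym m (i + 1) * hsym m (k - i) := by
        rw [eq_sub_of_add_eq h3.symm, smul_sub, smul_smul, inv_mul_cancel₀ hn0, one_smul]
        simp [psymList]
      rw [h4]
      refine Submodule.smul_mem _ _ (Submodule.sum_mem _ fun i hi => ?_)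
      have hi := Finset.mem_range.1 hi
      have h5 : psym m (i + 1) ∈ psymSpan m (i + 1) 1 := by
        have := psymList_mem (m := m) (l := [i + 1]) (n := i + 1) (k := 1) (by simp) (by simp)
          (by simp)
        simpa [psymList] using this
      have h6 := psymSpan_mul h5 (ih (k - i) (by omega) (by omega)).1
      rwa [show i + 1 + (k - i) = k + 1 by omega] at h6
    refine ⟨?_, h2⟩
    have := Submodule.add_mem _ (psymSpan_mono (by omega) h2) (Submodule.smul_mem _ (n : K)⁻¹ hp)
    rwa [sub_add_cancel] at this

/-- The product of the complete symmetric functions indexed by the entries of a list. -/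
noncomputable def hsymList (m : ℕ) (l : List ℕ) : R m := (l.map (hsym m)).prod

theorem hsymList_mem_psymSpan {l : List ℕ} (hl : ∀ r ∈ l, 0 < r) :
    hsymList m l ∈ psymSpan m l.sum l.length ∧
      ∃ c : K, c ≠ 0 ∧ hsymList m l - c • psymList m l ∈ psymSpan m l.sum (l.length + 1) := by
  induction l with
  | nil =>
    refine ⟨psymList_mem (l := []) (by simp) rfl le_rfl, 1, one_ne_zero, ?_⟩
    rw [one_smul, hsymList, psymList, List.map_nil, List.map_nil, sub_self]
    exact Submodule.zero_mem _
  | cons r l ih =>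
    have hr := hl r (by simp)
    obtain ⟨h1, c, hc, h2⟩ := ih fun x hx => hl x (by simp [hx])
    obtain ⟨h3, h4⟩ := hsym_mem_psymSpan (m := m) hr
    have e1 : hsymList m (r :: l) = hsym m r * hsymList m l := by
      rw [hsymList, List.map_cons, List.prod_cons, hsymList]
    have e2 : psymList m (r :: l) = psymList m [r] * psymList m l := by
      simp [psymList]
    have h5 : psymList m l ∈ psymSpan m l.sum l.length :=
      psymList_mem (fun x hx => hl x (by simp [hx])) rfl le_rfl
    rw [List.sum_cons, List.length_cons]
    refine ⟨?_, (r : K)⁻¹ * c, mul_ne_zero (inv_ne_zero (Nat.cast_ne_zero.2 hr.ne')) hc, ?_⟩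
    · rw [e1, add_comm l.length]
      exact psymSpan_mul h3 h1
    · have e3 : hsymList m (r :: l) - ((r : K)⁻¹ * c) • psymList m (r :: l) =
          hsym m r * (hsymList m l - c • psymList m l) +
            (hsym m r - (r : K)⁻¹ • psymList m [r]) * (c • psymList m l) := by
        rw [e1, e2, mul_sub, sub_mul, smul_mul_smul_comm, mul_smul_comm]
        abel
      rw [e3]
      refine Submodule.add_mem _ ?_ ?_
      · have := psymSpan_mul h3 h2
        rwa [show 1 + (l.length + 1) = l.length + 1 + 1 by omega] at this
      · have := psymSpan_mul h4 (Submodule.smul_mem _ c h5)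
        rwa [show 2 + l.length = l.length + 1 + 1 by omega] at this

theorem length_le_sum_of_pos {l : List ℕ} (hl : ∀ r ∈ l, 0 < r) : l.length ≤ l.sum := by
  induction l with
  | nil => simp
  | cons r l ih =>
    have h1 := hl r (by simp)
    have h2 := ih fun x hx => hl x (by simp [hx])
    rw [List.length_cons, List.sum_cons]
    omega

theorem hsymList_basis :
    LinearIndependent K (fun L : MPartition m => xpow L.1 * hsymList m L.2.rowLens) ∧
      ⊤ ≤ Submodule.span K
        (Set.range fun L : MPartition m => xpow L.1 * hsymList m L.2.rowLens) := by
  let b := Module.Basis.mk (psymList_basis (m := m)).1 psymList_basis.2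
  have hb : ∀ L, b L = xpow L.1 * psymList m L.2.rowLens := fun L =>
    Module.Basis.mk_apply _ _ L
  choose c hc0 hc using fun L : MPartition m =>
    (hsymList_mem_psymSpan (m := m) L.2.pos_of_mem_rowLens).2
  refine linearIndependent_and_span_of_basis_triangular b _
    -- Terms with more parts have smaller rank. The truncated subtraction is harmless, since a
    -- partition has at most as many parts as cells.
    (fun L => L.2.card - L.2.rowLens.length) c hc0 fun L => ?_
  rw [hb, ← mul_smul_comm, ← mul_sub]
  have h := hc L
  rw [sum_rowLens] at h
  refine Submodule.span_induction (p := fun f _ => xpow L.1 * f ∈ _) ?_ ?_ ?_ ?_ h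
  · rintro _ ⟨l, h1, h2, h3, rfl⟩
    obtain ⟨lam, hlam⟩ := exists_rowLens_perm h1
    refine Submodule.subset_span ⟨(L.1, lam), ?_, ?_⟩
    · have h4 := length_le_sum_of_pos h1
      have h5 := hlam.length_eq
      have h6 := card_eq_of_rowLens_perm hlam
      simp only [Set.mem_ofPred_eq]
      omega
    · rw [hb]
      simp only [psymList, (hlam.map (psym m)).prod_eq]
  · rw [mul_zero]; exact Submodule.zero_mem _
  · intro f g _ _ hf hg
    rw [mul_add]; exact Submodule.add_mem _ hf hg
  · intro a f _ hf
    rw [mul_smul_comm]; exact Submodule.smul_mem _ _ hf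

theorem prod_map_filter_pos {M : Type*} [CommMonoid M] (f : ℕ → M) (h0 : f 0 = 1) (l : List ℕ) :
    ((l.filter (0 < ·)).map f).prod = (l.map f).prod := by
  induction l with
  | nil => rfl
  | cons r l ih =>
    rcases Nat.eq_zero_or_pos r with rfl | hr
    · simp [h0, ih]
    · simp [hr, ih]

theorem sum_map_filter_pos (f : ℕ → ℕ) (h0 : f 0 = 0) (l : List ℕ) :
    ((l.filter (0 < ·)).map f).sum = (l.map f).sum := by
  induction l with
  | nil => rfl
  | cons r l ih =>
    rcases Nat.eq_zero_or_pos r with rfl | hr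
    · simp [h0, ih]
    · simp [hr, ih]

theorem sum_sq_le_sq_sum (l : List ℕ) : (l.map (· ^ 2)).sum ≤ l.sum ^ 2 := by
  induction l with
  | nil => simp
  | cons r l ih =>
    rw [List.map_cons, List.sum_cons, List.sum_cons]
    nlinarith [Nat.zero_le (r * l.sum)]

theorem perm_eq_one_of_monotone {n : ℕ} {σ : Equiv.Perm (Fin n)} (h : Monotone σ) : σ = 1 := by
  have hs : StrictMono σ := h.strictMono_of_injective σ.injective
  let e : Fin n ≃o Fin n := hs.orderIsoOfSurjective σ σ.surjective
  have : e = OrderIso.refl _ := Subsingleton.elim _ _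
  ext i
  exact congrArg Fin.val (DFunLike.congr_fun this i)

/-- The rearrangement inequality behind the triangularity of the Jacobi–Trudi determinant. -/
theorem sum_sq_lt_of_ne_one {n : ℕ} {L : Fin n → ℤ} (hL : StrictAnti L) {σ : Equiv.Perm (Fin n)}
    (hσ : σ ≠ 1) : ∑ i, (L i + i) ^ 2 < ∑ i, (L (σ i) + i) ^ 2 := by
  have hanti : Antivary L (fun i : Fin n => ((i : ℕ) : ℤ)) := by
    intro i j hij
    exact (hL (by simpa using hij)).le
  have h1 : ∑ i, L i * ((i : ℕ) : ℤ) < ∑ i, L (σ i) * ((i : ℕ) : ℤ) := by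
    -- The sequence `L` decreases while the positions increase, so by the rearrangement inequality
    -- the identity is the unique minimiser of the mixed term; the squares are invariant under
    -- permutation.
    refine hanti.sum_mul_lt_sum_comp_perm_mul_iff.2 fun h => hσ (perm_eq_one_of_monotone ?_)
    intro i j hij
    rcases hij.eq_or_lt with rfl | hij
    · exact le_rfl
    · have := h (i := i) (j := j) (by simpa using hij)
      exact hL.le_iff_ge.1 this
  have h2 : ∑ i, L (σ i) ^ 2 = ∑ i, L i ^ 2 := Equiv.sum_comp σ fun i => L i ^ 2
  have h3 : ∀ f : Fin n → ℤ, ∑ i, (f i + i) ^ 2 =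
      ∑ i, f i ^ 2 + 2 * ∑ i, f i * ((i : ℕ) : ℤ) + ∑ i : Fin n, ((i : ℕ) : ℤ) ^ 2 := by
    intro f
    rw [Finset.mul_sum, ← Finset.sum_add_distrib, ← Finset.sum_add_distrib]
    exact Finset.sum_congr rfl fun i _ => by ring
  have h4 := h3 fun i => L (σ i)
  rw [h3, h4, h2]
  linarith

/-- The span of the `h_l` of degree `n` with sum of squares larger than `d`. -/
noncomputable def hsymSpan (m n d : ℕ) : Submodule K (R m) :=
  Submodule.span K {f | ∃ l : List ℕ, (∀ r ∈ l, 0 < r) ∧ l.sum = n ∧ d < (l.map (· ^ 2)).sum ∧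
    f = hsymList m l}

theorem list_sum_eq_sum_range (lam : YoungDiagram) (f : ℕ → ℕ) :
    (lam.rowLens.map f).sum = ∑ i : Fin (lam.colLen 0), f (lam.rowLen i) := by
  rw [YoungDiagram.rowLens, List.map_map]
  exact Finset.sum_range fun i => f (lam.rowLen i)

/-- The identity permutation contributes `h_λ` to the determinant. Any other term vanishes or is, up
to sign, a product of the `h` with indices `λ_{σ i} - σ i + i`, whose sum of squares is larger by
rearrangement, because `λ_i - i` is strictly decreasing. -/
theorem schur_sub_hsymList_mem (lam : YoungDiagram) : schur m lam - hsymList m lam.rowLens ∈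
    hsymSpan m lam.card (lam.rowLens.map (· ^ 2)).sum := by
  classical
  set n := lam.colLen 0 with hn
  have hL : StrictAnti fun i : Fin n => ((lam.rowLen i : ℤ) - i) := by
    intro i j hij
    have h1 := lam.rowLen_anti i j hij.le
    have h2 : (i : ℕ) < j := hij
    simp only
    omega
  have h1 : hsymList m lam.rowLens = ∏ i : Fin n, hsym m (lam.rowLen i) := by
    rw [hsymList, YoungDiagram.rowLens, List.map_map]
    exact Finset.prod_range fun i => hsym m (lam.rowLen i)
  have hcard : (lam.card : ℤ) = ∑ i : Fin n, (lam.rowLen i : ℤ) := by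
    have := list_sum_eq_sum_range lam id
    rw [List.map_id, sum_rowLens] at this
    rw [this]
    push_cast
    rfl
  have hsq : (((lam.rowLens.map (· ^ 2)).sum : ℕ) : ℤ) = ∑ i : Fin n, (lam.rowLen i : ℤ) ^ 2 := by
    rw [list_sum_eq_sum_range]
    push_cast
    rfl
  rw [schur, Matrix.det_apply', ← Finset.add_sum_erase _ _ (Finset.mem_univ 1)]
  rw [show ∀ x y z : R m, x + y - z = (x - z) + y by intros; abel]
  refine Submodule.add_mem _ ?_ (Submodule.sum_mem _ fun σ hσ => ?_)
  · convert! Submodule.zero_mem _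
    rw [h1, sub_eq_zero, Equiv.Perm.sign_one, Units.val_one, Int.cast_one, one_mul]
    refine Finset.prod_congr rfl fun i _ => ?_
    simp
  · have hσ1 : σ ≠ 1 := (Finset.mem_erase.1 hσ).1
    have hsign : ∀ x : R m, x ∈ hsymSpan m lam.card (lam.rowLens.map (· ^ 2)).sum →
        (((Equiv.Perm.sign σ : ℤˣ) : ℤ) : R m) * x ∈
          hsymSpan m lam.card (lam.rowLens.map (· ^ 2)).sum := by
      intro x hx
      rcases Int.units_eq_one_or (Equiv.Perm.sign σ) with h | h
      · rw [h]; simpa using hx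
      · rw [h, Units.val_neg, Units.val_one, Int.cast_neg, Int.cast_one, show (-1 : R m) * x = -x by ring]
        exact Submodule.neg_mem _ hx
    refine hsign _ ?_
    by_cases hneg : ∃ i : Fin n, (lam.rowLen (σ i) : ℤ) - (σ i : ℕ) + (i : ℕ) < 0
    · obtain ⟨i, hi⟩ := hneg
      rw [Finset.prod_eq_zero (Finset.mem_univ i)]
      · exact Submodule.zero_mem _
      · simp only [Matrix.of_apply]
        rw [if_pos hi]
    · push Not at hneg
      set e : Fin n → ℕ := fun i => ((lam.rowLen (σ i) : ℤ) - (σ i : ℕ) + (i : ℕ)).toNat with he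
      have hei : ∀ i, (e i : ℤ) = (lam.rowLen (σ i) : ℤ) - (σ i : ℕ) + (i : ℕ) := fun i =>
        Int.toNat_of_nonneg (hneg i)
      -- Indices equal to `0` can be dropped: they contribute `h_0 = 1` and nothing to the sums.
      refine Submodule.subset_span ⟨(List.ofFn e).filter (0 < ·), ?_, ?_, ?_, ?_⟩
      · intro r hr
        simpa using (List.mem_filter.1 hr).2
      · have h2 := sum_map_filter_pos id rfl (List.ofFn e)
        rw [List.map_id, List.map_id, List.sum_ofFn] at h2
        rw [h2]
        zify
        rw [hcard]
        simp only [hei]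
        rw [Finset.sum_add_distrib, Finset.sum_sub_distrib,
          Equiv.sum_comp σ fun i => (lam.rowLen i : ℤ), Equiv.sum_comp σ fun i => ((i : ℕ) : ℤ)]
        ring
      · rw [sum_map_filter_pos (· ^ 2) rfl, List.map_ofFn, List.sum_ofFn]
        rw [← Nat.cast_lt (α := ℤ), hsq]
        simp only [Function.comp_apply]
        push_cast
        simp only [hei]
        have := sum_sq_lt_of_ne_one hL hσ1
        simpa using this
      · rw [hsymList, prod_map_filter_pos (hsym m) hsym_zero, List.map_ofFn, List.prod_ofFn]
        refine Finset.prod_congr rfl fun i _ => ?_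
        simp only [Matrix.of_apply]
        rw [if_neg (not_lt.2 (hneg i))]
        rfl

theorem schur_basis :
    LinearIndependent K (fun L : MPartition m => xpow L.1 * schur m L.2) ∧
      ⊤ ≤ Submodule.span K (Set.range fun L : MPartition m => xpow L.1 * schur m L.2) := by
  let b := Module.Basis.mk (hsymList_basis (m := m)).1 hsymList_basis.2
  have hb : ∀ L, b L = xpow L.1 * hsymList m L.2.rowLens := fun L =>
    Module.Basis.mk_apply _ _ L
  refine linearIndependent_and_span_of_basis_triangular b _
    -- Larger sums of squares have smaller rank; the square of the size bounds them, so the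
    -- subtraction never truncates.
    (fun L => L.2.card ^ 2 - (L.2.rowLens.map (· ^ 2)).sum) 1 (fun _ => one_ne_zero) fun L => ?_
  rw [Pi.one_apply, one_smul, hb, ← mul_sub]
  refine Submodule.span_induction (p := fun f _ => xpow L.1 * f ∈ _) ?_ ?_ ?_ ?_
    (schur_sub_hsymList_mem L.2)
  · rintro _ ⟨l, h1, h2, h3, rfl⟩
    obtain ⟨lam, hlam⟩ := exists_rowLens_perm h1
    refine Submodule.subset_span ⟨(L.1, lam), ?_, ?_⟩
    · have h4 := sum_sq_le_sq_sum l
      have h5 := (hlam.map (· ^ 2)).sum_eq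
      have h6 := card_eq_of_rowLens_perm hlam
      rw [h2] at h4 h6
      simp only [Set.mem_ofPred_eq]
      rw [h6, h5]
      omega
    · rw [hb]
      simp only [hsymList, (hlam.map (hsym m)).prod_eq]
  · rw [mul_zero]; exact Submodule.zero_mem _
  · intro f g _ _ hf hg
    rw [mul_add]; exact Submodule.add_mem _ hf hg
  · intro a f _ hf
    rw [mul_smul_comm]; exact Submodule.smul_mem _ _ hf

theorem HL_eq_ofPoly (a : Fin m → ℕ) : HL a = ofPoly m (hlPoly a) := rfl

/-- Since `H_a` is `x^a` plus monomials strictly below in the Bruhat order, the passage from `x^a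
s_λ` to `H_a s_λ` is unitriangular for `compRank`. -/
theorem kfun_basis :
    LinearIndependent K (kfun (m := m)) ∧ ⊤ ≤ Submodule.span K (Set.range (kfun (m := m))) := by
  classical
  let b := Module.Basis.mk (schur_basis (m := m)).1 schur_basis.2
  have hb : ∀ L, b L = xpow L.1 * schur m L.2 := fun L => Module.Basis.mk_apply _ _ L
  refine linearIndependent_and_span_of_basis_triangular b _
    (fun L => compRank L.1) 1 (fun _ => one_ne_zero) fun L => ?_
  rw [Pi.one_apply, one_smul, hb, kfun, ← sub_mul, HL_eq_ofPoly, xpow, ← map_sub]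
  have h1 : hlPoly L.1 - monomial (expo L.1) 1 =
      ∑ n ∈ (hlPoly L.1).support.erase (expo L.1), coeff n (hlPoly L.1) • monomial n (1 : K) := by
    have h2 : expo L.1 ∈ (hlPoly L.1).support := by
      rw [mem_support_iff, coeff_hlPoly_self]
      exact one_ne_zero
    conv_lhs => rw [(hlPoly L.1).as_sum, ← Finset.add_sum_erase _ _ h2, coeff_hlPoly_self,
      add_sub_cancel_left]
    refine Finset.sum_congr rfl fun n _ => ?_
    rw [smul_monomial, smul_eq_mul, mul_one]
  rw [h1, map_sum, Finset.sum_mul]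
  refine Submodule.sum_mem _ fun n hn => ?_
  rw [Finset.mem_erase, mem_support_iff] at hn
  rw [map_smul, smul_mul_assoc]
  refine Submodule.smul_mem _ _ (Submodule.subset_span ⟨(⇑n, L.2), ?_, ?_⟩)
  · refine compRank_lt (reflTransGen_of_coeff_hlPoly hn.2) fun e => hn.1 ?_
    change ⇑n = L.1 at e
    rw [← e, expo_coe]
  · rw [hb, xpow, expo_coe]

/-- The basis `k_Λ` of `R_m`. -/
noncomputable def kBasis (m : ℕ) : Module.Basis (MPartition m) K (R m) :=
  Module.Basis.mk kfun_basis.1 kfun_basis.2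

theorem kBasis_apply (L : MPartition m) : kBasis m L = kfun L := Module.Basis.mk_apply _ _ L

end KBasis

/-! ## The scalar product and the adjoints of the operators `T_i` -/

section Adjoint

variable {m : ℕ}

open Classical in
theorem form_kfun (L O : MPartition m) : form m (kfun L) (kfun O) = if L = O then 1 else 0 := by
  classical
  have h : ∃ B : LinearMap.BilinForm K (R m), ∀ L O : MPartition m,
      B (kfun L) (kfun O) = if L = O then 1 else 0 := by
    refine ⟨(kBasis m).constr K fun L => (kBasis m).coord L, fun L O => ?_⟩
    rw [← kBasis_apply, ← kBasis_apply, Module.Basis.constr_basis, Module.Basis.coord_apply,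
      Module.Basis.repr_self, Finsupp.single_apply]
    exact if_congr eq_comm rfl rfl
  rw [form, dif_pos h]
  exact h.choose_spec L O

theorem form_kfun_right (f : R m) (O : MPartition m) :
    form m f (kfun O) = (kBasis m).repr f O := by
  classical
  have h : (form m).flip (kfun O) = (kBasis m).coord O := by
    refine (kBasis m).ext fun L => ?_
    rw [Module.Basis.coord_apply, Module.Basis.repr_self, kBasis_apply, Finsupp.single_apply]
    exact form_kfun L O
  exact DFunLike.congr_fun h f

theorem form_kfun_left (f : R m) (L : MPartition m) :
    form m (kfun L) f = (kBasis m).repr f L := by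
  classical
  have h : form m (kfun L) = (kBasis m).coord L := by
    refine (kBasis m).ext fun O => ?_
    rw [Module.Basis.coord_apply, Module.Basis.repr_self, kBasis_apply,
      form_kfun, Finsupp.single_apply]
    exact if_congr eq_comm rfl rfl
  exact DFunLike.congr_fun h f

theorem eq_of_form_kfun_right {f g : R m} (h : ∀ O, form m f (kfun O) = form m g (kfun O)) :
    f = g :=
  (kBasis m).ext_elem fun O => by rw [← form_kfun_right, ← form_kfun_right, h]

theorem eq_of_form_kfun_left {f g : R m} (h : ∀ L, form m (kfun L) f = form m (kfun L) g) :
    f = g :=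
  (kBasis m).ext_elem fun L => by rw [← form_kfun_left, ← form_kfun_left, h]

/-! ### The action of `T_i` on the basis `k_Λ` -/

theorem psT_spec {i j : ℕ} (hij : i ≠ j) (f : MvPowerSeries ℕ K) :
    (MvPowerSeries.X i - MvPowerSeries.X j) * psT i j f =
      (t • MvPowerSeries.X i - MvPowerSeries.X j) * psSwap i j f +
        (1 - t) • (MvPowerSeries.X j * f) := by
  have h := psQuot_spec hij f
  rw [psT, heckeOp]
  simp only [Algebra.smul_def, map_sub, map_one] at h ⊢
  linear_combination (algebraMap K (MvPowerSeries ℕ K) t * MvPowerSeries.X i - MvPowerSeries.X j) * h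

theorem psT_unique {i j : ℕ} (hij : i ≠ j) {f g : MvPowerSeries ℕ K}
    (h : (MvPowerSeries.X i - MvPowerSeries.X j) * g =
      (t • MvPowerSeries.X i - MvPowerSeries.X j) * psSwap i j f +
        (1 - t) • (MvPowerSeries.X j * f)) : psT i j f = g :=
  mul_left_cancel₀ (X_sub_X_ne_zero hij) ((psT_spec hij f).trans h.symm)

/-- Consequently `T_i` acts on `H_a s_λ` through the first factor alone. -/
theorem psT_mul_of_psSwap_eq {i j : ℕ} (hij : i ≠ j) (f : MvPowerSeries ℕ K)
    {g : MvPowerSeries ℕ K} (hg : psSwap i j g = g) : psT i j (f * g) = psT i j f * g := by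
  refine psT_unique hij ?_
  rw [← mul_assoc, psT_spec hij, map_mul, hg, add_mul, smul_mul_assoc, mul_assoc, mul_assoc]

theorem psSwap_hsym (i j r : ℕ) : psSwap i j (hsym m r : MvPowerSeries ℕ K) = hsym m r := by
  ext n
  rw [coeff_psSwap]
  change (if (n.mapDomain (Equiv.swap i j)).degree = r then (1 : K) else 0) =
    if n.degree = r then 1 else 0
  rw [Finsupp.degree_mapDomain]

theorem psSwap_schur (i j : ℕ) (lam : YoungDiagram) :
    psSwap i j (schur m lam : MvPowerSeries ℕ K) = schur m lam := by
  have h : (((psSwap i j : MvPowerSeries ℕ K →ₐ[K] MvPowerSeries ℕ K) :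
      MvPowerSeries ℕ K →+* MvPowerSeries ℕ K).comp (R m).val) (schur m lam) =
      ((R m).val : R m →+* MvPowerSeries ℕ K) (schur m lam) := by
    rw [schur, RingHom.map_det, RingHom.map_det]
    congr 1
    ext1 a b
    simp only [RingHom.mapMatrix_apply, Matrix.map_apply, Matrix.of_apply]
    split_ifs
    · rw [map_zero, map_zero]
    · exact psSwap_hsym (m := m) i j _
  exact h

theorem coe_polySwap {i j : Fin m} (f : Pol m) :
    ((rename Fin.val (polySwap i j f) : MvPolynomial ℕ K) : MvPowerSeries ℕ K) =
      psSwap i j (rename Fin.val f : MvPolynomial ℕ K) := by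
  rw [psSwap, MvPowerSeries.rename_coe, polySwap, rename_rename, rename_rename]
  congr 3
  funext x
  exact (Fin.val_injective.swap_apply i j x).symm

theorem psT_ofPoly {i : ℕ} (hi : i + 1 < m) (f : Pol m) :
    psT i (i + 1) (ofPoly m f : MvPowerSeries ℕ K) = ofPoly m (opT m i f) := by
  refine psT_unique (by omega) ?_
  have h := congrArg
    (fun g : Pol m => coeToMvPowerSeries.ringHom (rename (Fin.val : Fin m → ℕ) g))
    (dl_spec (fin_ne_succ hi) f)
  rw [← opT_of_lt hi] at h
  simp only [map_mul, map_sub, map_add, map_one, rename_X, rename_C,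
    coeToMvPowerSeries.ringHom_apply, coe_polySwap, MvPolynomial.coe_X, MvPolynomial.coe_C] at h
  rw [coe_ofPoly, coe_ofPoly, h, MvPowerSeries.smul_eq_C_mul, MvPowerSeries.smul_eq_C_mul, map_sub,
    map_one]

/-- The coefficient of `H_a` in `T_i H_a`. -/
noncomputable def heckeDiag (i : ℕ) (hi : i + 1 < m) (a : Fin m → ℕ) : K :=
  if a ⟨i, by omega⟩ < a ⟨i + 1, hi⟩ then t - 1
  else if a ⟨i, by omega⟩ = a ⟨i + 1, hi⟩ then t else 0

/-- The coefficient of `H_{s_i a}` in `T_i H_a`, for `a ≠ s_i a`. -/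
noncomputable def heckeOff (i : ℕ) (hi : i + 1 < m) (a : Fin m → ℕ) : K :=
  if a ⟨i, by omega⟩ < a ⟨i + 1, hi⟩ then t
  else if a ⟨i, by omega⟩ = a ⟨i + 1, hi⟩ then 0 else 1

theorem opT_hlPoly {i : ℕ} (hi : i + 1 < m) (a : Fin m → ℕ) : opT m i (hlPoly a) =
    heckeDiag i hi a • hlPoly a + heckeOff i hi a • hlPoly (swapEntries a i hi) := by
  rw [heckeDiag, heckeOff]
  split_ifs with h1 h2
  · exact opT_hlPoly_of_lt a hi h1
  · rw [opT_hlPoly_of_eq a hi h2, zero_smul, add_zero]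
  · rw [opT_hlPoly_of_gt a hi (by omega), zero_smul, zero_add, one_smul]

theorem heckeT_kfun {i : ℕ} (hi : i + 1 < m) (L : MPartition m) : heckeT i hi (kfun L) =
    heckeDiag i hi L.1 • kfun L + heckeOff i hi L.1 • kfun (swapEntries L.1 i hi, L.2) := by
  have h1 : heckeT i hi (kfun L) = ofPoly m (opT m i (hlPoly L.1)) * schur m L.2 := by
    refine Subtype.ext ?_
    change psT i (i + 1) ((ofPoly m (hlPoly L.1) : MvPowerSeries ℕ K) * schur m L.2) = _
    rw [psT_mul_of_psSwap_eq (by omega) _ (psSwap_schur _ _ _), psT_ofPoly hi]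
    rfl
  rw [h1, opT_hlPoly hi, map_add, map_smul, map_smul, add_mul, smul_mul_assoc, smul_mul_assoc]
  rfl

/-- In an orthonormal basis the adjoint is the transposed matrix. The only possible off-diagonal
entry in the row of `O` comes from the exchanged composition, hence `heckeOff` is evaluated there.
-/
theorem form_heckeT_kfun {i : ℕ} (hi : i + 1 < m) (L O : MPartition m) :
    form m (heckeT i hi (kfun L)) (kfun O) = form m (kfun L) (heckeDiag i hi O.1 • kfun O +
      heckeOff i hi (swapEntries O.1 i hi) • kfun (swapEntries O.1 i hi, O.2)) := by
  simp only [heckeT_kfun, map_add, map_smul, LinearMap.add_apply, LinearMap.smul_apply, form_kfun,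
    smul_eq_mul]
  congr 1
  · split_ifs with h
    · rw [h]
    · rw [mul_zero, mul_zero]
  · by_cases h : (swapEntries L.1 i hi, L.2) = O
    · subst h
      simp only [swapEntries_swapEntries, if_true]
    · rw [if_neg h, if_neg, mul_zero, mul_zero]
      rintro rfl
      simp [swapEntries_swapEntries] at h

theorem form_heckeTstar {i : ℕ} (hi : i + 1 < m) (f g : R m) :
    form m (heckeT i hi f) g = form m f (heckeTstar i hi g) := by
  have h : ∃ S : R m →ₗ[K] R m, ∀ f g : R m, form m (heckeT i hi f) g = form m f (S g) := by
    let S : R m →ₗ[K] R m := (kBasis m).constr K fun O => heckeDiag i hi O.1 • kfun O +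
      heckeOff i hi (swapEntries O.1 i hi) • kfun (swapEntries O.1 i hi, O.2)
    refine ⟨S, fun f g => ?_⟩
    have h : (form m).comp (heckeT i hi) LinearMap.id = (form m).comp LinearMap.id S := by
      refine LinearMap.BilinForm.ext_basis (kBasis m) fun L O => ?_
      rw [LinearMap.BilinForm.comp_apply, LinearMap.BilinForm.comp_apply, LinearMap.id_apply,
        LinearMap.id_apply, Module.Basis.constr_basis, kBasis_apply, kBasis_apply,
        form_heckeT_kfun]
    exact DFunLike.congr_fun (DFunLike.congr_fun h f) g
  rw [heckeTstar, dif_pos h]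
  exact h.choose_spec f g

theorem heckeTstar_kfun {i : ℕ} (hi : i + 1 < m) (O : MPartition m) :
    heckeTstar i hi (kfun O) = heckeDiag i hi O.1 • kfun O +
      heckeOff i hi (swapEntries O.1 i hi) • kfun (swapEntries O.1 i hi, O.2) :=
  eq_of_form_kfun_left fun L => by rw [← form_heckeTstar, form_heckeT_kfun]

end Adjoint

/-! ## The tableaux of `𝒮_{ΛΩ}` for dominant `Λ` -/

section Charge

variable {m : ℕ}

/-- When the letters increase weakly in the order of reading, each next letter lies ahead of the
current position. The search never returns to the beginning of the word, and the label remains `0`.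
-/
theorem chargeRound_of_sorted (n : ℕ) : ∀ (r : ℕ) (pre post : List ℕ),
    (pre ++ post).Pairwise (· ≤ ·) → (∀ x ∈ pre, x < r) →
      (chargeRound n r 0 pre post).1 = 0 ∧
        (chargeRound n r 0 pre post).2.Sublist (pre ++ post) := by
  induction n with
  | zero => exact fun r pre post _ _ => ⟨rfl, List.Sublist.refl _⟩
  | succ n ih =>
    intro r pre post hs hpre
    rw [chargeRound]
    split_ifs with h1 h2
    · have h3 : (pre ++ post.takeWhile (· ≠ r) ++ (post.dropWhile (· ≠ r)).tail).Sublist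
          (pre ++ post) := by
        conv_rhs => rw [← List.takeWhile_append_dropWhile (p := (· ≠ r)) (l := post),
          ← List.append_assoc]
        exact (List.Sublist.refl _).append (List.tail_sublist _)
      have h4 := ih (r + 1) (pre ++ post.takeWhile (· ≠ r)) (post.dropWhile (· ≠ r)).tail
        (hs.sublist h3) ?_
      · exact ⟨(zero_add _).trans h4.1, h4.2.trans h3⟩
      · intro x hx
        rcases List.mem_append.1 hx with hx | hx
        · exact (hpre x hx).trans r.lt_succ_self
        · have h5 := (List.pairwise_append.1 hs).2.1
          rw [← List.takeWhile_append_dropWhile (p := (· ≠ r)) (l := post)] at h5 h1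
          have h6 : r ∈ post.dropWhile (· ≠ r) := by
            refine (List.mem_append.1 h1).resolve_left fun h => ?_
            simpa using List.mem_takeWhile_imp h
          exact Nat.lt_succ_of_le ((List.pairwise_append.1 h5).2.2 x hx r h6)
    -- The wrap-around branch: letters already passed are smaller than `r`.
    · exact absurd (hpre r h2) (lt_irrefl r)
    · exact ⟨rfl, List.Sublist.refl _⟩

theorem chargeRounds_of_sorted (n : ℕ) : ∀ w : List ℕ, w.Pairwise (· ≤ ·) →
    chargeRounds n w = 0 := by
  induction n with
  | zero => exact fun _ _ => rfl
  | succ n ih =>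
    intro w hw
    have h := chargeRound_of_sorted w.length 1 [] w hw (by simp)
    rw [chargeRounds]
    simp only [h.1, ih _ (hw.sublist h.2)]

theorem makeDominant_of_antitone {w : List ℕ} (n : ℕ)
    (h : ∀ v, 1 ≤ v → v < m → w.count (v + 1) ≤ w.count v) : makeDominant m n w = w := by
  cases n with
  | zero => rfl
  | succ n =>
    rw [makeDominant]
    have h1 : (List.range' 1 (m - 1)).find? (fun a => w.count a < w.count (a + 1)) = none := by
      rw [List.find?_eq_none]
      intro v hv
      rw [List.mem_range'_1] at hv
      have := h v hv.1 (by omega)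
      simpa using this
    rw [h1]

theorem count_uWord (a : Fin m → ℕ) (i : Fin m) :
    (uWord a).count (m - (i : ℕ)) = a ⟨0, i.pos⟩ - a i := by
  rw [uWord, List.count_flatMap, ← Fin.sum_univ_def, Finset.sum_eq_single i]
  · simp
  · intro j _ hj
    rw [Function.comp_apply, List.count_eq_zero]
    intro h
    have h1 := List.eq_of_mem_replicate h
    exact hj (Fin.ext (by omega))
  · simp

/-- The letter `m - i` occurs `a_0 - a_i` times, so for dominant `a` the evaluation is already
dominant, and the word read from right to left is weakly increasing. -/
theorem charge_uWord {a : Fin m → ℕ} (ha : Antitone a) : charge m (uWord a) = 0 := by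
  rw [charge, makeDominant_of_antitone, chargeRounds_of_sorted]
  · rw [List.pairwise_reverse, uWord, List.pairwise_flatMap]
    refine ⟨fun i _ => List.pairwise_replicate.2 (Or.inr le_rfl),
      (List.pairwise_lt_finRange m).imp fun {i j} hij x hx y hy => ?_⟩
    rw [List.eq_of_mem_replicate hx, List.eq_of_mem_replicate hy]
    have : (i : ℕ) < j := hij
    omega
  · intro v hv hvm
    have h1 := count_uWord a ⟨m - v, by omega⟩
    have h2 := count_uWord a ⟨m - v - 1, by omega⟩
    have h3 : a ⟨m - v, by omega⟩ ≤ a ⟨m - v - 1, by omega⟩ := ha (by simp [Fin.le_def])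
    rw [show m - (m - v) = v by omega] at h1
    rw [show m - (m - v - 1) = v + 1 by omega] at h2
    rw [h1, h2]
    exact Nat.sub_le_sub_left h3 _

theorem barWord_self (L : MPartition m) (T : Filling m (cup L.1 L.2) L.2) : barWord L L T = [] := by
  rw [barWord]
  simp

theorem inv_of_antitone {a : Fin m → ℕ} (ha : Antitone a) : inv a = 0 := by
  rw [inv, Finset.card_eq_zero, Finset.filter_eq_empty_iff]
  rintro ⟨i, j⟩ - ⟨h1, h2⟩
  exact absurd (ha h1.le) (not_le.2 h2)

theorem tableauCharge_self {L : MPartition m} (hL : Antitone L.1)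
    (T : Filling m (cup L.1 L.2) L.2) : tableauCharge L L T = 0 := by
  rw [tableauCharge, inv_of_antitone hL, barWord_self, List.nil_append, charge_uWord hL]

end Charge

/-! ### Column lengths and size of the partition `a ∪ λ` -/

section Cup

variable {m : ℕ}

/-- In a weakly decreasing list the entries larger than `c` form an initial segment. -/
theorem lt_countP_iff {w : List ℕ} (hw : w.Pairwise (· ≥ ·)) (c : ℕ) : ∀ i : ℕ,
    i < w.countP (c < ·) ↔ ∃ h : i < w.length, c < w[i] := by
  induction w with
  | nil => simp
  | cons x w ih =>
    rw [List.pairwise_cons] at hw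
    intro i
    by_cases hx : c < x
    · rw [List.countP_cons_of_pos (by simpa using hx)]
      cases i with
      | zero => simp [hx]
      | succ i => simpa using ih hw.2 i
    · have h0 : (x :: w).countP (c < ·) = 0 := by
        rw [List.countP_eq_zero]
        intro y hy
        rcases List.mem_cons.1 hy with rfl | hy
        · simpa using hx
        · have := hw.1 y hy
          simp only [decide_eq_true_eq]
          omega
      rw [h0]
      refine iff_of_false (Nat.not_lt_zero i) ?_
      rintro ⟨h, hc⟩
      have := List.countP_eq_zero.1 h0 _ (List.getElem_mem h)
      simp [hc] at this

theorem colLen_ofRowLens (w : List ℕ) (hw : w.SortedGE) (c : ℕ) :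
    (YoungDiagram.ofRowLens w hw).colLen c = w.countP (c < ·) := by
  refine eq_of_forall_lt_iff fun i => ?_
  rw [← YoungDiagram.mem_iff_lt_colLen, YoungDiagram.mem_ofRowLens, lt_countP_iff hw.pairwise]

/-- The number of entries of `a` larger than `c`. -/
def headColLen (a : Fin m → ℕ) (c : ℕ) : ℕ := (Finset.univ.filter fun i => c < a i).card

/-- A column length counts the parts larger than `c`, which is additive under union of multisets and
insensitive to sorting. -/
theorem colLen_cup (a : Fin m → ℕ) (lam : YoungDiagram) (c : ℕ) :
    (cup a lam).colLen c = headColLen a c + lam.colLen c := by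
  rw [cup, colLen_ofRowLens, ← Multiset.coe_countP, Multiset.sort_eq, Multiset.countP_add,
    Multiset.coe_countP, Multiset.countP_map, headColLen]
  congr 1
  rw [← colLen_ofRowLens _ lam.rowLens_sorted, YoungDiagram.ofRowLens_to_rowLens_eq_self]

theorem card_eq_sum_colLen {lam : YoungDiagram} {n : ℕ} (hn : ∀ c, c ∈ lam → c.2 < n) :
    lam.card = ∑ c ∈ Finset.range n, lam.colLen c := by
  rw [YoungDiagram.card, Finset.card_eq_sum_card_fiberwise (f := Prod.snd) (t := Finset.range n)]
  · exact Finset.sum_congr rfl fun c _ => (lam.colLen_eq_card).symm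
  · intro c hc
    exact Finset.mem_coe.2 (Finset.mem_range.2 (hn c hc))

theorem eq_of_colLen_eq {lam mu : YoungDiagram} (h : ∀ c, lam.colLen c = mu.colLen c) :
    lam = mu := by
  ext ⟨r, c⟩
  rw [YoungDiagram.mem_cells, YoungDiagram.mem_cells, YoungDiagram.mem_iff_lt_colLen,
    YoungDiagram.mem_iff_lt_colLen, h]

theorem sum_headColLen {a : Fin m → ℕ} {n : ℕ} (hn : ∀ i, a i ≤ n) :
    ∑ c ∈ Finset.range n, headColLen a c = ∑ i, a i := by
  simp only [headColLen, Finset.card_filter]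
  rw [Finset.sum_comm]
  refine Finset.sum_congr rfl fun i _ => ?_
  rw [← Finset.card_filter]
  have : (Finset.range n).filter (· < a i) = Finset.range (a i) := by
    ext c
    have := hn i
    simp only [Finset.mem_filter, Finset.mem_range]
    omega
  rw [this, Finset.card_range]

theorem headColLen_pos {a : Fin m → ℕ} {c : ℕ} {i : Fin m} (h : c < a i) : 0 < headColLen a c :=
  Finset.card_pos.2 ⟨i, by simpa using h⟩

theorem le_cup (a : Fin m → ℕ) (lam : YoungDiagram) : lam ≤ cup a lam := by
  rintro ⟨r, c⟩ h
  have h : (r, c) ∈ lam := h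
  change (r, c) ∈ cup a lam
  rw [YoungDiagram.mem_iff_lt_colLen] at h ⊢
  rw [colLen_cup]
  omega

theorem card_cup (a : Fin m → ℕ) (lam : YoungDiagram) :
    (cup a lam).card = ∑ i, a i + lam.card := by
  set n := (cup a lam).rowLen 0 with hn
  have h1 : ∀ c, c ∈ cup a lam → c.2 < n := fun c hc =>
    YoungDiagram.mem_iff_lt_rowLen.1 ((cup a lam).up_left_mem (Nat.zero_le c.1) le_rfl hc)
  have h2 : ∀ i, a i ≤ n := fun i => by
    by_contra h
    have h3 := headColLen_pos (not_le.1 h)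
    have h4 : (0, n) ∈ cup a lam := by
      rw [YoungDiagram.mem_iff_lt_colLen, colLen_cup]
      omega
    exact lt_irrefl _ (h1 _ h4)
  rw [card_eq_sum_colLen h1, card_eq_sum_colLen fun c hc => h1 c (le_cup a lam hc),
    ← sum_headColLen h2, ← Finset.sum_add_distrib]
  exact Finset.sum_congr rfl fun c _ => colLen_cup a lam c

theorem lt_headColLen_iff {a : Fin m → ℕ} (ha : Antitone a) (c : ℕ) (i : Fin m) :
    (i : ℕ) < headColLen a c ↔ c < a i := by
  constructor
  · intro h
    by_contra hc
    have h1 : (Finset.univ.filter fun j => c < a j) ⊆ Finset.Iio i := by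
      intro j hj
      rw [Finset.mem_filter] at hj
      rw [Finset.mem_Iio]
      by_contra hij
      exact hc (hj.2.trans_le (ha (not_lt.1 hij)))
    have h2 := Finset.card_le_card h1
    rw [Fin.card_Iio] at h2
    rw [headColLen] at h
    omega
  · intro h
    have h1 : Finset.Iic i ⊆ Finset.univ.filter fun j => c < a j := by
      intro j hj
      exact Finset.mem_filter.2 ⟨Finset.mem_univ j, h.trans_le (ha (Finset.mem_Iic.1 hj))⟩
    have h2 := Finset.card_le_card h1
    rw [Fin.card_Iic] at h2
    exact h2

theorem headColLen_le (a : Fin m → ℕ) (c : ℕ) : headColLen a c ≤ m :=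
  (Finset.card_le_univ _).trans_eq (Fintype.card_fin m)

end Cup

/-! ### Tableaux in `𝒮_{ΛΩ}`: triangularity and the diagonal coefficient -/

section Tableaux

variable {m : ℕ} {L O : MPartition m} {T : Filling m (cup L.1 L.2) O.2}

/-- Column strictness allows each letter at most once in a column. -/
theorem IsTableau.injOn_snd (hT : IsTableau L O T) (i : Fin m) :
    Set.InjOn (fun c : {c // c ∈ (cup L.1 L.2).cells \ O.2.cells} => c.1.2) {c | T c = i} := by
  intro c hc d hd hcd
  have hc : T c = i := hc
  have hd : T d = i := hd
  refine Subtype.ext (Prod.ext ?_ hcd)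
  rcases lt_trichotomy c.1.1 d.1.1 with h | h | h
  · exact absurd (hT.col_strict c d hcd h) (by rw [hc, hd]; exact lt_irrefl _)
  · exact h
  · exact absurd (hT.col_strict d c hcd.symm h) (by rw [hc, hd]; exact lt_irrefl _)

theorem IsTableau.image_subset (hT : IsTableau L O T) (i : Fin m) :
    (Finset.univ.filter fun c => T c = i).image (fun c => c.1.2) ⊆ Finset.range (L.1 i) := by
  intro x hx
  obtain ⟨c, hc, rfl⟩ := Finset.mem_image.1 hx
  rw [Finset.mem_range, ← (Finset.mem_filter.1 hc).2]
  exact hT.columns c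

theorem IsTableau.card_image (hT : IsTableau L O T) (i : Fin m) :
    ((Finset.univ.filter fun c => T c = i).image (fun c => c.1.2)).card = O.1 i := by
  rw [Finset.card_image_of_injOn, hT.count]
  intro c hc d hd
  exact hT.injOn_snd i (by simpa using hc) (by simpa using hd)

theorem IsTableau.le (hT : IsTableau L O T) (i : Fin m) : O.1 i ≤ L.1 i := by
  rw [← hT.card_image i, ← Finset.card_range (L.1 i)]
  exact Finset.card_le_card (hT.image_subset i)

theorem IsTableau.psize_eq (hT : IsTableau L O T) : psize O = psize L := by
  have h1 : ∑ i, O.1 i = ((cup L.1 L.2).cells \ O.2.cells).card := by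
    rw [← Fintype.card_coe, ← Finset.card_univ,
      Finset.card_eq_sum_card_fiberwise (f := T) (t := Finset.univ) (fun _ _ => Finset.mem_univ _)]
    exact Finset.sum_congr rfl fun i _ => (hT.count i).symm
  have h2 := Finset.card_sdiff_add_card_eq_card (YoungDiagram.cells_subset_iff.2 hT.shape)
  have h3 := card_cup L.1 L.2
  rw [psize, psize]
  rw [YoungDiagram.card] at h3
  rw [YoungDiagram.card, YoungDiagram.card] at *
  omega

/-- The number of cells in column `c` of a skew diagram. -/
theorem card_filter_snd (al be : YoungDiagram) (c : ℕ) :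
    ((al.cells \ be.cells).filter fun d => d.2 = c).card = al.colLen c - be.colLen c := by
  have h1 : (al.cells \ be.cells).filter (fun d => d.2 = c) =
      (Finset.Ico (be.colLen c) (al.colLen c)).image fun r => (r, c) := by
    ext ⟨r, x⟩
    simp only [Finset.mem_filter, Finset.mem_sdiff, YoungDiagram.mem_cells,
      YoungDiagram.mem_iff_lt_colLen, Finset.mem_image, Finset.mem_Ico, Prod.mk.injEq]
    constructor
    · rintro ⟨⟨h1, h2⟩, rfl⟩
      exact ⟨r, ⟨by omega, h1⟩, rfl, rfl⟩
    · rintro ⟨r, ⟨h1, h2⟩, rfl, rfl⟩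
      exact ⟨⟨h2, by omega⟩, rfl⟩
  rw [h1, Finset.card_image_of_injective _ (Prod.mk_left_injective c), Nat.card_Ico]

theorem colLen_mono {al be : YoungDiagram} (h : be ≤ al) (c : ℕ) : be.colLen c ≤ al.colLen c := by
  refine le_of_forall_lt fun r hr => ?_
  rw [← YoungDiagram.mem_iff_lt_colLen] at hr ⊢
  exact h hr

/-- Since the total size is conserved, having no more cells in `μ` means having no smaller sum of
the `b_i`; with `b_i ≤ a_i` this gives `b = a`. Every column `c` then contains exactly the letters
`i` with `c < a_i`, which fixes the column lengths of `μ`. -/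
theorem IsTableau.eq_of_card_le (hT : IsTableau L O T) (h : O.2.card ≤ L.2.card) : O = L := by
  have h1 := hT.psize_eq
  rw [psize, psize] at h1
  have h2 : ∀ i, O.1 i = L.1 i := by
    intro i
    by_contra hne
    have := Finset.sum_lt_sum (s := Finset.univ) (f := O.1) (g := L.1) (fun i _ => hT.le i)
      ⟨i, Finset.mem_univ i, lt_of_le_of_ne (hT.le i) hne⟩
    omega
  -- The letter `i` occupies `a_i` different columns among the first `a_i`, hence all of them.
  have h3 : ∀ i c, c < L.1 i → ∃ d, T d = i ∧ d.1.2 = c := by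
    intro i c hc
    have h4 := Finset.eq_of_subset_of_card_le (hT.image_subset i)
      (by rw [hT.card_image, Finset.card_range, h2])
    rw [← Finset.mem_range, ← h4, Finset.mem_image] at hc
    obtain ⟨d, hd, hd2⟩ := hc
    exact ⟨d, (Finset.mem_filter.1 hd).2, hd2⟩
  refine Prod.ext (funext h2) (eq_of_colLen_eq fun c => ?_)
  have h5 : (cup L.1 L.2).colLen c - O.2.colLen c = headColLen L.1 c := by
    rw [← card_filter_snd, headColLen, ← Finset.card_attach]
    refine Finset.card_bij (fun d _ => T ⟨d.1, (Finset.mem_filter.1 d.2).1⟩) ?_ ?_ ?_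
    · intro d _
      rw [Finset.mem_filter]
      refine ⟨Finset.mem_univ _, ?_⟩
      conv_lhs => rw [← (Finset.mem_filter.1 d.2).2]
      exact hT.columns ⟨d.1, _⟩
    · intro d _ e _ hde
      have h7 : (⟨d.1, (Finset.mem_filter.1 d.2).1⟩ :
          {c // c ∈ (cup L.1 L.2).cells \ O.2.cells}) ∈ {c | T c =
            T ⟨e.1, (Finset.mem_filter.1 e.2).1⟩} := hde
      have h8 := hT.injOn_snd _ h7 (by rfl)
        ((Finset.mem_filter.1 d.2).2.trans (Finset.mem_filter.1 e.2).2.symm)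
      exact Subtype.ext (Subtype.mk.inj h8)
    · intro i hi
      obtain ⟨d, hd, hdc⟩ := h3 i c (Finset.mem_filter.1 hi).2
      exact ⟨⟨d.1, Finset.mem_filter.2 ⟨d.2, hdc⟩⟩, Finset.mem_attach _ _, hd⟩
  have h6 := colLen_mono hT.shape c
  rw [colLen_cup] at h5 h6
  omega

theorem colLen_le_of_mem {d : ℕ × ℕ} {a : Fin m → ℕ} {lam : YoungDiagram}
    (hd : d ∈ (cup a lam).cells \ lam.cells) :
    lam.colLen d.2 ≤ d.1 ∧ d.1 < headColLen a d.2 + lam.colLen d.2 := by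
  obtain ⟨r, c⟩ := d
  rw [Finset.mem_sdiff, YoungDiagram.mem_cells, YoungDiagram.mem_cells,
    YoungDiagram.mem_iff_lt_colLen, YoungDiagram.mem_iff_lt_colLen, colLen_cup] at hd
  simp only
  omega

/-- The tableau of shape `(a ∪ λ)/λ` whose columns are filled with `1, 2, …`. -/
def superTableau (L : MPartition m) : Filling m (cup L.1 L.2) L.2 := fun d =>
  ⟨d.1.1 - L.2.colLen d.1.2, by
    have h1 := colLen_le_of_mem d.2
    have h2 := headColLen_le L.1 d.1.2
    omega⟩

theorem isTableau_superTableau (hL : Antitone L.1) : IsTableau L L (superTableau L) where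
  shape := le_cup _ _
  row_weak c d h1 h2 := by
    have h3 := L.2.colLen_anti c.1.2 d.1.2 h2.le
    simp only [superTableau, Fin.mk_le_mk]
    omega
  col_strict c d h1 h2 := by
    have h3 := colLen_le_of_mem c.2
    have h4 := colLen_le_of_mem d.2
    simp only [superTableau, Fin.mk_lt_mk]
    rw [h1] at *
    omega
  columns c := by
    rw [← lt_headColLen_iff hL]
    have h3 := colLen_le_of_mem c.2
    simp only [superTableau]
    omega
  count i := by
    rw [← Finset.card_range (L.1 i)]
    refine Finset.card_bij (fun c _ => c.1.2) ?_ ?_ ?_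
    · intro c hc
      rw [Finset.mem_range, ← lt_headColLen_iff hL, ← (Finset.mem_filter.1 hc).2]
      have h3 := colLen_le_of_mem c.2
      simp only [superTableau]
      omega
    · intro c hc d hd hcd
      have h3 := colLen_le_of_mem c.2
      have h4 := colLen_le_of_mem d.2
      have h5 := congrArg Fin.val
        ((Finset.mem_filter.1 hc).2.trans (Finset.mem_filter.1 hd).2.symm)
      simp only [superTableau] at h5
      have hcd : c.1.2 = d.1.2 := hcd
      rw [hcd] at h3 h5
      exact Subtype.ext (Prod.ext (by omega) hcd)
    · intro c hc
      rw [Finset.mem_range, ← lt_headColLen_iff hL] at hc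
      refine ⟨⟨(i + L.2.colLen c, c), ?_⟩, ?_, rfl⟩
      · rw [Finset.mem_sdiff, YoungDiagram.mem_cells, YoungDiagram.mem_cells,
          YoungDiagram.mem_iff_lt_colLen, YoungDiagram.mem_iff_lt_colLen, colLen_cup]
        omega
      · rw [Finset.mem_filter]
        exact ⟨Finset.mem_univ _, Fin.ext (Nat.add_sub_cancel _ _)⟩

theorem strictMono_fin_eq {n : ℕ} {f : Fin n → Fin n} (hf : StrictMono f) (i : Fin n) : f i = i :=
  congrFun ((hf.range_inj strictMono_id).1 (by
    rw [(Finite.injective_iff_surjective.1 hf.injective).range_eq, Set.range_id])) i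

/-- Column `c` has `headColLen L.1 c` cells, and for dominant `a` the letters allowed in it are the
first `headColLen L.1 c` ones; a strictly increasing filling leaves no choice. -/
theorem IsTableau.eq_superTableau (hL : Antitone L.1) {T : Filling m (cup L.1 L.2) L.2}
    (hT : IsTableau L L T) : T = superTableau L := by
  funext d
  obtain ⟨⟨r, c⟩, hd⟩ := d
  have h1 := colLen_le_of_mem hd
  simp only at h1
  have hmem : ∀ s : Fin (headColLen L.1 c),
      ((s : ℕ) + L.2.colLen c, c) ∈ (cup L.1 L.2).cells \ L.2.cells := by
    intro s
    have := s.isLt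
    rw [Finset.mem_sdiff, YoungDiagram.mem_cells, YoungDiagram.mem_cells,
      YoungDiagram.mem_iff_lt_colLen, YoungDiagram.mem_iff_lt_colLen, colLen_cup]
    omega
  let f : Fin (headColLen L.1 c) → Fin (headColLen L.1 c) := fun s =>
    ⟨T ⟨_, hmem s⟩, (lt_headColLen_iff hL c _).2 (hT.columns ⟨_, hmem s⟩)⟩
  have hf : StrictMono f := fun s s' hs => hT.col_strict ⟨_, hmem s⟩ ⟨_, hmem s'⟩ rfl
    (Nat.add_lt_add_right hs _)
  have h2 := congrArg Fin.val (strictMono_fin_eq hf ⟨r - L.2.colLen c, by omega⟩)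
  refine Fin.ext ?_
  simp only [f, Nat.sub_add_cancel h1.1] at h2
  exact h2

theorem Ddom_self (hL : Antitone L.1) : Ddom L L = 1 := by
  classical
  rw [Ddom, Finset.sum_eq_single (superTableau L), tableauCharge_self hL, pow_zero]
  · intro T hT hne
    exact absurd ((Finset.mem_filter.1 hT).2.eq_superTableau hL) hne
  · intro h
    exact absurd (Finset.mem_filter.2 ⟨Finset.mem_univ _, isTableau_superTableau hL⟩) h

theorem psize_eq_of_Ddom_ne_zero (h : Ddom L O ≠ 0) :
    psize O = psize L ∧ (O ≠ L → L.2.card < O.2.card) := by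
  classical
  obtain ⟨T, hT, -⟩ := Finset.exists_ne_zero_of_sum_ne_zero h
  have hT := (Finset.mem_filter.1 hT).2
  exact ⟨hT.psize_eq, fun hne => not_le.1 fun hle => hne (hT.eq_of_card_le hle)⟩

end Tableaux

/-! ## The dual `m`-symmetric Schur functions -/

section Dual

variable {m : ℕ}

/-- The span of the `k_Ω` of degree `p` for which `μ` has more than `d` cells. -/
noncomputable def upperSpan (m p d : ℕ) : Submodule K (R m) :=
  Submodule.span K {f | ∃ O : MPartition m, psize O = p ∧ d < O.2.card ∧ f = kfun O}

theorem heckeTstar_mem_upperSpan {i : ℕ} (hi : i + 1 < m) {p d : ℕ} {f : R m}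
    (hf : f ∈ upperSpan m p d) : heckeTstar i hi f ∈ upperSpan m p d := by
  refine Submodule.span_induction (p := fun f _ => heckeTstar i hi f ∈ upperSpan m p d)
    ?_ ?_ ?_ ?_ hf
  · rintro _ ⟨O, h1, h2, rfl⟩
    rw [heckeTstar_kfun]
    refine Submodule.add_mem _
      (Submodule.smul_mem _ _ (Submodule.subset_span ⟨O, h1, h2, rfl⟩))
      (Submodule.smul_mem _ _ (Submodule.subset_span ⟨(swapEntries O.1 i hi, O.2), ?_, h2, rfl⟩))
    rw [← h1, psize, psize, sum_swapEntries]
  · rw [map_zero]; exact Submodule.zero_mem _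
  · intro f g _ _ hf hg
    rw [map_add]; exact Submodule.add_mem _ hf hg
  · intro c f _ hf
    rw [map_smul]; exact Submodule.smul_mem _ _ hf

/-- At a descent the diagonal coefficient vanishes, and the other one, transposed, is the
coefficient `t` of the ascent. It is cancelled by the `t⁻¹` in the definition of `sdual`. -/
theorem heckeTstar_kfun_swapEntries {i : ℕ} (hi : i + 1 < m) {L : MPartition m}
    (h : L.1 ⟨i, by omega⟩ < L.1 ⟨i + 1, hi⟩) :
    heckeTstar i hi (kfun (swapEntries L.1 i hi, L.2)) = t • kfun L := by
  rw [heckeTstar_kfun, heckeDiag, heckeOff]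
  simp only [swapEntries_left, swapEntries_right, swapEntries_swapEntries]
  rw [if_neg h.not_gt, if_neg h.ne', if_pos h, zero_smul, zero_add]

theorem antitone_of_not_isAscent {a : Fin m → ℕ} (h : ¬ ∃ i, IsAscent a i) : Antitone a := by
  cases m with
  | zero => exact fun i => i.elim0
  | succ n =>
    refine Fin.antitone_iff_succ_le.2 fun i => not_lt.1 fun hlt => h ⟨i, ?_, hlt⟩
    exact Nat.succ_lt_succ i.isLt

/-- The key triangularity. In the dominant case it comes from the tableaux; it then propagates along
ascents, because `T_i^*` preserves `upperSpan` and sends leading term to leading term. -/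
theorem sdual_sub_kfun_mem (L : MPartition m) :
    sdual L - kfun L ∈ upperSpan m (psize L) L.2.card := by
  obtain ⟨n, hn⟩ : ∃ n, n = ∑ j : Fin m, (j : ℕ) * L.1 j := ⟨_, rfl⟩
  induction n using Nat.strong_induction_on generalizing L with
  | _ n ih =>
    classical
    rw [sdual]
    split_ifs with h
    · obtain ⟨hi, hlt⟩ := Nat.find_spec h
      have h1 := ih _ (hn ▸ swapEntries_lt _ _ hi hlt) (swapEntries L.1 (Nat.find h) hi, L.2) rfl
      have h2 : psize (swapEntries L.1 (Nat.find h) hi, L.2) = psize L := by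
        rw [psize, psize, sum_swapEntries]
      rw [h2] at h1
      have h3 := Submodule.smul_mem _ t⁻¹ (heckeTstar_mem_upperSpan hi h1)
      rw [map_sub, heckeTstar_kfun_swapEntries hi hlt, smul_sub, smul_smul,
        inv_mul_cancel₀ t_ne_zero, one_smul] at h3
      exact h3
    · have ha := antitone_of_not_isAscent h
      -- Tableaux conserve the size, so the sum over all `m`-partitions is finite and the `finsum`
      -- does not take its default value.
      have hfin : (Function.support fun O => Ddom L O • kfun O).Finite := by
        refine (finite_setOf_psize_le (psize L)).subset fun O hO => ?_
        have h1 : Ddom L O ≠ 0 := fun h0 => hO (by simp only [h0, zero_smul])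
        exact (psize_eq_of_Ddom_ne_zero h1).1.le
      rw [finsum_eq_sum_of_support_subset (s := insert L hfin.toFinset) _ (by
        intro O hO
        simpa using Or.inr hO)]
      rw [← Finset.add_sum_erase _ _ (Finset.mem_insert_self L _), Ddom_self ha, one_smul,
        add_sub_cancel_left]
      refine Submodule.sum_mem _ fun O hO => ?_
      by_cases h0 : Ddom L O = 0
      · rw [h0, zero_smul]; exact Submodule.zero_mem _
      · have h1 := psize_eq_of_Ddom_ne_zero h0
        exact Submodule.smul_mem _ _
          (Submodule.subset_span ⟨O, h1.1, h1.2 (Finset.ne_of_mem_erase hO), rfl⟩)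

theorem form_kfun_eq_zero {L : MPartition m} {p d : ℕ} (h : ¬ (psize L = p ∧ d < L.2.card))
    {f : R m} (hf : f ∈ upperSpan m p d) : form m (kfun L) f = 0 := by
  have h1 : upperSpan m p d ≤ LinearMap.ker (form m (kfun L)) := by
    refine Submodule.span_le.2 ?_
    rintro _ ⟨O, h1, h2, rfl⟩
    rw [SetLike.mem_coe, LinearMap.mem_ker, form_kfun, if_neg]
    rintro rfl
    exact h ⟨h1, h2⟩
  exact LinearMap.mem_ker.1 (h1 hf)

open Classical in
theorem form_kfun_sdual {L O : MPartition m} (h : ¬ (psize L = psize O ∧ O.2.card < L.2.card)) :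
    form m (kfun L) (sdual O) = if L = O then 1 else 0 := by
  have h1 := form_kfun_eq_zero h (sdual_sub_kfun_mem O)
  rw [map_sub, sub_eq_zero, form_kfun] at h1
  exact h1

open Classical in
-- Inversion of a unitriangular matrix by induction on the number of cells: only finitely many `O`
-- with fewer cells pair nontrivially with `kfun L` besides `L` itself, and their dual vectors are
-- subtracted. Without such a family `mschur` would be `0` by default.
theorem exists_form_sdual (L : MPartition m) :
    ∃ f : R m, ∀ O, form m f (sdual O) = if L = O then 1 else 0 := by
  obtain ⟨n, hn⟩ : ∃ n, n = L.2.card := ⟨_, rfl⟩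
  induction n using Nat.strong_induction_on generalizing L with
  | _ n ih =>
    have hfin : {O : MPartition m | psize L = psize O ∧ O.2.card < L.2.card}.Finite :=
      (finite_setOf_psize_le (psize L)).subset fun O hO => hO.1.ge
    -- The implication makes the choice total; the value `0` for larger `O` is never used.
    have hs : ∀ O : MPartition m, ∃ f : R m, O.2.card < L.2.card →
        ∀ P, form m f (sdual P) = if O = P then 1 else 0 := by
      intro O
      by_cases h : O.2.card < L.2.card
      · obtain ⟨f, hf⟩ := ih _ (hn ▸ h) O rfl
        exact ⟨f, fun _ => hf⟩
      · exact ⟨0, fun h' => absurd h' h⟩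
    choose s hs using hs
    refine ⟨kfun L - ∑ O ∈ hfin.toFinset, form m (kfun L) (sdual O) • s O, fun P => ?_⟩
    have h1 : ∑ O ∈ hfin.toFinset, form m (form m (kfun L) (sdual O) • s O) (sdual P) =
        if P ∈ hfin.toFinset then form m (kfun L) (sdual P) else 0 := by
      rw [← Finset.sum_ite_eq' hfin.toFinset P fun O => form m (kfun L) (sdual O)]
      refine Finset.sum_congr rfl fun O hO => ?_
      rw [map_smul, LinearMap.smul_apply, hs O (hfin.mem_toFinset.1 hO).2, smul_eq_mul, mul_ite,
        mul_one, mul_zero]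
    rw [map_sub, map_sum, LinearMap.sub_apply, LinearMap.sum_apply, h1]
    split_ifs with h2 h3 h3
    · subst h3
      exact absurd (hfin.mem_toFinset.1 h2).2 (lt_irrefl _)
    · exact sub_self _
    · rw [sub_zero, form_kfun_sdual (fun h => h2 (hfin.mem_toFinset.2 h)), if_pos h3]
    · rw [sub_zero, form_kfun_sdual (fun h => h2 (hfin.mem_toFinset.2 h)), if_neg h3]

/-- At constant total size, more cells in the partition means a smaller sum of the composition. That
sum therefore serves as a decreasing rank, bounded below by `0`. -/
theorem span_sdual : ⊤ ≤ Submodule.span K (Set.range (sdual (m := m))) := by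
  refine (linearIndependent_and_span_of_basis_triangular (kBasis m) sdual (fun L => ∑ i, L.1 i) 1
    (fun _ => one_ne_zero) fun L => ?_).2
  rw [Pi.one_apply, one_smul, kBasis_apply]
  refine Submodule.span_mono ?_ (sdual_sub_kfun_mem L)
  rintro _ ⟨O, h1, h2, rfl⟩
  refine ⟨O, ?_, kBasis_apply O⟩
  rw [psize, psize] at h1
  change ∑ i, O.1 i < ∑ i, L.1 i
  omega

theorem eq_of_form_sdual {f g : R m} (h : ∀ O, form m f (sdual O) = form m g (sdual O)) :
    f = g := by
  have h1 : form m f = form m g := LinearMap.ext_on_range (v := sdual) (top_le_iff.1 span_sdual) h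
  exact eq_of_form_kfun_right fun O => by rw [h1]

open Classical in
theorem form_mschur (L O : MPartition m) :
    form m (mschur L) (sdual O) = if L = O then 1 else 0 := by
  have h : ∃ s : MPartition m → R m, ∀ L O, form m (s L) (sdual O) = if L = O then 1 else 0 :=
    ⟨_, fun L => (exists_form_sdual L).choose_spec⟩
  rw [mschur, dif_pos h]
  exact h.choose_spec L O

theorem card_bot : (⊥ : YoungDiagram).card = 0 := rfl

/-- No partition has fewer cells than the empty one, so no correction term of any `sdual O` pairs
with `kfun (b, ⊥)`. -/
theorem mschur_bot (b : Fin m → ℕ) : mschur ((b, ⊥) : MPartition m) = kfun (b, ⊥) :=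
  eq_of_form_sdual fun O => by
    rw [form_mschur, form_kfun_sdual fun h => Nat.not_lt_zero _ (card_bot ▸ h.2)]

theorem schur_bot : schur m ⊥ = 1 := by
  have h : (⊥ : YoungDiagram).colLen 0 = 0 := by
    rw [YoungDiagram.colLen_eq_card, Finset.card_eq_zero]
    rfl
  have : IsEmpty (Fin ((⊥ : YoungDiagram).colLen 0)) := by rw [h]; exact Fin.isEmpty'
  rw [schur, Matrix.det_isEmpty]

theorem kfun_bot (b : Fin m → ℕ) : kfun ((b, ⊥) : MPartition m) = HL b := by
  rw [kfun, schur_bot, mul_one]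

end Dual

end MSym

theorem mainTheorem7 (m : ℕ) :
    (∀ b : Fin m → ℕ,
      MSym.mschur ((b, ⊥) : MSym.MPartition m) = MSym.kfun ((b, ⊥) : MSym.MPartition m) ∧
        MSym.kfun ((b, ⊥) : MSym.MPartition m) = MSym.HL b) ∧
      Set.range (MSym.HL : (Fin m → ℕ) → MSym.R m) ⊆
        Set.range (MSym.mschur : MSym.MPartition m → MSym.R m) := by
  refine ⟨fun b => ⟨MSym.mschur_bot b, MSym.kfun_bot b⟩, ?_⟩
  rintro _ ⟨b, rfl⟩
  exact ⟨(b, ⊥), (MSym.mschur_bot b).trans (MSym.kfun_bot b)⟩
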